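/- **Setting.** Let $d,m,n_1,n_2\ge 1$, let $D\subset\mathbb R^d$ be open and bounded, $x_1,\dots,x_{n_1}\in D$, $y_1,\dots,y_{n_2}\in\partial D$ with $\|x_p\|_2,\|y_q\|_2\le 1$, let $\gamma>0$, and let $f,g$ be real functions with $|f(x_p)|,|g(y_q)|\le F$ for all $p,q$. For $\theta=(w,a)$ with $w_1,\dots,w_m\in\mathbb R^{d+1}$ and $a\in\mathbb R^m$ let $$\phi(x;\theta)=\frac1{\sqrt m}\sum_{r=1}^m a_r\,\sigma\big(w_r^\top\tilde x\big),\qquad \tilde x=(x,1),$$ $$L(\theta)=\sum_{p=1}^{n_1}\frac1{2n_1}\big(\Delta\phi(x_p;\theta)-f(x_p)\big)^2+\sum_{q=1}^{n_2}\frac{\gamma}{2n_2}\big(\phi(y_q;\theta)-g(y_q)\big)^2 ,$$ where $\Delta$ is the Laplacian in $x$. (This is the loss of a physics-informed network for $\Delta u=f$ in $D$, $u=g$ on $\partial D$.) Put $s_p=n_1^{-1/2}(\Delta\phi(x_p;\theta)-f(x_p))$ and $h_q=(\gamma/n_2)^{1/2}(\phi(y_q;\theta)-g(y_q))$. *Initialization.*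 $\theta(0)$ is random: all $w_r(0)\sim\mathcal N(0,I_{d+1})$, all $a_r(0)\sim\mathrm{Unif}\{-1,1\}$, all independent. *Activation.* $\sigma\in C^3(\mathbb R)$, and for every $M>0$ there is $C_M\ge 1$ such that for $k=0,1,2,3$: $|\sigma^{(k)}(z_1)-\sigma^{(k)}(z_2)|\le C_M|z_1-z_2|$ whenever $|z_1|,|z_2|\le M$; $|\sigma^{(k)}(0)|\le C_M$; and $C_M\le C(1+M^\ell)$ for all $M>0$, with $C,\ell>0$. *Gram matrices.* Let $D_w$ and $D_a$ be the matrices whose $n_1+n_2$ columns are the derivatives of $s_1,\dots,s_{n_1},h_1,\dots,h_{n_2}$ with respect to $w$ and to $a$, and let $G_w=D_w^\top D_w$, $G_a=D_a^\top D_a$, $G_w^\infty=\mathbb E[G_w(\theta(0))]$, $G_a^\infty=\mathbb E[G_a(\theta(0))]$ (these do not depend on $m$). Assume that $G_w^\infty$ and $G_a^\infty$ are positive definite, with smallest eigenvalues $\lambda_w,\lambda_a>0$, and put $\lambda_\theta=\lambda_w+\lambda_a$. *SGD.* Fix batch sizes $1\le b_1\le n_1$, $1\le b_2\le n_2$ and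 a step size $\eta>0$. At each iteration $t$ draw $\mathcal I_t\subset\{1,\dots,n_1\}$ with $|\mathcal I_t|=b_1$ and $\mathcal J_t\subset\{1,\dots,n_2\}$ with $|\mathcal J_t|=b_2$ uniformly, independently of each other, of the other iterations and of $\theta(0)$, and put $\theta(t+1)=\theta(t)-\eta\nabla\widetilde L_t(\theta(t))$, where $$\widetilde L_t(\theta)=\sum_{p\in\mathcal I_t}\frac1{2b_1}\big(\Delta\phi(x_p;\theta)-f(x_p)\big)^2+\sum_{q\in\mathcal J_t}\frac{\gamma}{2b_2}\big(\phi(y_q;\theta)-g(y_q)\big)^2 .$$ Write $L(t)=L(\theta(t))$. **Theorem.** For given $\gamma>0$, $F\ge0$, $C,\ell>0$ there is $c_0>0$ such that for all $c_w,c_a\in(0,c_0]$ there are $K,c>0$ with the following property. The constants $c_0,K,c$ depend only on the quantities quantified before them; in particular they do not depend on $d,m,n_1,n_2$, the batch sizes, the sampling points, $\delta$, $\tilde\delta$, $\eta$, $\lambda_w$, $\lambda_a$. In the setting above let $\delta,\tilde\delta\in(0,1)$, $$B=1+\sqrt{2(d+1)\log\frac{2m(d+1)}{\delta}},\qquad R_w=c_w\frac{\min\{\lambda_w,\lambda_a\}}{C_B^2B^6},\qquad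 R_a=c_a\frac{\min\{\lambda_w,\lambda_a\}}{C_B^2B^6},$$ where $C_B$ is $C_M$ for $M=B$, and let $T\in\mathbb N\cup\{\infty\}$ be the first time at which one of the inequalities $$\|w_r(t)-w_r(0)\|_2\le R_w,\quad |a_r(t)-a_r(0)|\le R_a\quad(1\le r\le m),\qquad L(t)\le\sqrt m\,L(0)$$ fails ($T=\infty$ if this never happens). Suppose that $$m\ge K\,\frac{C_B^4d^2}{\min\{\lambda_w^2,\lambda_a^2\}}\log^2\Big(\frac{n_1+n_2}\delta\Big)\max\Big\{\log\Big(\frac{n_1+n_2}\delta\Big),\frac{C_B^4B^{18}}{\tilde\delta^2\lambda_\theta^2}\Big\},\qquad \eta\le c\,\frac{\lambda_\theta}{C_B^4B^{12}} .$$ Then with probability at least $1-2\delta$ over the initialization $\theta(0)$ the following holds, where $\mathbb P$ and $\mathbb E$ refer to the random choice of the mini-batches for given $\theta(0)$: $$\mathbb P(T=\infty)\ge(1-\tilde\delta)^2,\qquad\text{and}\qquad \mathbb E\big[L(t)\,\mathbf 1_{\{T>t\}}\big]\le\Big(1-\eta\frac{\lambda_\theta}2\Big)^tL(0)\quad\text{for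 all }t\in\mathbb N .$$ In particular, $\mathbb E[L(t)\,\mathbf 1_{\{T=\infty\}}]\le(1-\eta\lambda_\theta/2)^tL(0)$ for all $t$. -/

import Mathlib

open MeasureTheory ProbabilityTheory

noncomputable section

namespace PINN

/-- The data of the discretized Poisson-Dirichlet problem `Δu = f` in the domain, `u = g` on its
boundary, together with the activation function: `x p` are the interior and `y q` the boundary
sampling points, and `γ` is the weight of the boundary loss. -/
structure Problem (d n₁ n₂ : ℕ) where
  σ : ℝ → ℝ
  γ : ℝ
  f : EuclideanSpace ℝ (Fin d) → ℝ
  g : EuclideanSpace ℝ (Fin d) → ℝ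
  x : Fin n₁ → EuclideanSpace ℝ (Fin d)
  y : Fin n₂ → EuclideanSpace ℝ (Fin d)

/-- The parameters `θ = (w, a)` of a two-layer network of width `m` on `ℝᵈ`; the last coordinate
of each `w r` is the bias. -/
abbrev Params (m d : ℕ) : Type :=
  (Fin m → EuclideanSpace ℝ (Fin (d + 1))) × (Fin m → ℝ)

/-- The extended point `(x, 1)`. -/
def extendedPoint {d : ℕ} (x : EuclideanSpace ℝ (Fin d)) : EuclideanSpace ℝ (Fin (d + 1)) :=
  WithLp.toLp 2 (Fin.snoc (α := fun _ => ℝ) (fun i => x i) 1)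

/-- The two-layer network `φ(x; w, a) = m^{-1/2} ∑ᵣ aᵣ σ(wᵣᵀ (x, 1))`. -/
def network {m d : ℕ} (σ : ℝ → ℝ) (θ : Params m d) (x : EuclideanSpace ℝ (Fin d)) : ℝ :=
  1 / √(m : ℝ) * ∑ r, θ.2 r * σ (inner ℝ (θ.1 r) (extendedPoint x))

/-- Partial gradient with respect to `wᵣ` of a function of the parameters. -/
def gradW {m d : ℕ} (F : Params m d → ℝ) (θ : Params m d) (r : Fin m) :
    EuclideanSpace ℝ (Fin (d + 1)) :=
  gradient (fun v => F (Function.update θ.1 r v, θ.2)) (θ.1 r)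

/-- Partial derivative with respect to `aᵣ` of a function of the parameters. -/
def gradA {m d : ℕ} (F : Params m d → ℝ) (θ : Params m d) (r : Fin m) : ℝ :=
  deriv (fun b => F (θ.1, Function.update θ.2 r b)) (θ.2 r)

namespace Problem

variable {d n₁ n₂ m : ℕ}

/-- The residual `Δφ(x_p) - f(x_p)` of the equation at an interior sampling point. -/
def interiorResidual (P : Problem d n₁ n₂) (θ : Params m d) (p : Fin n₁) : ℝ :=
  Laplacian.laplacian (network P.σ θ) (P.x p) - P.f (P.x p)

/-- The residual `φ(y_q) - g(y_q)` of the boundary condition at a boundary sampling point. -/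
def boundaryResidual (P : Problem d n₁ n₂) (θ : Params m d) (q : Fin n₂) : ℝ :=
  network P.σ θ (P.y q) - P.g (P.y q)

/-- The empirical loss `L(w, a)`. -/
def loss (P : Problem d n₁ n₂) (θ : Params m d) : ℝ :=
  ∑ p, 1 / (2 * (n₁ : ℝ)) * P.interiorResidual θ p ^ 2 +
    ∑ q, P.γ / (2 * (n₂ : ℝ)) * P.boundaryResidual θ q ^ 2

/-- The mini-batch loss for the index sets `S.1 ⊆ [n₁]` and `S.2 ⊆ [n₂]`. -/
def batchLoss (P : Problem d n₁ n₂) (S : Finset (Fin n₁) × Finset (Fin n₂)) (θ : Params m d) : ℝ :=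
  ∑ p ∈ S.1, 1 / (2 * (S.1.card : ℝ)) * P.interiorResidual θ p ^ 2 +
    ∑ q ∈ S.2, P.γ / (2 * (S.2.card : ℝ)) * P.boundaryResidual θ q ^ 2

/-- The loss vector `(s₁, …, s_{n₁}, h₁, …, h_{n₂})`. -/
def lossVector (P : Problem d n₁ n₂) (j : Fin n₁ ⊕ Fin n₂) (θ : Params m d) : ℝ :=
  Sum.elim (fun p => 1 / √(n₁ : ℝ) * P.interiorResidual θ p)
    (fun q => √(P.γ / (n₂ : ℝ)) * P.boundaryResidual θ q) j

/-- The Gram matrix `G_w(θ) = D_wᵀ D_w`, where the columns of `D_w` are the derivatives of the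
entries of the loss vector with respect to `w`. -/
def gramW (P : Problem d n₁ n₂) (θ : Params m d) : Matrix (Fin n₁ ⊕ Fin n₂) (Fin n₁ ⊕ Fin n₂) ℝ :=
  Matrix.of fun j k =>
    ∑ r, inner ℝ (gradW (P.lossVector j) θ r) (gradW (P.lossVector k) θ r)

/-- The Gram matrix `G_a(θ) = D_aᵀ D_a`. -/
def gramA (P : Problem d n₁ n₂) (θ : Params m d) : Matrix (Fin n₁ ⊕ Fin n₂) (Fin n₁ ⊕ Fin n₂) ℝ :=
  Matrix.of fun j k => ∑ r, gradA (P.lossVector j) θ r * gradA (P.lossVector k) θ r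

end Problem

/-- The uniform distribution on `{-1, 1}`. -/
def rademacher : Measure ℝ :=
  (2⁻¹ : ENNReal) • Measure.dirac (-1) + (2⁻¹ : ENNReal) • Measure.dirac 1

/-- The law of the initialization: all `wᵣ(0)` are standard Gaussian in `ℝ^{d+1}`, all `aᵣ(0)` are
Rademacher, and everything is independent. -/
def initLaw (m d : ℕ) : Measure (Params m d) :=
  (Measure.pi fun _ : Fin m => stdGaussian (EuclideanSpace ℝ (Fin (d + 1)))).prod
    (Measure.pi fun _ : Fin m => rademacher)

/-- The uniform distribution on the subsets of `[n]` with `b` elements. -/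
def batchLaw {n b : ℕ} (hb : b ≤ n) : Measure (Finset (Fin n)) :=
  (PMF.uniformOfFinset (Finset.powersetCard b (Finset.univ : Finset (Fin n)))
    (Finset.powersetCard_nonempty.2 (by simpa using hb))).toMeasure

/-- The law of the sequence of mini-batches: at every iteration a pair of independent uniformly
chosen index sets of the sizes `b₁`, `b₂`, independent over the iterations. -/
def batchesLaw {n₁ n₂ b₁ b₂ : ℕ} (h₁ : b₁ ≤ n₁) (h₂ : b₂ ≤ n₂) :
    Measure (ℕ → Finset (Fin n₁) × Finset (Fin n₂)) :=
  Measure.infinitePi fun _ : ℕ => (batchLaw h₁).prod (batchLaw h₂)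

/-- The smallest eigenvalue of a real symmetric matrix. -/
def lambdaMin {ι : Type} [Fintype ι] [DecidableEq ι] (A : Matrix ι ι ℝ) : ℝ :=
  sInf (spectrum ℝ A)

namespace Problem

variable {d n₁ n₂ m : ℕ}

/-- The infinite Gram matrix `G_w^∞ = E[G_w(θ(0))]`; it does not depend on the width `m ≥ 1`. -/
def gramWInf (P : Problem d n₁ n₂) (m : ℕ) : Matrix (Fin n₁ ⊕ Fin n₂) (Fin n₁ ⊕ Fin n₂) ℝ :=
  Matrix.of fun j k => ∫ θ, P.gramW θ j k ∂(initLaw m d)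

/-- The infinite Gram matrix `G_a^∞ = E[G_a(θ(0))]`; it does not depend on the width `m ≥ 1`. -/
def gramAInf (P : Problem d n₁ n₂) (m : ℕ) : Matrix (Fin n₁ ⊕ Fin n₂) (Fin n₁ ⊕ Fin n₂) ℝ :=
  Matrix.of fun j k => ∫ θ, P.gramA θ j k ∂(initLaw m d)

/-- The iterates `θ(t)` of mini-batch SGD with step size `η`, started at `θ₀`, along the sequence
`S` of mini-batches. -/
def sgd (P : Problem d n₁ n₂) (η : ℝ) (θ₀ : Params m d)
    (S : ℕ → Finset (Fin n₁) × Finset (Fin n₂)) : ℕ → Params m d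
  | 0 => θ₀
  | t + 1 =>
    (fun r => (P.sgd η θ₀ S t).1 r - η • gradW (P.batchLoss (S t)) (P.sgd η θ₀ S t) r,
     fun r => (P.sgd η θ₀ S t).2 r - η * gradA (P.batchLoss (S t)) (P.sgd η θ₀ S t) r)

/-- The first time `T ∈ ℕ ∪ {∞}` at which one of the inequalities `‖wᵣ(t) - wᵣ(0)‖ ≤ Rw`,
`|aᵣ(t) - aᵣ(0)| ≤ Ra` for all `r`, `L(t) ≤ √m L(0)` fails. -/
def stoppingTime (P : Problem d n₁ n₂) (η Rw Ra : ℝ) (θ₀ : Params m d)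
    (S : ℕ → Finset (Fin n₁) × Finset (Fin n₂)) : ℕ∞ :=
  sInf ((fun t : ℕ => (t : ℕ∞)) '' {t : ℕ |
    ¬ ((∀ r, ‖(P.sgd η θ₀ S t).1 r - θ₀.1 r‖ ≤ Rw ∧ |(P.sgd η θ₀ S t).2 r - θ₀.2 r| ≤ Ra) ∧
      P.loss (P.sgd η θ₀ S t) ≤ √(m : ℝ) * P.loss θ₀)})

/-- The random variable `L(t) · 1_{T > t}`. -/
def stoppedLoss (P : Problem d n₁ n₂) (η Rw Ra : ℝ) (θ₀ : Params m d) (t : ℕ)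
    (S : ℕ → Finset (Fin n₁) × Finset (Fin n₂)) : ℝ :=
  Set.indicator {S | (t : ℕ∞) < P.stoppingTime η Rw Ra θ₀ S}
    (fun S => P.loss (P.sgd η θ₀ S t)) S

end Problem

/-- The assumption on the activation function: `σ` is three times continuously differentiable, and
`σ, σ', σ'', σ'''` are Lipschitz on `[-M, M]` with a constant `C_M = CM M ≥ 1` that also bounds
their values at `0` and grows at most polynomially, `C_M ≤ C (1 + M ^ ℓ)`. -/
structure ActivationBound (σ : ℝ → ℝ) (CM : ℝ → ℝ) (C ℓ : ℝ) : Prop where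
  contDiff : ContDiff ℝ 3 σ
  lipschitz : ∀ M : ℝ, 0 < M → ∀ k : ℕ, k ≤ 3 → ∀ z₁ z₂ : ℝ, |z₁| ≤ M → |z₂| ≤ M →
    |iteratedDeriv k σ z₁ - iteratedDeriv k σ z₂| ≤ CM M * |z₁ - z₂|
  one_le : ∀ M : ℝ, 0 < M → 1 ≤ CM M
  at_zero : ∀ M : ℝ, 0 < M → ∀ k : ℕ, k ≤ 3 → |iteratedDeriv k σ 0| ≤ CM M
  growth : ∀ M : ℝ, 0 < M → CM M ≤ C * (1 + M ^ ℓ)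

/-- `B = 1 + √(2 (d + 1) log (2 m (d + 1) / δ))`. -/
def radius (m d : ℕ) (δ : ℝ) : ℝ :=
  1 + √(2 * ((d : ℝ) + 1) * Real.log (2 * (m : ℝ) * ((d : ℝ) + 1) / δ))

end PINN

end

/-! The Laplacian acts on each neuron separately: it turns `σ(w·x̃)` into `‖w'‖² σ''(w·x̃)`, where
`w'` is `w` without its bias. Interior and boundary residuals are therefore outputs of one two-layer
model `m^{-1/2} ∑ aᵣ ψⱼ(wᵣ) - τⱼ` with features `ψⱼ`, and the sampled loss is half a weighted sum of
their squares, with random weights of mean one. The argument is carried out for such a model and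
specialized afterwards.

Descent. Let `Q` be of order `C_B B³`, the size of the features and their gradients on the region
where the inner weights live. A Taylor expansion bounds the loss after one step by `L - η⟨∇L, ∇L̃⟩ +
O(Q⁴η²)L̃`. The average over the batch is `L - η lᵀ(G_w + G_a)l + O(Q⁴η²)L`, with `l` the loss
vector, which is at most `(1 - ηλ_θ/2)L` if `G_w + G_a ≥ λ_θ/2` and `η` is small
(`integral_stepBound_le`). This lower bound holds near the initialization, since the Gram matrices
are Lipschitz in the parameters (`quadW_perturb`, `quadA_perturb`).

Stopping (`stopped_descent`). The process can leave the controlled regime in two ways. If the loss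
exceeds `√m L(0)` while the parameters are still close to their start, the supermartingale property
charges this event: its probability is at most `1/√m`. If the parameters leave their balls, the
total movement was large. One step moves a neuron by at most a multiple of `ηQ√(L̃/m)`; by the
geometric decay the expected sum of these bounds is of order `Q√L(0)/(√m λ_θ)`, in which `η`
cancels, and Markov's inequality applies. The one-step bound requires the next iterate to be close
to the start, so the stopped recursion is run with an upper bound that is nonnegative in all cases.

Initialization. With probability at least `1 - 2δ` three things hold. All `wᵣ` lie in a region of
radius `B - 1` (Gaussian tails). All entries of the Gram matrices are close to their means
(Hoeffding for truncated kernels, moment bounds for the truncation error). The loss is of order `d²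
log((n₁+n₂)/δ)`, because the outputs are Rademacher sums conditionally on the `wᵣ`. The scaling of
the loss vector keeps the numbers of sampling points out of the quadratic forms.

Constants. `λ_w` and `λ_a` are bounded by a constant depending only on `γ, C, ℓ`, as the diagonal
entry of a boundary point shows. This permits a choice of `c₀, K, c` independent of the dimension
and the samples. -/

noncomputable section
namespace PINN

/-! ### Stopped stochastic descent with finitely many choices per step -/

section StoppedProcess

variable {β : Type*}

/-- A function of a sequence that depends only on the first `t` entries. -/
def PrefixDep {κ : Type*} (t : ℕ) (F : (ℕ → β) → κ) : Prop :=
  ∀ S S' : ℕ → β, (∀ i < t, S i = S' i) → F S = F S'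

theorem PrefixDep.mono {κ : Type*} {t u : ℕ} {F : (ℕ → β) → κ} (h : PrefixDep t F) (htu : t ≤ u) :
    PrefixDep u F := fun S S' hS => h S S' fun i hi => hS i (hi.trans_le htu)

/-- The entries from `t` on may be replaced by one fixed element. For finite `β` the space of
prefixes is finite, so every function of a prefix is measurable and bounded, and no regularity of
the loss in the parameters is needed below. -/
theorem PrefixDep.exists_eq_comp_restrict {κ : Type*} [Nonempty β] {t : ℕ} {F : (ℕ → β) → κ}
    (h : PrefixDep t F) :
    ∃ g : (Finset.range t → β) → κ, ∀ S, F S = g fun i => S i := by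
  classical
  obtain ⟨b⟩ := ‹Nonempty β›
  refine ⟨fun p => F fun i => if hi : i ∈ Finset.range t then p ⟨i, hi⟩ else b, fun S => ?_⟩
  refine h _ _ fun i hi => ?_
  simp [hi]

theorem indepFun_prefix [MeasurableSpace β] {ν : Measure β} [IsProbabilityMeasure ν] (t : ℕ) :
    IndepFun (fun (S : ℕ → β) (i : Finset.range t) => S i) (fun S => S t)
      (Measure.infinitePi fun _ : ℕ => ν) := by
  have h := iIndepFun_infinitePi (P := fun _ : ℕ => ν) (X := fun _ (b : β) => b)
    (fun _ => measurable_id)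
  have h2 := h.indepFun_finset (Finset.range t) {t} (by simp) fun i => measurable_pi_apply i
  exact h2.comp (φ := id) (ψ := fun p : (({t} : Finset ℕ) → β) => p ⟨t, by simp⟩) measurable_id
    (measurable_pi_apply _)

variable [Fintype β] [MeasurableSpace β] [MeasurableSingletonClass β]

theorem PrefixDep.measurable {κ : Type*} [MeasurableSpace κ] [Nonempty β] {t : ℕ}
    {F : (ℕ → β) → κ} (h : PrefixDep t F) : Measurable F := by
  obtain ⟨g, hg⟩ := h.exists_eq_comp_restrict
  rw [funext hg]
  exact (measurable_of_countable g).comp (by fun_prop)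

theorem PrefixDep.measurableSet [Nonempty β] {t : ℕ} {F : (ℕ → β) → Prop} (h : PrefixDep t F) :
    MeasurableSet {S | F S} := h.measurable.setOf

variable {ν : Measure β} [IsProbabilityMeasure ν]

theorem PrefixDep.integrable {t : ℕ} {F : (ℕ → β) → ℝ} (h : PrefixDep t F) :
    Integrable F (Measure.infinitePi fun _ : ℕ => ν) := by
  have : Nonempty β := nonempty_of_isProbabilityMeasure ν
  have hm := h.measurable
  obtain ⟨g, hg⟩ := h.exists_eq_comp_restrict
  obtain ⟨C, hC⟩ := (Set.finite_range fun p => ‖g p‖).bddAbove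
  refine Integrable.of_bound hm.aestronglyMeasurable C (ae_of_all _ fun S => ?_)
  rw [hg]
  exact hC ⟨_, rfl⟩

/-- Integrating out the entry number `t` of the sequence. -/
theorem integral_prefix_apply {t : ℕ} {F : (ℕ → β) → β → ℝ}
    (h : ∀ s, PrefixDep t fun S => F S s) :
    ∫ S, F S (S t) ∂(Measure.infinitePi fun _ : ℕ => ν) =
      ∫ S, ∫ s, F S s ∂ν ∂(Measure.infinitePi fun _ : ℕ => ν) := by
  classical
  have : Nonempty β := nonempty_of_isProbabilityMeasure ν
  -- Splitting over the finitely many values of `S t` leaves products of a prefix function and a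
  -- function of `S t`, which are independent.
  have h1 : ∀ S : ℕ → β, F S (S t) = ∑ s, F S s * (if S t = s then 1 else 0) := by
    intro S; simp
  have hi : ∀ s, PrefixDep (t + 1) fun S : ℕ → β => F S s * (if S t = s then (1 : ℝ) else 0) := by
    intro s S S' hS
    have h2 := h s S S' fun i hi => hS i (by omega)
    simp only at h2
    simp only [h2, hS t (by omega)]
  simp_rw [h1]
  rw [integral_finsetSum _ fun s _ => (hi s).integrable]
  simp_rw [integral_fintype (μ := ν) Integrable.of_finite]
  simp_rw [smul_eq_mul]
  rw [integral_finsetSum _ fun s _ => ((h s).integrable.const_mul (ν.real {s}))]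
  refine Finset.sum_congr rfl fun s _ => ?_
  obtain ⟨g, hg⟩ := (h s).exists_eq_comp_restrict
  have hind := (indepFun_prefix (ν := ν) t).comp (measurable_of_countable g)
    (measurable_of_countable fun b : β => if b = s then (1 : ℝ) else 0)
  have h3 := hind.integral_fun_mul_eq_mul_integral
    ((measurable_of_countable g).comp (by fun_prop)).aestronglyMeasurable
    ((measurable_of_countable _).comp (by fun_prop)).aestronglyMeasurable
  simp only [Function.comp_apply] at h3
  simp_rw [hg, h3]
  rw [integral_const_mul, mul_comm]
  congr 1
  have h5 : ∫ S : ℕ → β, (if S t = s then (1 : ℝ) else 0) ∂(Measure.infinitePi fun _ : ℕ => ν) =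
      ∫ b, (if b = s then (1 : ℝ) else 0) ∂ν := by
    conv_rhs => rw [← Measure.infinitePi_map_eval (fun _ : ℕ => ν) t]
    rw [integral_map (measurable_pi_apply t).aemeasurable
      (measurable_of_countable _).aestronglyMeasurable]
  rw [h5, integral_fintype Integrable.of_finite]
  simp

variable {X : Type*}

/-- The expected loss of a stopped stochastic descent decays geometrically, and the process is
stopped with small probability. -/
theorem stopped_descent {step : β → X → X} {Θ : (ℕ → β) → ℕ → X} {x₀ : X} {Lo : X → ℝ}
    {U Bt : β → X → ℝ} {good : X → Prop} {ρ M α R : ℝ}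
    (hΘ₀ : ∀ S, Θ S 0 = x₀) (hΘ : ∀ S t, Θ S (t + 1) = step (S t) (Θ S t))
    (hLo : ∀ x, 0 ≤ Lo x) (hBt : ∀ s x, 0 ≤ Bt s x)
    (hρ : 0 < ρ) (hρ1 : ρ < 1) (hM : 1 ≤ M) (hα : 0 ≤ α) (hR : 0 < R)
    (hgood : good x₀) (hL₀ : 0 < Lo x₀)
    (hU : ∀ x, good x → Lo x ≤ M * Lo x₀ → ∀ s, 0 ≤ U s x)
    (hstep : ∀ x, good x → Lo x ≤ M * Lo x₀ → ∀ s, good (step s x) → Lo (step s x) ≤ U s x)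
    (hUint : ∀ x, good x → Lo x ≤ M * Lo x₀ → ∫ s, U s x ∂ν ≤ ρ * Lo x)
    (hBint : ∀ x, ∫ s, Bt s x ∂ν ≤ Lo x)
    (hmove : ∀ S t, (∀ u ≤ t, good (Θ S u)) →
      ∑ u ∈ Finset.range (t + 1), α * √(Bt (S u) (Θ S u)) ≤ R → good (Θ S (t + 1))) :
    (∀ t, Integrable ({S | ∀ u ≤ t, good (Θ S u) ∧ Lo (Θ S u) ≤ M * Lo x₀}.indicator
        fun S => Lo (Θ S t)) (Measure.infinitePi fun _ : ℕ => ν) ∧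
      ∫ S, {S | ∀ u ≤ t, good (Θ S u) ∧ Lo (Θ S u) ≤ M * Lo x₀}.indicator
        (fun S => Lo (Θ S t)) S ∂(Measure.infinitePi fun _ : ℕ => ν) ≤ ρ ^ t * Lo x₀) ∧
    1 - (2 * α * √(Lo x₀) / ((1 - ρ) * R) + 1 / M) ≤
      (Measure.infinitePi fun _ : ℕ => ν).real
        {S | ∀ u, good (Θ S u) ∧ Lo (Θ S u) ≤ M * Lo x₀} := by
  classical
  have : Nonempty β := nonempty_of_isProbabilityMeasure ν
  set P := Measure.infinitePi fun _ : ℕ => ν with hP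
  set K := M * Lo x₀ with hK
  have hK0 : 0 < K := by positivity
  have hdep : ∀ t, PrefixDep t fun S => Θ S t := by
    intro t
    induction t with
    | zero => intro S S' _; simp [hΘ₀]
    | succ t ih =>
      intro S S' hS
      have := ih S S' fun i hi => hS i (by omega)
      simp only at this
      simp only [hΘ, this, hS t (by omega)]
  let al : ℕ → (ℕ → β) → Prop := fun t S => ∀ u ≤ t, good (Θ S u) ∧ Lo (Θ S u) ≤ K
  have haldep : ∀ t, PrefixDep t (al t) := by
    intro t S S' hS
    simp only [al]
    refine forall_congr fun u => forall_congr fun hu => ?_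
    have := hdep u S S' fun i hi => hS i (by omega)
    simp only at this
    rw [this]
  let a : ℕ → (ℕ → β) → ℝ := fun t S => if al t S then Lo (Θ S t) else 0
  have hadep : ∀ t, PrefixDep t (a t) := by
    intro t S S' hS
    have h1 := hdep t S S' hS
    have h2 := haldep t S S' hS
    simp only at h1
    simp only [a, h1, h2]
  have ha0 : ∀ t S, 0 ≤ a t S := by
    intro t S; simp only [a]; split_ifs <;> simp [hLo]
  -- the loss exits the region while the parameters stay good
  let ex : ℕ → (ℕ → β) → Prop := fun t S => al t S ∧ good (Θ S (t + 1)) ∧ K < Lo (Θ S (t + 1))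
  let le : ℕ → (ℕ → β) → Prop := fun t S => ∃ u < t, ex u S
  have hexdep : ∀ t, PrefixDep (t + 1) (ex t) := by
    intro t S S' hS
    have h1 := hdep (t + 1) S S' hS
    have h2 := (haldep t).mono t.le_succ S S' hS
    simp only at h1
    simp only [ex, h1, h2]
  have hledep : ∀ t, PrefixDep t (le t) := by
    intro t S S' hS
    simp only [le]
    refine propext (exists_congr fun u => and_congr_right fun hu => ?_)
    rw [hexdep u S S' fun i hi => hS i (by omega)]
  -- Supermartingale step with bookkeeping: the mass lost by the stopped loss pays `K` times the
  -- probability that the loss crosses `K` at this step.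
  have hstepE : ∀ t, ∫ S, a (t + 1) S ∂P + K * P.real {S | ex t S} ≤ ρ * ∫ S, a t S ∂P := by
    intro t
    let G : (ℕ → β) → β → ℝ := fun S s => if al t S then U s (Θ S t) else 0
    have hGdep : ∀ s, PrefixDep t fun S => G S s := by
      intro s S S' hS
      have h1 := hdep t S S' hS
      have h2 := haldep t S S' hS
      simp only at h1
      simp only [G, h1, h2]
    have hGdep' : PrefixDep (t + 1) fun S => G S (S t) := by
      intro S S' hS
      have := hGdep (S t) S S' fun i hi => hS i (by omega)
      simp only at this ⊢
      rw [this, hS t (by omega)]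
    have hexi : Integrable ({S | ex t S}.indicator fun _ => K) P :=
      (integrable_const K).indicator (hexdep t).measurableSet
    have h1 : ∀ S, a (t + 1) S + {S | ex t S}.indicator (fun _ => K) S ≤ G S (S t) := by
      intro S
      simp only [a, G, Set.indicator_apply, Set.mem_ofPred_eq]
      by_cases hal : al t S
      · have ht := hal t le_rfl
        have hU' := hU _ ht.1 ht.2 (S t)
        have hs' := hstep _ ht.1 ht.2 (S t)
        rw [← hΘ] at hs'
        rw [if_pos hal]
        by_cases hg : good (Θ S (t + 1))
        · by_cases hl : Lo (Θ S (t + 1)) ≤ K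
          · have hal1 : ¬ ex t S := fun h => absurd h.2.2 (not_lt.2 hl)
            rw [if_neg hal1]
            split_ifs <;> linarith [hs' hg]
          · have hal1 : ¬ al (t + 1) S := fun h => hl (h _ le_rfl).2
            rw [if_neg hal1]
            split_ifs with h
            · linarith [hs' hg, h.2.2]
            · linarith
        -- The parameters have left the good set, so nothing bounds the new loss; both terms on the
        -- left vanish, and `U ≥ 0` is enough.
        · have hal1 : ¬ al (t + 1) S := fun h => hg (h _ le_rfl).1
          have hex1 : ¬ ex t S := fun h => hg h.2.1
          rw [if_neg hal1, if_neg hex1]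
          linarith
      · have hal1 : ¬ al (t + 1) S := fun h => hal fun u hu => h u (by omega)
        have hex1 : ¬ ex t S := fun h => hal h.1
        simp [hal, hal1, hex1]
    have h2 := integral_mono (μ := P) ((hadep (t + 1)).integrable.add hexi) hGdep'.integrable h1
    simp only [Pi.add_apply] at h2
    rw [integral_add (hadep (t + 1)).integrable hexi,
      integral_indicator_const _ (hexdep t).measurableSet, integral_prefix_apply hGdep,
      smul_eq_mul, mul_comm _ K] at h2
    refine h2.trans ?_
    rw [← integral_const_mul]
    have hFdep : PrefixDep t fun S => ∫ s, G S s ∂ν := by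
      intro S S' hS
      have := fun s => hGdep s S S' hS
      simp only at this ⊢
      simp_rw [this]
    refine integral_mono hFdep.integrable ((hadep t).integrable.const_mul ρ) fun S => ?_
    simp only [G, a]
    split_ifs with hal
    · exact hUint _ (hal t le_rfl).1 (hal t le_rfl).2
    · simp
  have hae : ∀ t, ∫ S, a t S ∂P ≤ ρ ^ t * Lo x₀ := by
    intro t
    induction t with
    | zero =>
      have : ∀ S, a 0 S ≤ Lo x₀ := by
        intro S
        simp only [a, hΘ₀]
        split_ifs
        · exact le_rfl
        · exact hL₀.le
      simpa using integral_mono (μ := P) (hadep 0).integrable (integrable_const (Lo x₀)) this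
    | succ t ih =>
      have h1 := hstepE t
      have h2 : 0 ≤ K * P.real {S | ex t S} := by positivity
      calc ∫ S, a (t + 1) S ∂P ≤ ρ * ∫ S, a t S ∂P := by linarith
        _ ≤ ρ * (ρ ^ t * Lo x₀) := by gcongr
        _ = ρ ^ (t + 1) * Lo x₀ := by ring
  -- Summing `hstepE` over the steps, with `ρ ≤ 1`: all crossings together are paid by the initial
  -- loss.
  have hle : ∀ t, ∫ S, a t S ∂P + K * P.real {S | le t S} ≤ Lo x₀ := by
    intro t
    induction t with
    | zero => simpa [le] using hae 0
    | succ t ih =>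
      have h1 := hstepE t
      have h0 : 0 ≤ ∫ S, a t S ∂P := integral_nonneg (ha0 t)
      have h2 : P.real {S | le (t + 1) S} ≤ P.real {S | le t S} + P.real {S | ex t S} := by
        refine (measureReal_mono ?_).trans (measureReal_union_le _ _)
        rintro S ⟨u, hu, hS⟩
        rcases Nat.lt_succ_iff_lt_or_eq.1 hu with h | rfl
        · exact Or.inl ⟨u, h, hS⟩
        · exact Or.inr hS
      have h3 := mul_le_mul_of_nonneg_left h2 hK0.le
      have h4 : ρ * ∫ S, a t S ∂P ≤ ∫ S, a t S ∂P := mul_le_of_le_one_left h0 hρ1.le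
      linarith
  have hle' : ∀ t, P.real {S | le t S} ≤ 1 / M := by
    intro t
    have h1 := hle t
    have h0 : 0 ≤ ∫ S, a t S ∂P := integral_nonneg (ha0 t)
    have h2 : M * P.real {S | le t S} * Lo x₀ ≤ 1 * Lo x₀ := by
      rw [hK] at h1; linarith
    have h3 := le_of_mul_le_mul_right h2 hL₀
    rw [le_div_iff₀ (by linarith)]; linarith
  -- the total movement
  let y : ℕ → (ℕ → β) → ℝ := fun t S => if al t S then α * √(Bt (S t) (Θ S t)) else 0
  have hydep : ∀ t, PrefixDep (t + 1) (y t) := by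
    intro t S S' hS
    have h1 := (hdep t).mono t.le_succ S S' hS
    have h2 := (haldep t).mono t.le_succ S S' hS
    simp only at h1
    simp only [y, h1, h2, hS t (by omega)]
  have hy0 : ∀ t S, 0 ≤ y t S := by
    intro t S; simp only [y]; split_ifs <;> positivity
  have hy : ∀ t, ∫ S, y t S ∂P ≤ α * √(Lo x₀) * √ρ ^ t := by
    intro t
    let G : (ℕ → β) → β → ℝ := fun S s => if al t S then Bt s (Θ S t) else 0
    have hGdep : ∀ s, PrefixDep t fun S => G S s := by
      intro s S S' hS
      have h1 := hdep t S S' hS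
      have h2 := haldep t S S' hS
      simp only at h1
      simp only [G, h1, h2]
    have hGdep' : PrefixDep (t + 1) fun S => G S (S t) := by
      intro S S' hS
      have := hGdep (S t) S S' fun i hi => hS i (by omega)
      simp only at this ⊢
      rw [this, hS t (by omega)]
    have hGE : ∫ S, G S (S t) ∂P ≤ ρ ^ t * Lo x₀ := by
      rw [hP, integral_prefix_apply hGdep, ← hP]
      refine le_trans ?_ (hae t)
      have hFdep : PrefixDep t fun S => ∫ s, G S s ∂ν := by
        intro S S' hS
        have := fun s => hGdep s S S' hS
        simp only at this ⊢
        simp_rw [this]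
      refine integral_mono hFdep.integrable (hadep t).integrable fun S => ?_
      simp only [G, a]
      split_ifs with hal
      · exact hBint _
      · simp
    -- Jensen's inequality for the square root, in the form `√G ≤ (G / b + b) / 2` with `b` the root
    -- of the bound for the mean of `G`.
    set b := √(ρ ^ t * Lo x₀) with hb
    have hb0 : 0 < b := Real.sqrt_pos.2 (by positivity)
    have hb2 : b ^ 2 = ρ ^ t * Lo x₀ := Real.sq_sqrt (by positivity)
    have h1 : ∀ S, y t S ≤ α * ((G S (S t) / b + b) / 2) := by
      intro S
      simp only [y, G]
      split_ifs with hal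
      · refine mul_le_mul_of_nonneg_left ?_ hα
        have h2 := Real.sq_sqrt (hBt (S t) (Θ S t))
        rw [div_add' _ _ _ hb0.ne', div_div, le_div_iff₀ (by positivity)]
        nlinarith [sq_nonneg (√(Bt (S t) (Θ S t)) - b)]
      · positivity
    have h2 := integral_mono (μ := P) (hydep t).integrable
      (((hGdep'.integrable.div_const b).add (integrable_const b)).div_const 2
        |>.const_mul α) h1
    simp only [Pi.add_apply] at h2
    rw [integral_const_mul, integral_div, integral_add (hGdep'.integrable.div_const b)
      (integrable_const b), integral_div] at h2
    simp only [integral_const, probReal_univ, one_smul] at h2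
    refine h2.trans ?_
    have hbe : α * √(Lo x₀) * √ρ ^ t = α * b := by
      rw [hb, Real.sqrt_mul (by positivity)]
      have : √(ρ ^ t) = √ρ ^ t := by
        rw [Real.sqrt_eq_iff_eq_sq (by positivity) (by positivity), ← pow_mul, mul_comm t,
          pow_mul, Real.sq_sqrt hρ.le]
      rw [this]; ring
    rw [hbe]
    refine mul_le_mul_of_nonneg_left ?_ hα
    have h3 : (∫ S, G S (S t) ∂P) / b ≤ b := by
      rw [div_le_iff₀ hb0]; nlinarith
    linarith
  have hZdep : ∀ t, PrefixDep t fun S => ∑ u ∈ Finset.range t, y u S := by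
    intro t S S' hS
    refine Finset.sum_congr rfl fun u hu => ?_
    exact hydep u S S' fun i hi => hS i (by have := Finset.mem_range.1 hu; omega)
  have hsq1 : √ρ < 1 := by rw [Real.sqrt_lt' one_pos]; simpa using hρ1
  have hsq0 : 0 ≤ √ρ := Real.sqrt_nonneg ρ
  have hZ : ∀ t, ∫ S, ∑ u ∈ Finset.range t, y u S ∂P ≤ 2 * α * √(Lo x₀) / (1 - ρ) := by
    intro t
    rw [integral_finsetSum _ fun u _ => (hydep u).integrable]
    refine (Finset.sum_le_sum fun u _ => hy u).trans ?_
    rw [← Finset.mul_sum]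
    -- The factor `2` comes from `1 - ρ = (1 - √ρ)(1 + √ρ) ≤ 2(1 - √ρ)`.
    have h1 : ∑ i ∈ Finset.range t, √ρ ^ i ≤ 2 / (1 - ρ) := by
      have h2 : ∑ i ∈ Finset.range t, √ρ ^ i ≤ (1 - √ρ)⁻¹ := by
        rw [← tsum_geometric_of_lt_one hsq0 hsq1]
        exact (summable_geometric_of_lt_one hsq0 hsq1).sum_le_tsum _ fun i _ => by positivity
      refine h2.trans ?_
      have h3 := Real.sq_sqrt hρ.le
      rw [inv_eq_one_div, div_le_div_iff₀ (by linarith) (by linarith)]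
      nlinarith
    calc α * √(Lo x₀) * ∑ i ∈ Finset.range t, √ρ ^ i ≤ α * √(Lo x₀) * (2 / (1 - ρ)) := by
          gcongr
      _ = _ := by ring
  -- At the first failure either the loss crosses `K` with good parameters, or the parameters leave
  -- the good set, which by `hmove` costs movement more than `R`. Before that time `y` is the
  -- untruncated movement.
  have hcover : ∀ t S, ¬ al t S → le t S ∨ R ≤ ∑ u ∈ Finset.range t, y u S := by
    intro t
    induction t with
    | zero =>
      intro S h
      refine absurd ?_ h
      intro u hu
      obtain rfl : u = 0 := by omega
      rw [hΘ₀]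
      exact ⟨hgood, by rw [hK]; nlinarith⟩
    | succ t ih =>
      intro S h
      by_cases hal : al t S
      · by_cases hg : good (Θ S (t + 1))
        · left
          refine ⟨t, by omega, hal, hg, ?_⟩
          by_contra hl
          refine h fun u hu => ?_
          rcases Nat.le_succ_iff.1 hu with h' | rfl
          · exact hal u h'
          · exact ⟨hg, not_lt.1 hl⟩
        · right
          by_contra hlt
          refine hg (hmove S t (fun u hu => (hal u hu).1) ?_)
          rw [not_le] at hlt
          refine le_trans (le_of_eq ?_) hlt.le
          refine Finset.sum_congr rfl fun u hu => ?_
          have hau : al u S := fun v hv => hal v (by have := Finset.mem_range.1 hu; omega)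
          simp only [y, if_pos hau]
      · rcases ih S hal with ⟨u, hu, h'⟩ | h'
        · exact Or.inl ⟨u, by omega, h'⟩
        · right
          rw [Finset.sum_range_succ]
          linarith [hy0 t S]
  have hnot : ∀ t, P.real {S | ¬ al t S} ≤ 2 * α * √(Lo x₀) / ((1 - ρ) * R) + 1 / M := by
    intro t
    have h1 : P.real {S | R ≤ ∑ u ∈ Finset.range t, y u S} ≤
        2 * α * √(Lo x₀) / ((1 - ρ) * R) := by
      have h2 := mul_meas_ge_le_integral_of_nonneg (μ := P)
        (ae_of_all _ fun S => Finset.sum_nonneg fun u _ => hy0 u S)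
        (hZdep t).integrable R
      rw [← div_div, le_div_iff₀ hR]
      linarith [hZ t]
    refine (measureReal_mono (fun S hS => hcover t S hS)).trans ?_
    refine (measureReal_union_le {S | le t S} {S | R ≤ ∑ u ∈ Finset.range t, y u S}).trans ?_
    linarith [hle' t]
  have hset : ∀ t, {S | ∀ u ≤ t, good (Θ S u) ∧ Lo (Θ S u) ≤ K}.indicator
      (fun S => Lo (Θ S t)) = a t := by
    intro t; funext S
    simp only [a, al, Set.indicator_apply, Set.mem_ofPred_eq]
  refine ⟨fun t => ?_, ?_⟩
  · rw [hset t]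
    exact ⟨(hadep t).integrable, hae t⟩
  · have hInter : {S | ∀ u, good (Θ S u) ∧ Lo (Θ S u) ≤ K} = ⋂ t, {S | al t S} := by
      ext S
      simp only [Set.mem_ofPred_eq, Set.mem_iInter, al]
      exact ⟨fun h t u _ => h u, fun h u => h u u le_rfl⟩
    rw [hInter]
    -- The bound is uniform in the time horizon, so it passes to the intersection by continuity from
    -- above.
    have hanti : Antitone fun t => {S | al t S} := by
      intro t t' htt' S hS u hu
      exact hS u (hu.trans htt')
    have hlim := tendsto_measure_iInter_atTop (μ := P)
      (fun t => (haldep t).measurableSet.nullMeasurableSet) hanti ⟨0, measure_ne_top _ _⟩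
    have hlim' := (ENNReal.tendsto_toReal (measure_ne_top P _)).comp hlim
    refine ge_of_tendsto' hlim' fun t => ?_
    have h1 := hnot t
    have h2 := probReal_compl_eq_one_sub (μ := P) (haldep t).measurableSet
    have h3 : {S | al t S}ᶜ = {S | ¬ al t S} := rfl
    rw [h3] at h2
    change _ ≤ P.real {S | al t S}
    linarith

end StoppedProcess

end PINN
end

noncomputable section
namespace PINN

set_option linter.unusedSectionVars false

/-! ### Two-layer models with abstract features: losses and gradient bounds -/

section Features

variable {ι V : Type*} [NormedAddCommGroup V] [InnerProductSpace ℝ V]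

/-- Uniform bounds on a set `W` for features `ψ j` with gradients `D j`. -/
structure FeatureBounds (W : Set V) (ψ : ι → V → ℝ) (D : ι → V → V) (q : ι → ℝ) : Prop where
  nonneg : ∀ j, 0 ≤ q j
  val : ∀ j, ∀ w ∈ W, |ψ j w| ≤ q j
  grad : ∀ j, ∀ w ∈ W, ‖D j w‖ ≤ q j
  lip : ∀ j, ∀ w ∈ W, ∀ w' ∈ W, |ψ j w' - ψ j w| ≤ q j * ‖w' - w‖
  gradLip : ∀ j, ∀ w ∈ W, ∀ w' ∈ W, ‖D j w' - D j w‖ ≤ q j * ‖w' - w‖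
  taylor : ∀ j, ∀ w ∈ W, ∀ w' ∈ W,
    |ψ j w' - ψ j w - inner ℝ (D j w) (w' - w)| ≤ q j * ‖w' - w‖ ^ 2

variable {m : ℕ}

/-- The loss vector of a two-layer model with features `ψ` and targets `τ`. -/
def output (ψ : ι → V → ℝ) (τ : ι → ℝ) (θ : (Fin m → V) × (Fin m → ℝ)) (j : ι) : ℝ :=
  1 / √(m : ℝ) * ∑ r, θ.2 r * ψ j (θ.1 r) - τ j

variable [Fintype ι]

/-- The weighted square loss. -/
def sqLoss (ψ : ι → V → ℝ) (τ : ι → ℝ) (ω : ι → ℝ) (θ : (Fin m → V) × (Fin m → ℝ)) : ℝ :=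
  1 / 2 * ∑ j, ω j * output ψ τ θ j ^ 2

/-- The gradient of `sqLoss` with respect to the inner weights. -/
def sqGradW (ψ : ι → V → ℝ) (D : ι → V → V) (τ : ι → ℝ) (ω : ι → ℝ)
    (θ : (Fin m → V) × (Fin m → ℝ)) (r : Fin m) : V :=
  (1 / √(m : ℝ) * θ.2 r) • ∑ j, (ω j * output ψ τ θ j) • D j (θ.1 r)

/-- The gradient of `sqLoss` with respect to the outer weights. -/
def sqGradA (ψ : ι → V → ℝ) (τ : ι → ℝ) (ω : ι → ℝ)
    (θ : (Fin m → V) × (Fin m → ℝ)) (r : Fin m) : ℝ :=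
  1 / √(m : ℝ) * ∑ j, (ω j * output ψ τ θ j) * ψ j (θ.1 r)

/-- The inner product of the full gradient with the gradient of a weighted loss. -/
def gradInner (ψ : ι → V → ℝ) (D : ι → V → V) (τ : ι → ℝ) (ω : ι → ℝ)
    (θ : (Fin m → V) × (Fin m → ℝ)) : ℝ :=
  ∑ r, (inner ℝ (sqGradW ψ D τ 1 θ r) (sqGradW ψ D τ ω θ r) +
    sqGradA ψ τ 1 θ r * sqGradA ψ τ ω θ r)

/-- The quadratic form of the Gram matrix of the derivatives in the inner weights. -/
def quadW (D : ι → V → V) (θ : (Fin m → V) × (Fin m → ℝ)) (v : ι → ℝ) : ℝ :=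
  1 / (m : ℝ) * ∑ r, θ.2 r ^ 2 * ‖∑ j, v j • D j (θ.1 r)‖ ^ 2

/-- The quadratic form of the Gram matrix of the derivatives in the outer weights. -/
def quadA (ψ : ι → V → ℝ) (θ : (Fin m → V) × (Fin m → ℝ)) (v : ι → ℝ) : ℝ :=
  1 / (m : ℝ) * ∑ r, (∑ j, v j * ψ j (θ.1 r)) ^ 2

variable {W : Set V} {ψ : ι → V → ℝ} {D : ι → V → V} {q τ ω : ι → ℝ} {Q : ℝ}
  {θ θ' θ₀ : (Fin m → V) × (Fin m → ℝ)}

theorem sqLoss_nonneg (hω : ∀ j, 0 ≤ ω j) : 0 ≤ sqLoss ψ τ ω θ := by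
  unfold sqLoss
  have : 0 ≤ ∑ j, ω j * output ψ τ θ j ^ 2 :=
    Finset.sum_nonneg fun j _ => mul_nonneg (hω j) (sq_nonneg _)
  linarith

/-- Weighted Cauchy-Schwarz inequality. -/
theorem sum_mul_abs_mul_sq_le {l : ι → ℝ} (hω : ∀ j, 0 ≤ ω j) :
    (∑ j, ω j * |l j| * q j) ^ 2 ≤ (∑ j, ω j * l j ^ 2) * ∑ j, ω j * q j ^ 2 := by
  refine Finset.sum_sq_le_sum_mul_sum_of_sq_le_mul _ (fun j _ => mul_nonneg (hω j) (sq_nonneg _))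
    (fun j _ => mul_nonneg (hω j) (sq_nonneg _)) fun j _ => ?_
  rw [mul_pow, mul_pow, sq_abs]; exact le_of_eq (by ring)

/-- Weighted Cauchy-Schwarz separates the residuals from the feature bounds and reproduces the loss
with the same weights `ω`. Each of the `m` neurons carries only a fraction `1/m` of the squared
gradient, so single neurons move little in a wide network. -/
theorem sqGradW_bound (hF : FeatureBounds W ψ D q) (hm : 1 ≤ m) (hω : ∀ j, 0 ≤ ω j)
    (hωq : ∑ j, ω j * q j ^ 2 ≤ 2 * Q ^ 2) (hθ : ∀ r, θ.1 r ∈ W) (ha : ∀ r, |θ.2 r| ≤ 2)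
    (r : Fin m) : ‖sqGradW ψ D τ ω θ r‖ ^ 2 ≤ 16 * Q ^ 2 * sqLoss ψ τ ω θ / m := by
  have hm0 : (0 : ℝ) < m := by exact_mod_cast hm
  set l := output ψ τ θ with hl
  have h1 : ‖∑ j, (ω j * l j) • D j (θ.1 r)‖ ≤ ∑ j, ω j * |l j| * q j := by
    refine norm_sum_le_of_le _ fun j _ => ?_
    rw [norm_smul, Real.norm_eq_abs, abs_mul, abs_of_nonneg (hω j)]
    exact mul_le_mul_of_nonneg_left (hF.grad j _ (hθ r)) (mul_nonneg (hω j) (abs_nonneg _))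
  have h2 := sum_mul_abs_mul_sq_le (q := q) (l := l) hω
  have h3 : ∑ j, ω j * l j ^ 2 = 2 * sqLoss ψ τ ω θ := by unfold sqLoss; ring
  have h0 : 0 ≤ sqLoss ψ τ ω θ := sqLoss_nonneg hω
  rw [h3] at h2
  have h4 : ‖∑ j, (ω j * l j) • D j (θ.1 r)‖ ^ 2 ≤ 4 * Q ^ 2 * sqLoss ψ τ ω θ := by
    calc _ ≤ (∑ j, ω j * |l j| * q j) ^ 2 := by gcongr
      _ ≤ _ := h2
      _ ≤ 2 * sqLoss ψ τ ω θ * (2 * Q ^ 2) := by gcongr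
      _ = _ := by ring
  have h5 : θ.2 r ^ 2 ≤ 4 := by
    have := sq_le_sq' (by linarith [abs_nonneg (θ.2 r), ha r]) (ha r)
    rw [sq_abs] at this; linarith
  unfold sqGradW
  rw [norm_smul, mul_pow, Real.norm_eq_abs, sq_abs, mul_pow, div_pow, Real.sq_sqrt hm0.le]
  calc 1 ^ 2 / (m : ℝ) * θ.2 r ^ 2 * ‖∑ j, (ω j * l j) • D j (θ.1 r)‖ ^ 2
      ≤ 1 ^ 2 / (m : ℝ) * 4 * (4 * Q ^ 2 * sqLoss ψ τ ω θ) := by gcongr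
    _ = _ := by ring

theorem sqGradA_bound (hF : FeatureBounds W ψ D q) (hm : 1 ≤ m) (hω : ∀ j, 0 ≤ ω j)
    (hωq : ∑ j, ω j * q j ^ 2 ≤ 2 * Q ^ 2) (hθ : ∀ r, θ.1 r ∈ W)
    (r : Fin m) : sqGradA ψ τ ω θ r ^ 2 ≤ 4 * Q ^ 2 * sqLoss ψ τ ω θ / m := by
  have hm0 : (0 : ℝ) < m := by exact_mod_cast hm
  set l := output ψ τ θ with hl
  have h1 : |∑ j, (ω j * l j) * ψ j (θ.1 r)| ≤ ∑ j, ω j * |l j| * q j := by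
    refine (Finset.abs_sum_le_sum_abs _ _).trans (Finset.sum_le_sum fun j _ => ?_)
    rw [abs_mul, abs_mul, abs_of_nonneg (hω j)]
    exact mul_le_mul_of_nonneg_left (hF.val j _ (hθ r)) (mul_nonneg (hω j) (abs_nonneg _))
  have h2 := sum_mul_abs_mul_sq_le (q := q) (l := l) hω
  have h3 : ∑ j, ω j * l j ^ 2 = 2 * sqLoss ψ τ ω θ := by unfold sqLoss; ring
  have h0 : 0 ≤ sqLoss ψ τ ω θ := sqLoss_nonneg hω
  rw [h3] at h2
  have h4 : (∑ j, (ω j * l j) * ψ j (θ.1 r)) ^ 2 ≤ 4 * Q ^ 2 * sqLoss ψ τ ω θ := by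
    rw [← sq_abs]
    calc _ ≤ (∑ j, ω j * |l j| * q j) ^ 2 := by gcongr
      _ ≤ _ := h2
      _ ≤ 2 * sqLoss ψ τ ω θ * (2 * Q ^ 2) := by gcongr
      _ = _ := by ring
  unfold sqGradA
  rw [mul_pow, div_pow, Real.sq_sqrt hm0.le]
  calc 1 ^ 2 / (m : ℝ) * (∑ j, (ω j * l j) * ψ j (θ.1 r)) ^ 2
      ≤ 1 ^ 2 / (m : ℝ) * (4 * Q ^ 2 * sqLoss ψ τ ω θ) := by gcongr
    _ = _ := by ring

theorem sum_sqGrad_bound (hF : FeatureBounds W ψ D q) (hm : 1 ≤ m) (hω : ∀ j, 0 ≤ ω j)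
    (hωq : ∑ j, ω j * q j ^ 2 ≤ 2 * Q ^ 2) (hθ : ∀ r, θ.1 r ∈ W) (ha : ∀ r, |θ.2 r| ≤ 2) :
    ∑ r, (‖sqGradW ψ D τ ω θ r‖ ^ 2 + sqGradA ψ τ ω θ r ^ 2) ≤
      20 * Q ^ 2 * sqLoss ψ τ ω θ := by
  have hm0 : (0 : ℝ) < m := by exact_mod_cast hm
  calc _ ≤ ∑ r : Fin m, (16 * Q ^ 2 * sqLoss ψ τ ω θ / m + 4 * Q ^ 2 * sqLoss ψ τ ω θ / m) :=
        Finset.sum_le_sum fun r _ => add_le_add (sqGradW_bound hF hm hω hωq hθ ha r)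
          (sqGradA_bound hF hm hω hωq hθ r)
    _ = _ := by
      rw [Finset.sum_const, Finset.card_univ, Fintype.card_fin, nsmul_eq_mul]
      field_simp; ring

/-- This serves `stepBound_nonneg`: the upper bound for the next loss must stay nonnegative for
every batch, even when the batch gradient points against the full gradient. -/
theorem gradInner_abs_le (hF : FeatureBounds W ψ D q) (hm : 1 ≤ m) (hω : ∀ j, 0 ≤ ω j)
    (hq : ∑ j, q j ^ 2 ≤ 2 * Q ^ 2)
    (hωq : ∑ j, ω j * q j ^ 2 ≤ 2 * Q ^ 2) (hθ : ∀ r, θ.1 r ∈ W) (ha : ∀ r, |θ.2 r| ≤ 2) :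
    |gradInner ψ D τ ω θ| ≤ 20 * Q ^ 2 * √(sqLoss ψ τ 1 θ * sqLoss ψ τ ω θ) := by
  have h1 := sum_sqGrad_bound (τ := τ) (ω := 1) hF hm (fun _ => zero_le_one) (by simpa using hq)
    hθ ha
  have h2 := sum_sqGrad_bound (τ := τ) hF hm hω hωq hθ ha
  have hL1 : 0 ≤ sqLoss ψ τ 1 θ := sqLoss_nonneg fun _ => zero_le_one
  have hL2 : 0 ≤ sqLoss ψ τ ω θ := sqLoss_nonneg hω
  have hcs : gradInner ψ D τ ω θ ^ 2 ≤ (20 * Q ^ 2 * sqLoss ψ τ 1 θ) *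
      (20 * Q ^ 2 * sqLoss ψ τ ω θ) := by
    have e1 : |gradInner ψ D τ ω θ| ≤ ∑ r, √(‖sqGradW ψ D τ 1 θ r‖ ^ 2 + sqGradA ψ τ 1 θ r ^ 2) *
        √(‖sqGradW ψ D τ ω θ r‖ ^ 2 + sqGradA ψ τ ω θ r ^ 2) := by
      refine (Finset.abs_sum_le_sum_abs _ _).trans (Finset.sum_le_sum fun r _ => ?_)
      rw [← Real.sqrt_mul (by positivity)]
      refine Real.le_sqrt_of_sq_le ?_
      rw [sq_abs]
      have e1 := abs_real_inner_le_norm (sqGradW ψ D τ 1 θ r) (sqGradW ψ D τ ω θ r)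
      set x := inner ℝ (sqGradW ψ D τ 1 θ r) (sqGradW ψ D τ ω θ r)
      set p := ‖sqGradW ψ D τ 1 θ r‖
      set p' := ‖sqGradW ψ D τ ω θ r‖
      set a := sqGradA ψ τ 1 θ r
      set b := sqGradA ψ τ ω θ r
      have e2 : |x + a * b| ≤ p * p' + |a| * |b| :=
        (abs_add_le _ _).trans (by rw [abs_mul a b]; linarith)
      have e3 : (x + a * b) ^ 2 ≤ (p * p' + |a| * |b|) ^ 2 := by
        rw [← sq_abs (x + a * b)]; gcongr
      -- Lagrange's identity, that is, Cauchy-Schwarz for the two blocks of one neuron; `e2` below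
      -- then sums over the neurons.
      have e4 : (p * p' + |a| * |b|) ^ 2 + (p * |b| - p' * |a|) ^ 2 =
        (p ^ 2 + |a| ^ 2) * (p' ^ 2 + |b| ^ 2) := by ring
      rw [sq_abs, sq_abs] at e4
      nlinarith [sq_nonneg (p * |b| - p' * |a|)]
    have e2 := Finset.sum_mul_sq_le_sq_mul_sq Finset.univ
      (fun r => √(‖sqGradW ψ D τ 1 θ r‖ ^ 2 + sqGradA ψ τ 1 θ r ^ 2))
      (fun r => √(‖sqGradW ψ D τ ω θ r‖ ^ 2 + sqGradA ψ τ ω θ r ^ 2))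
    have e3 : ∀ ω' : ι → ℝ, ∀ r, √(‖sqGradW ψ D τ ω' θ r‖ ^ 2 + sqGradA ψ τ ω' θ r ^ 2) ^ 2 =
        ‖sqGradW ψ D τ ω' θ r‖ ^ 2 + sqGradA ψ τ ω' θ r ^ 2 := fun ω' r =>
      Real.sq_sqrt (by positivity)
    simp_rw [e3] at e2
    rw [← sq_abs]
    refine (pow_le_pow_left₀ (abs_nonneg _) e1 2).trans (e2.trans ?_)
    exact mul_le_mul h1 h2 (Finset.sum_nonneg fun r _ => by positivity) (by positivity)
  refine abs_le_of_sq_le_sq (hcs.trans (le_of_eq ?_)) (by positivity)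
  rw [mul_pow, Real.sq_sqrt (by positivity)]
  ring

end Features
end PINN
end

noncomputable section
namespace PINN

set_option linter.unusedSectionVars false

/-! ### Second-order expansion of the loss and its average over the batch -/

section Descent

variable {ι V : Type*} [NormedAddCommGroup V] [InnerProductSpace ℝ V] [Fintype ι] {m : ℕ}
  {W : Set V} {ψ : ι → V → ℝ} {D : ι → V → V} {q τ ω : ι → ℝ} {Q : ℝ}
  {θ θ' θ₀ : (Fin m → V) × (Fin m → ℝ)}

/-- The derivative of the loss vector at `θ` in direction `θ' - θ`. -/
def outputDeriv (ψ : ι → V → ℝ) (D : ι → V → V) (θ θ' : (Fin m → V) × (Fin m → ℝ)) (j : ι) : ℝ :=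
  1 / √(m : ℝ) * ∑ r, ((θ'.2 r - θ.2 r) * ψ j (θ.1 r) +
    θ.2 r * inner ℝ (D j (θ.1 r)) (θ'.1 r - θ.1 r))

/-- The squared Euclidean distance of two parameters. -/
def sqDist (θ θ' : (Fin m → V) × (Fin m → ℝ)) : ℝ :=
  ∑ r, (‖θ'.1 r - θ.1 r‖ ^ 2 + (θ'.2 r - θ.2 r) ^ 2)

theorem sqDist_nonneg : 0 ≤ sqDist θ θ' := Finset.sum_nonneg fun _ _ => by positivity

/-- The remainder consists of a mixed term, at most `q/2` times the squared displacement of the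
neuron by the arithmetic-geometric mean inequality, and a feature remainder with `|aᵣ| ≤ 2`; hence
`5/2`. The factor `m^{-1/2}` survives, which later compensates a large loss. -/
theorem output_taylor (hF : FeatureBounds W ψ D q) (hθ : ∀ r, θ.1 r ∈ W) (ha : ∀ r, |θ.2 r| ≤ 2)
    (hθ' : ∀ r, θ'.1 r ∈ W) (j : ι) :
    |output ψ τ θ' j - output ψ τ θ j - outputDeriv ψ D θ θ' j| ≤
      1 / √(m : ℝ) * (5 / 2 * q j * sqDist θ θ') := by
  have h1 : output ψ τ θ' j - output ψ τ θ j - outputDeriv ψ D θ θ' j =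
      1 / √(m : ℝ) * ∑ r, ((θ'.2 r - θ.2 r) * (ψ j (θ'.1 r) - ψ j (θ.1 r)) +
        θ.2 r * (ψ j (θ'.1 r) - ψ j (θ.1 r) - inner ℝ (D j (θ.1 r)) (θ'.1 r - θ.1 r))) := by
    unfold output outputDeriv
    rw [sub_sub_sub_cancel_right, ← mul_sub, ← mul_sub, ← Finset.sum_sub_distrib,
      ← Finset.sum_sub_distrib]
    congr 1
    refine Finset.sum_congr rfl fun r _ => ?_
    ring
  rw [h1, abs_mul, abs_of_nonneg (by positivity)]
  refine mul_le_mul_of_nonneg_left ?_ (by positivity)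
  unfold sqDist
  rw [Finset.mul_sum]
  refine (Finset.abs_sum_le_sum_abs _ _).trans (Finset.sum_le_sum fun r _ => ?_)
  refine (abs_add_le _ _).trans ?_
  rw [abs_mul, abs_mul]
  have e1 := hF.lip j _ (hθ r) _ (hθ' r)
  have e2 := hF.taylor j _ (hθ r) _ (hθ' r)
  have e3 := hF.nonneg j
  set x := ‖θ'.1 r - θ.1 r‖
  have e4 : |θ'.2 r - θ.2 r| * |ψ j (θ'.1 r) - ψ j (θ.1 r)| ≤
      |θ'.2 r - θ.2 r| * (q j * x) := by gcongr
  have e5 : |θ.2 r| * |ψ j (θ'.1 r) - ψ j (θ.1 r) - inner ℝ (D j (θ.1 r)) (θ'.1 r - θ.1 r)| ≤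
      2 * (q j * x ^ 2) := by
    refine mul_le_mul (ha r) e2 (abs_nonneg _) (by norm_num)
  have e6 : |θ'.2 r - θ.2 r| * x ≤ (x ^ 2 + (θ'.2 r - θ.2 r) ^ 2) / 2 := by
    rw [← sq_abs (θ'.2 r - θ.2 r)]
    nlinarith [sq_nonneg (|θ'.2 r - θ.2 r| - x)]
  have e7 := mul_le_mul_of_nonneg_left e6 e3
  have e8 : 0 ≤ q j * (θ'.2 r - θ.2 r) ^ 2 := by positivity
  nlinarith

theorem output_lip (hF : FeatureBounds W ψ D q) (hm : 1 ≤ m) (hθ : ∀ r, θ.1 r ∈ W)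
    (ha : ∀ r, |θ.2 r| ≤ 2) (hθ' : ∀ r, θ'.1 r ∈ W) (j : ι) :
    (output ψ τ θ' j - output ψ τ θ j) ^ 2 ≤ 5 * q j ^ 2 * sqDist θ θ' := by
  have hm0 : (0 : ℝ) < m := by exact_mod_cast hm
  have h1 : output ψ τ θ' j - output ψ τ θ j =
      1 / √(m : ℝ) * ∑ r, ((θ'.2 r - θ.2 r) * ψ j (θ'.1 r) +
        θ.2 r * (ψ j (θ'.1 r) - ψ j (θ.1 r))) := by
    unfold output
    rw [sub_sub_sub_cancel_right, ← mul_sub, ← Finset.sum_sub_distrib]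
    congr 1
    refine Finset.sum_congr rfl fun r _ => ?_
    ring
  have e3 := hF.nonneg j
  rw [h1, mul_pow, div_pow, Real.sq_sqrt hm0.le, one_pow]
  have h2 := Finset.sum_mul_sq_le_sq_mul_sq Finset.univ (fun _ : Fin m => (1 : ℝ))
    fun r => ((θ'.2 r - θ.2 r) * ψ j (θ'.1 r) + θ.2 r * (ψ j (θ'.1 r) - ψ j (θ.1 r)))
  simp only [one_mul, one_pow, Finset.sum_const, Finset.card_univ, Fintype.card_fin, nsmul_eq_mul,
    mul_one] at h2
  have h3 : ∑ r, ((θ'.2 r - θ.2 r) * ψ j (θ'.1 r) +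
      θ.2 r * (ψ j (θ'.1 r) - ψ j (θ.1 r))) ^ 2 ≤ 5 * q j ^ 2 * sqDist θ θ' := by
    unfold sqDist
    rw [Finset.mul_sum]
    refine Finset.sum_le_sum fun r _ => ?_
    have e1 := hF.lip j _ (hθ r) _ (hθ' r)
    have e2 := hF.val j _ (hθ' r)
    set x := ‖θ'.1 r - θ.1 r‖
    have e4 : |(θ'.2 r - θ.2 r) * ψ j (θ'.1 r) + θ.2 r * (ψ j (θ'.1 r) - ψ j (θ.1 r))| ≤
        |θ'.2 r - θ.2 r| * q j + 2 * (q j * x) := by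
      refine (abs_add_le _ _).trans ?_
      rw [abs_mul, abs_mul]
      refine add_le_add (by gcongr) (mul_le_mul (ha r) e1 (abs_nonneg _) (by norm_num))
    rw [← sq_abs]
    refine (pow_le_pow_left₀ (abs_nonneg _) e4 2).trans ?_
    rw [← sq_abs (θ'.2 r - θ.2 r)]
    set y := |θ'.2 r - θ.2 r|
    -- Cauchy-Schwarz for `(1, 2)` and `(y, x)`, which gives `5 = 1 + 4`.
    have : (y * q j + 2 * (q j * x)) ^ 2 + q j ^ 2 * (2 * y - x) ^ 2 =
      5 * q j ^ 2 * (x ^ 2 + y ^ 2) := by ring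
    nlinarith [mul_nonneg (sq_nonneg (q j)) (sq_nonneg (2 * y - x))]
  calc 1 / (m : ℝ) * _ ≤ 1 / (m : ℝ) * (m * (5 * q j ^ 2 * sqDist θ θ')) := by
        refine mul_le_mul_of_nonneg_left (h2.trans ?_) (by positivity)
        exact mul_le_mul_of_nonneg_left h3 hm0.le
    _ = _ := by field_simp

/-- Second-order expansion of the loss. -/
theorem sqLoss_le_taylor (hF : FeatureBounds W ψ D q) (hm : 1 ≤ m)
    (hq : ∑ j, q j ^ 2 ≤ 2 * Q ^ 2) (hθ : ∀ r, θ.1 r ∈ W) (ha : ∀ r, |θ.2 r| ≤ 2)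
    (hθ' : ∀ r, θ'.1 r ∈ W) (hL : 2 * sqLoss ψ τ 1 θ ≤ m * Q ^ 2) :
    sqLoss ψ τ 1 θ' ≤ sqLoss ψ τ 1 θ + ∑ j, output ψ τ θ j * outputDeriv ψ D θ θ' j +
      10 * Q ^ 2 * sqDist θ θ' := by
  have hm0 : (0 : ℝ) < m := by exact_mod_cast hm
  set l := output ψ τ θ
  set l' := output ψ τ θ'
  set δ := outputDeriv ψ D θ θ'
  set s := sqDist θ θ' with hs
  have hs0 : 0 ≤ s := sqDist_nonneg
  have h1 : sqLoss ψ τ 1 θ' = sqLoss ψ τ 1 θ + ∑ j, l j * δ j + ∑ j, l j * (l' j - l j - δ j) +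
      1 / 2 * ∑ j, (l' j - l j) ^ 2 := by
    unfold sqLoss
    simp only [Pi.one_apply, one_mul, Finset.mul_sum, ← Finset.sum_add_distrib]
    refine Finset.sum_congr rfl fun j _ => ?_
    ring
  have h2 : ∑ j, (l' j - l j) ^ 2 ≤ 10 * Q ^ 2 * s := by
    calc _ ≤ ∑ j, 5 * q j ^ 2 * s := Finset.sum_le_sum fun j _ => output_lip hF hm hθ ha hθ' j
      _ = 5 * (∑ j, q j ^ 2) * s := by rw [← Finset.sum_mul, ← Finset.mul_sum]
      _ ≤ 5 * (2 * Q ^ 2) * s := by gcongr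
      _ = _ := by ring
  -- Here `2L ≤ m Q²` enters: the residuals may grow like `√m`, which cancels the `1/√m` in the
  -- remainder of the outputs.
  have h3 : ∑ j, |l j| * q j ≤ √(m : ℝ) * (√2 * Q ^ 2) := by
    have e1 := sum_mul_abs_mul_sq_le (q := q) (l := l) (ω := 1) fun _ => zero_le_one
    simp only [Pi.one_apply, one_mul] at e1
    have e2 : ∑ j, l j ^ 2 = 2 * sqLoss ψ τ 1 θ := by unfold sqLoss; simp; rfl
    rw [e2] at e1
    refine abs_le_of_sq_le_sq' ?_ (by positivity) |>.2
    refine e1.trans ((mul_le_mul hL hq (Finset.sum_nonneg fun j _ => by positivity)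
      (by positivity)).trans (le_of_eq ?_))
    rw [mul_pow, mul_pow, Real.sq_sqrt hm0.le, Real.sq_sqrt (by norm_num)]
    ring
  have h4 : ∑ j, l j * (l' j - l j - δ j) ≤ 5 / 2 * √2 * Q ^ 2 * s := by
    calc ∑ j, l j * (l' j - l j - δ j) ≤ ∑ j, |l j| * (1 / √(m : ℝ) * (5 / 2 * q j * s)) := by
          refine Finset.sum_le_sum fun j _ => (le_abs_self _).trans ?_
          rw [abs_mul]
          exact mul_le_mul_of_nonneg_left (output_taylor hF hθ ha hθ' j) (abs_nonneg _)
      _ = 1 / √(m : ℝ) * (5 / 2 * s) * ∑ j, |l j| * q j := by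
          rw [Finset.mul_sum]; refine Finset.sum_congr rfl fun j _ => ?_; ring
      _ ≤ 1 / √(m : ℝ) * (5 / 2 * s) * (√(m : ℝ) * (√2 * Q ^ 2)) := by gcongr
      _ = _ := by field_simp
  -- With this the remainder term and the quadratic term contribute `5 Q² s` each.
  have h5 : √2 ≤ 2 := by rw [Real.sqrt_le_left (by norm_num)]; norm_num
  have h6 : √2 * (Q ^ 2 * s) ≤ 2 * (Q ^ 2 * s) := by gcongr
  rw [h1]
  nlinarith

theorem outputDeriv_step {η : ℝ} (hθ1 : ∀ r, θ'.1 r = θ.1 r - η • sqGradW ψ D τ ω θ r)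
    (hθ2 : ∀ r, θ'.2 r = θ.2 r - η * sqGradA ψ τ ω θ r) :
    ∑ j, output ψ τ θ j * outputDeriv ψ D θ θ' j = -η * gradInner ψ D τ ω θ := by
  unfold outputDeriv gradInner
  simp only [Finset.mul_sum]
  rw [Finset.sum_comm]
  refine Finset.sum_congr rfl fun r _ => ?_
  have e1 : θ'.1 r - θ.1 r = -(η • sqGradW ψ D τ ω θ r) := by rw [hθ1]; abel
  have e2 : θ'.2 r - θ.2 r = -(η * sqGradA ψ τ ω θ r) := by rw [hθ2]; ring
  have e3 : inner ℝ (sqGradW ψ D τ 1 θ r) (sqGradW ψ D τ ω θ r) =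
      ∑ j, output ψ τ θ j * (1 / √(m : ℝ) * (θ.2 r *
        inner ℝ (D j (θ.1 r)) (sqGradW ψ D τ ω θ r))) := by
    rw [sqGradW, inner_smul_left, sum_inner, Finset.mul_sum]
    refine Finset.sum_congr rfl fun j _ => ?_
    rw [inner_smul_left]
    simp
    ring
  have e4 : sqGradA ψ τ 1 θ r = ∑ j, output ψ τ θ j * (1 / √(m : ℝ) * ψ j (θ.1 r)) := by
    rw [sqGradA, Finset.mul_sum]
    refine Finset.sum_congr rfl fun j _ => ?_
    simp
    ring
  rw [e3, e4, Finset.sum_mul, ← Finset.sum_add_distrib, Finset.mul_sum]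
  refine Finset.sum_congr rfl fun j _ => ?_
  rw [e1, e2, inner_neg_right, inner_smul_right]
  ring

theorem sqDist_step {η : ℝ} (hθ1 : ∀ r, θ'.1 r = θ.1 r - η • sqGradW ψ D τ ω θ r)
    (hθ2 : ∀ r, θ'.2 r = θ.2 r - η * sqGradA ψ τ ω θ r) :
    sqDist θ θ' = η ^ 2 * ∑ r, (‖sqGradW ψ D τ ω θ r‖ ^ 2 + sqGradA ψ τ ω θ r ^ 2) := by
  unfold sqDist
  rw [Finset.mul_sum]
  refine Finset.sum_congr rfl fun r _ => ?_
  have e1 : θ'.1 r - θ.1 r = -(η • sqGradW ψ D τ ω θ r) := by rw [hθ1]; abel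
  have e2 : θ'.2 r - θ.2 r = -(η * sqGradA ψ τ ω θ r) := by rw [hθ2]; ring
  rw [e1, e2, norm_neg, norm_smul, mul_pow, Real.norm_eq_abs, sq_abs]
  ring

/-- The upper bound for the loss after a stochastic gradient step. -/
def stepBound (ψ : ι → V → ℝ) (D : ι → V → V) (τ : ι → ℝ) (Q η : ℝ) (ω : ι → ℝ)
    (θ : (Fin m → V) × (Fin m → ℝ)) : ℝ :=
  sqLoss ψ τ 1 θ - η * gradInner ψ D τ ω θ + 200 * Q ^ 4 * η ^ 2 * sqLoss ψ τ ω θ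

/-- The constant `200 = 10 * 20` combines the second-order term of `sqLoss_le_taylor` with the bound
of `sum_sqGrad_bound` for the batch gradient. The new point is required to lie in `W`, which is not
guaranteed for every batch. -/
theorem sqLoss_step_le {η : ℝ} (hF : FeatureBounds W ψ D q) (hm : 1 ≤ m)
    (hω : ∀ j, 0 ≤ ω j) (hq : ∑ j, q j ^ 2 ≤ 2 * Q ^ 2)
    (hωq : ∑ j, ω j * q j ^ 2 ≤ 2 * Q ^ 2) (hθ : ∀ r, θ.1 r ∈ W) (ha : ∀ r, |θ.2 r| ≤ 2)
    (hθ' : ∀ r, θ'.1 r ∈ W) (hL : 2 * sqLoss ψ τ 1 θ ≤ m * Q ^ 2)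
    (hθ1 : ∀ r, θ'.1 r = θ.1 r - η • sqGradW ψ D τ ω θ r)
    (hθ2 : ∀ r, θ'.2 r = θ.2 r - η * sqGradA ψ τ ω θ r) :
    sqLoss ψ τ 1 θ' ≤ stepBound ψ D τ Q η ω θ := by
  have h1 := sqLoss_le_taylor hF hm hq hθ ha hθ' hL
  rw [outputDeriv_step hθ1 hθ2, sqDist_step hθ1 hθ2] at h1
  have h2 := sum_sqGrad_bound (τ := τ) hF hm hω hωq hθ ha
  have h3 : 10 * Q ^ 2 * η ^ 2 * ∑ r, (‖sqGradW ψ D τ ω θ r‖ ^ 2 + sqGradA ψ τ ω θ r ^ 2) ≤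
    10 * Q ^ 2 * η ^ 2 * (20 * Q ^ 2 * sqLoss ψ τ ω θ) := by gcongr
  unfold stepBound
  nlinarith

/-- With `x = √L`, `y = √L̃` and `z = Q²ηy` the bound is at least `x² - 20xz + 200z² = (x - 10z)² +
100z²`. -/
theorem stepBound_nonneg {η : ℝ} (hF : FeatureBounds W ψ D q) (hm : 1 ≤ m) (hη : 0 ≤ η)
    (hω : ∀ j, 0 ≤ ω j) (hq : ∑ j, q j ^ 2 ≤ 2 * Q ^ 2)
    (hωq : ∑ j, ω j * q j ^ 2 ≤ 2 * Q ^ 2) (hθ : ∀ r, θ.1 r ∈ W) (ha : ∀ r, |θ.2 r| ≤ 2) :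
    0 ≤ stepBound ψ D τ Q η ω θ := by
  have h1 := gradInner_abs_le (τ := τ) hF hm hω hq hωq hθ ha
  have hL1 : 0 ≤ sqLoss ψ τ 1 θ := sqLoss_nonneg fun _ => zero_le_one
  have hL2 : 0 ≤ sqLoss ψ τ ω θ := sqLoss_nonneg hω
  rw [Real.sqrt_mul hL1] at h1
  have h2 : η * gradInner ψ D τ ω θ ≤
      η * (20 * Q ^ 2 * (√(sqLoss ψ τ 1 θ) * √(sqLoss ψ τ ω θ))) :=
    mul_le_mul_of_nonneg_left ((le_abs_self _).trans h1) hη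
  unfold stepBound
  have e1 := Real.sq_sqrt hL1
  have e2 := Real.sq_sqrt hL2
  set x := √(sqLoss ψ τ 1 θ)
  set y := √(sqLoss ψ τ ω θ)
  rw [← e1, ← e2]
  nlinarith [sq_nonneg (x - 10 * (Q ^ 2 * η * y)), sq_nonneg (Q ^ 2 * η * y)]

/-- The squared gradient norm is the Gram quadratic form at the loss vector, so a spectral lower
bound becomes a decay rate. -/
theorem gradInner_one : gradInner ψ D τ 1 θ =
    quadW D θ (output ψ τ θ) + quadA ψ θ (output ψ τ θ) := by
  unfold gradInner quadW quadA sqGradW sqGradA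
  rw [Finset.mul_sum, Finset.mul_sum, ← Finset.sum_add_distrib]
  refine Finset.sum_congr rfl fun r _ => ?_
  have e : (1 / √(m : ℝ)) ^ 2 = 1 / m := by rw [div_pow, Real.sq_sqrt (by positivity), one_pow]
  rw [real_inner_self_eq_norm_sq, norm_smul, mul_pow, Real.norm_eq_abs, sq_abs, mul_pow, e, ← sq,
    mul_pow, e]
  simp only [Pi.one_apply, one_mul]
  ring

/-- `gradInner` is linear in the weights. -/
theorem gradInner_eq_sum : ∃ c : ι → ℝ, ∀ ω : ι → ℝ, gradInner ψ D τ ω θ = ∑ j, ω j * c j := by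
  -- Only the second gradient carries `ω`, and it does so linearly; the mean over the batches
  -- therefore depends on the mean weights alone.
  refine ⟨fun j => ∑ r, output ψ τ θ j * (1 / √(m : ℝ)) *
    (θ.2 r * inner ℝ (sqGradW ψ D τ 1 θ r) (D j (θ.1 r)) + sqGradA ψ τ 1 θ r * ψ j (θ.1 r)),
    fun ω => ?_⟩
  unfold gradInner
  simp only [Finset.mul_sum]
  rw [Finset.sum_comm]
  refine Finset.sum_congr rfl fun r _ => ?_
  have e1 : inner ℝ (sqGradW ψ D τ 1 θ r) (sqGradW ψ D τ ω θ r) =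
      ∑ j, ω j * (output ψ τ θ j * (1 / √(m : ℝ)) *
        (θ.2 r * inner ℝ (sqGradW ψ D τ 1 θ r) (D j (θ.1 r)))) := by
    conv_lhs => rw [sqGradW.eq_1 ψ D τ ω, inner_smul_right, inner_sum, Finset.mul_sum]
    refine Finset.sum_congr rfl fun j _ => ?_
    rw [inner_smul_right]; ring
  have e2 : sqGradA ψ τ ω θ r = ∑ j, ω j * (output ψ τ θ j * (1 / √(m : ℝ)) * ψ j (θ.1 r)) := by
    rw [sqGradA, Finset.mul_sum]
    refine Finset.sum_congr rfl fun j _ => ?_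
    ring
  rw [e1, e2, Finset.mul_sum, ← Finset.sum_add_distrib]
  refine Finset.sum_congr rfl fun j _ => ?_
  ring

/-- Expectation of a random linear combination with coefficients of mean one. -/
theorem integral_weighted_sum {β : Type*} [Finite β] [MeasurableSpace β]
    [MeasurableSingletonClass β] {ν : Measure β} [IsFiniteMeasure ν] {Ω : β → ι → ℝ}
    (hΩ : ∀ j, ∫ s, Ω s j ∂ν = 1) (c : ι → ℝ) :
    ∫ s, ∑ j, Ω s j * c j ∂ν = ∑ j, c j := by
  rw [integral_finsetSum _ fun _ _ => Integrable.of_finite]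
  refine Finset.sum_congr rfl fun j _ => ?_
  rw [integral_mul_const, hΩ, one_mul]

variable {β : Type*} [Finite β] [MeasurableSpace β] [MeasurableSingletonClass β] {ν : Measure β}
  [IsProbabilityMeasure ν] {Ω : β → ι → ℝ}

theorem integral_gradInner (hΩ : ∀ j, ∫ s, Ω s j ∂ν = 1) :
    ∫ s, gradInner ψ D τ (Ω s) θ ∂ν = gradInner ψ D τ 1 θ := by
  obtain ⟨c, hc⟩ := gradInner_eq_sum (ψ := ψ) (D := D) (τ := τ) (θ := θ)
  simp_rw [hc]
  rw [integral_weighted_sum hΩ]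
  simp

theorem integral_sqLoss (hΩ : ∀ j, ∫ s, Ω s j ∂ν = 1) :
    ∫ s, sqLoss ψ τ (Ω s) θ ∂ν = sqLoss ψ τ 1 θ := by
  unfold sqLoss
  rw [integral_const_mul, integral_weighted_sum hΩ]
  simp

/-- The Gram form at the loss vector is at least `lam/2 * 2L = lam * L`. The step size condition
makes the second-order term at most half of the resulting gain `η * lam * L`. -/
theorem integral_stepBound_le {η lam : ℝ} (hΩ : ∀ j, ∫ s, Ω s j ∂ν = 1) (hη : 0 ≤ η)
    (hquad : ∀ v : ι → ℝ, lam / 2 * ∑ j, v j ^ 2 ≤ quadW D θ v + quadA ψ θ v)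
    (hηQ : 400 * Q ^ 4 * η ≤ lam) :
    ∫ s, stepBound ψ D τ Q η (Ω s) θ ∂ν ≤ (1 - η * lam / 2) * sqLoss ψ τ 1 θ := by
  have hL1 : 0 ≤ sqLoss ψ τ 1 θ := sqLoss_nonneg fun _ => zero_le_one
  unfold stepBound
  rw [integral_add Integrable.of_finite Integrable.of_finite,
    integral_sub Integrable.of_finite Integrable.of_finite, integral_const_mul, integral_const_mul,
    integral_gradInner hΩ, integral_sqLoss hΩ, gradInner_one]
  have h1 := hquad (output ψ τ θ)
  have h2 : ∑ j, output ψ τ θ j ^ 2 = 2 * sqLoss ψ τ 1 θ := by unfold sqLoss; simp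
  rw [h2] at h1
  have h3 := mul_le_mul_of_nonneg_left h1 hη
  have h4 := mul_le_mul_of_nonneg_right hηQ (mul_nonneg hη hL1)
  simp only [integral_const, probReal_univ, one_smul]
  nlinarith

theorem norm_sum_smul_le (hq : ∑ j, q j ^ 2 ≤ 2 * Q ^ 2)
    {u : ι → V} {κ : ℝ} (hu : ∀ j, ‖u j‖ ≤ q j * κ) (v : ι → ℝ) :
    ‖∑ j, v j • u j‖ ^ 2 ≤ 2 * Q ^ 2 * κ ^ 2 * ∑ j, v j ^ 2 := by
  have h1 : ‖∑ j, v j • u j‖ ≤ κ * ∑ j, |v j| * q j := by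
    rw [Finset.mul_sum]
    refine norm_sum_le_of_le _ fun j _ => ?_
    rw [norm_smul, Real.norm_eq_abs]
    have := mul_le_mul_of_nonneg_left (hu j) (abs_nonneg (v j))
    linarith
  have e1 := sum_mul_abs_mul_sq_le (q := q) (l := v) (ω := 1) fun _ => zero_le_one
  simp only [Pi.one_apply, one_mul] at e1
  have e2 : 0 ≤ ∑ j, v j ^ 2 := Finset.sum_nonneg fun _ _ => sq_nonneg _
  calc ‖∑ j, v j • u j‖ ^ 2 ≤ (κ * ∑ j, |v j| * q j) ^ 2 := by gcongr
    _ = κ ^ 2 * (∑ j, |v j| * q j) ^ 2 := by ring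
    _ ≤ κ ^ 2 * ((∑ j, v j ^ 2) * ∑ j, q j ^ 2) := by gcongr
    _ ≤ κ ^ 2 * ((∑ j, v j ^ 2) * (2 * Q ^ 2)) := by gcongr
    _ = _ := by ring

end Descent
end PINN
end

noncomputable section
namespace PINN

set_option linter.unusedSectionVars false

/-! ### Stability of the Gram forms near the start, and convergence for abstract features -/

section FeatureSGD

variable {ι V : Type*} [NormedAddCommGroup V] [InnerProductSpace ℝ V] [Fintype ι] {m : ℕ}
  {W : Set V} {ψ : ι → V → ℝ} {D : ι → V → V} {q τ ω : ι → ℝ} {Q : ℝ}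
  {θ θ' θ₀ : (Fin m → V) × (Fin m → ℝ)}

/-- Factor the difference of squares: the norms add up to at most `2√X` and differ by at most `√X
κ`. -/
theorem norm_sq_sub_norm_sq_le {E : Type*} [NormedAddCommGroup E] {u v : E} {X κ : ℝ}
    (hX : 0 ≤ X) (hκ : 0 ≤ κ) (hu : ‖u‖ ^ 2 ≤ X) (hv : ‖v‖ ^ 2 ≤ X)
    (huv : ‖v - u‖ ^ 2 ≤ X * κ ^ 2) : ‖u‖ ^ 2 - ‖v‖ ^ 2 ≤ 2 * X * κ := by
  have h1 : ‖u‖ ≤ √X := Real.le_sqrt_of_sq_le hu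
  have h2 : ‖v‖ ≤ √X := Real.le_sqrt_of_sq_le hv
  have h3 : ‖v - u‖ ≤ √X * κ := by
    have := Real.le_sqrt_of_sq_le huv
    rwa [Real.sqrt_mul hX, Real.sqrt_sq hκ] at this
  have h4 : ‖u‖ - ‖v‖ ≤ ‖v - u‖ := by rw [norm_sub_rev]; exact norm_sub_norm_le u v
  have h5 := Real.sq_sqrt hX
  set s := √X
  have hs : 0 ≤ s := Real.sqrt_nonneg X
  have hsκ : 0 ≤ s * κ := mul_nonneg hs hκ
  have h6 : (‖u‖ - ‖v‖) * (‖u‖ + ‖v‖) ≤ (s * κ) * (s + s) :=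
    mul_le_mul (h4.trans h3) (add_le_add h1 h2) (by positivity) hsκ
  rw [← h5]; nlinarith

theorem quadW_perturb (hF : FeatureBounds W ψ D q) (hm : 1 ≤ m)
    (hq : ∑ j, q j ^ 2 ≤ 2 * Q ^ 2) (hθ : ∀ r, θ.1 r ∈ W) (hθ₀ : ∀ r, θ₀.1 r ∈ W)
    (ha₀ : ∀ r, |θ₀.2 r| = 1) {Rw Ra : ℝ} (hRw : 0 ≤ Rw) (hRa1 : Ra ≤ 1)
    (hw : ∀ r, ‖θ.1 r - θ₀.1 r‖ ≤ Rw) (ha : ∀ r, |θ.2 r - θ₀.2 r| ≤ Ra) (v : ι → ℝ) :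
    quadW D θ₀ v - Q ^ 2 * (4 * Rw + 6 * Ra) * ∑ j, v j ^ 2 ≤ quadW D θ v := by
  have hm0 : (0 : ℝ) < m := by exact_mod_cast hm
  have hv0 : 0 ≤ ∑ j, v j ^ 2 := Finset.sum_nonneg fun _ _ => sq_nonneg _
  set n := ∑ j, v j ^ 2
  have key : ∀ r, θ₀.2 r ^ 2 * ‖∑ j, v j • D j (θ₀.1 r)‖ ^ 2 - Q ^ 2 * (4 * Rw + 6 * Ra) * n ≤
      θ.2 r ^ 2 * ‖∑ j, v j • D j (θ.1 r)‖ ^ 2 := by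
    intro r
    have h0 : θ₀.2 r ^ 2 = 1 := by rw [← sq_abs, ha₀, one_pow]
    have h1 := norm_sum_smul_le (κ := 1) hq (u := fun j => D j (θ.1 r))
      (fun j => by simpa using hF.grad j _ (hθ r)) v
    have h2 := norm_sum_smul_le (κ := 1) hq (u := fun j => D j (θ₀.1 r))
      (fun j => by simpa using hF.grad j _ (hθ₀ r)) v
    have h3 := norm_sum_smul_le (κ := Rw) hq (u := fun j => D j (θ.1 r) - D j (θ₀.1 r))
      (fun j => (hF.gradLip j _ (hθ₀ r) _ (hθ r)).trans
        (mul_le_mul_of_nonneg_left (hw r) (hF.nonneg j))) v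
    simp only [smul_sub, Finset.sum_sub_distrib] at h3
    simp only [one_pow, mul_one] at h1 h2
    have h4 := norm_sq_sub_norm_sq_le (X := 2 * Q ^ 2 * n) (by positivity) hRw h2 h1
      (h3.trans (le_of_eq (by ring)))
    -- The weights start at `±1` and move by at most `Ra ≤ 1`. The loss `3 * Ra` times the bound `2
    -- Q² n` gives the coefficient `6`; the coefficient `4` of `Rw` comes from `h4`.
    have h5 : 1 - 3 * Ra ≤ θ.2 r ^ 2 := by
      have e1 := ha r
      rw [abs_le] at e1
      rcases (abs_eq zero_le_one).1 (ha₀ r) with h | h <;> rw [h] at e1 <;> nlinarith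
    set x := ‖∑ j, v j • D j (θ.1 r)‖ ^ 2
    have hx : 0 ≤ x := by positivity
    have hRa : 0 ≤ Ra := (abs_nonneg _).trans (ha r)
    rw [h0]
    nlinarith [mul_le_mul_of_nonneg_right h5 hx, mul_le_mul_of_nonneg_left h1 hRa]
  unfold quadW
  rw [← sub_nonneg]
  have h6 : 1 / (m : ℝ) * ∑ r, θ.2 r ^ 2 * ‖∑ j, v j • D j (θ.1 r)‖ ^ 2 -
      (1 / (m : ℝ) * ∑ r, θ₀.2 r ^ 2 * ‖∑ j, v j • D j (θ₀.1 r)‖ ^ 2 -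
        Q ^ 2 * (4 * Rw + 6 * Ra) * n) =
      1 / (m : ℝ) * ∑ r, (θ.2 r ^ 2 * ‖∑ j, v j • D j (θ.1 r)‖ ^ 2 -
        (θ₀.2 r ^ 2 * ‖∑ j, v j • D j (θ₀.1 r)‖ ^ 2 - Q ^ 2 * (4 * Rw + 6 * Ra) * n)) := by
    rw [Finset.sum_sub_distrib, Finset.sum_sub_distrib, Finset.sum_const, Finset.card_univ,
      Fintype.card_fin, nsmul_eq_mul]
    field_simp
  rw [h6]
  exact mul_nonneg (by positivity) (Finset.sum_nonneg fun r _ => sub_nonneg.2 (key r))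

theorem quadA_perturb (hF : FeatureBounds W ψ D q) (hm : 1 ≤ m)
    (hq : ∑ j, q j ^ 2 ≤ 2 * Q ^ 2) (hθ : ∀ r, θ.1 r ∈ W) (hθ₀ : ∀ r, θ₀.1 r ∈ W)
    {Rw : ℝ} (hRw : 0 ≤ Rw) (hw : ∀ r, ‖θ.1 r - θ₀.1 r‖ ≤ Rw) (v : ι → ℝ) :
    quadA ψ θ₀ v - Q ^ 2 * (4 * Rw) * ∑ j, v j ^ 2 ≤ quadA ψ θ v := by
  have hm0 : (0 : ℝ) < m := by exact_mod_cast hm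
  have hv0 : 0 ≤ ∑ j, v j ^ 2 := Finset.sum_nonneg fun _ _ => sq_nonneg _
  set n := ∑ j, v j ^ 2
  have key : ∀ r, (∑ j, v j * ψ j (θ₀.1 r)) ^ 2 - Q ^ 2 * (4 * Rw) * n ≤
      (∑ j, v j * ψ j (θ.1 r)) ^ 2 := by
    intro r
    have h1 := norm_sum_smul_le (κ := 1) hq (u := fun j => ψ j (θ.1 r))
      (fun j => by simpa using hF.val j _ (hθ r)) v
    have h2 := norm_sum_smul_le (κ := 1) hq (u := fun j => ψ j (θ₀.1 r))
      (fun j => by simpa using hF.val j _ (hθ₀ r)) v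
    have h3 := norm_sum_smul_le (κ := Rw) hq (u := fun j => ψ j (θ.1 r) - ψ j (θ₀.1 r))
      (fun j => (hF.lip j _ (hθ₀ r) _ (hθ r)).trans
        (mul_le_mul_of_nonneg_left (hw r) (hF.nonneg j))) v
    simp only [smul_sub, Finset.sum_sub_distrib] at h3
    simp only [one_pow, mul_one] at h1 h2
    have h4 := norm_sq_sub_norm_sq_le (X := 2 * Q ^ 2 * n) (by positivity) hRw h2 h1
      (h3.trans (le_of_eq (by ring)))
    simp only [Real.norm_eq_abs, sq_abs, smul_eq_mul] at h4
    linarith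
  unfold quadA
  rw [← sub_nonneg]
  have h6 : 1 / (m : ℝ) * ∑ r, (∑ j, v j * ψ j (θ.1 r)) ^ 2 -
      (1 / (m : ℝ) * ∑ r, (∑ j, v j * ψ j (θ₀.1 r)) ^ 2 - Q ^ 2 * (4 * Rw) * n) =
      1 / (m : ℝ) * ∑ r, ((∑ j, v j * ψ j (θ.1 r)) ^ 2 -
        ((∑ j, v j * ψ j (θ₀.1 r)) ^ 2 - Q ^ 2 * (4 * Rw) * n)) := by
    rw [Finset.sum_sub_distrib, Finset.sum_sub_distrib, Finset.sum_const, Finset.card_univ,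
      Fintype.card_fin, nsmul_eq_mul]
    field_simp
  rw [h6]
  exact mul_nonneg (by positivity) (Finset.sum_nonneg fun r _ => sub_nonneg.2 (key r))

variable {β : Type*} [Fintype β] [MeasurableSpace β] [MeasurableSingletonClass β] {ν : Measure β}
  [IsProbabilityMeasure ν] {Ω : β → ι → ℝ}

/-- Convergence of stochastic gradient descent for a two-layer model with bounded features, started
at a point where the Gram matrix is well conditioned and the loss is moderate. -/
theorem features_sgd {Θ : (ℕ → β) → ℕ → (Fin m → V) × (Fin m → ℝ)} {η lam Rw Ra : ℝ}
    (hF : FeatureBounds W ψ D q) (hm : 1 ≤ m) (hQ : 0 < Q) (hq : ∑ j, q j ^ 2 ≤ 2 * Q ^ 2)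
    (hΩ0 : ∀ s j, 0 ≤ Ω s j) (hΩq : ∀ s, ∑ j, Ω s j * q j ^ 2 ≤ 2 * Q ^ 2)
    (hΩ : ∀ j, ∫ s, Ω s j ∂ν = 1)
    (hΘ₀ : ∀ S, Θ S 0 = θ₀)
    (hΘ1 : ∀ S t r, (Θ S (t + 1)).1 r = (Θ S t).1 r - η • sqGradW ψ D τ (Ω (S t)) (Θ S t) r)
    (hΘ2 : ∀ S t r, (Θ S (t + 1)).2 r = (Θ S t).2 r - η * sqGradA ψ τ (Ω (S t)) (Θ S t) r)
    (hRw : 0 < Rw) (hRa : 0 < Ra) (hRa1 : Ra ≤ 1) (hη : 0 < η) (hlam : 0 < lam)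
    (hW : ∀ r w, ‖w - θ₀.1 r‖ ≤ Rw → w ∈ W) (ha₀ : ∀ r, |θ₀.2 r| = 1)
    (hquad : ∀ v : ι → ℝ, 3 / 4 * lam * ∑ j, v j ^ 2 ≤ quadW D θ₀ v + quadA ψ θ₀ v)
    (hR : Q ^ 2 * (8 * Rw + 6 * Ra) ≤ lam / 4) (hηQ : 400 * Q ^ 4 * η ≤ lam) (hηl : η * lam < 2)
    (hL₀ : 0 < sqLoss ψ τ 1 θ₀) (hL₀Q : 2 * sqLoss ψ τ 1 θ₀ ≤ √(m : ℝ) * Q ^ 2) :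
    (∀ t, Integrable ({S | ∀ u ≤ t, (∀ r, ‖(Θ S u).1 r - θ₀.1 r‖ ≤ Rw ∧
          |(Θ S u).2 r - θ₀.2 r| ≤ Ra) ∧ sqLoss ψ τ 1 (Θ S u) ≤ √(m : ℝ) * sqLoss ψ τ 1 θ₀}.indicator
        fun S => sqLoss ψ τ 1 (Θ S t)) (Measure.infinitePi fun _ : ℕ => ν) ∧
      ∫ S, {S | ∀ u ≤ t, (∀ r, ‖(Θ S u).1 r - θ₀.1 r‖ ≤ Rw ∧
          |(Θ S u).2 r - θ₀.2 r| ≤ Ra) ∧ sqLoss ψ τ 1 (Θ S u) ≤ √(m : ℝ) * sqLoss ψ τ 1 θ₀}.indicator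
        (fun S => sqLoss ψ τ 1 (Θ S t)) S ∂(Measure.infinitePi fun _ : ℕ => ν) ≤
        (1 - η * lam / 2) ^ t * sqLoss ψ τ 1 θ₀) ∧
    1 - (16 * Q * √(sqLoss ψ τ 1 θ₀) / (√(m : ℝ) * lam * min Rw Ra) + 1 / √(m : ℝ)) ≤
      (Measure.infinitePi fun _ : ℕ => ν).real
        {S | ∀ u, (∀ r, ‖(Θ S u).1 r - θ₀.1 r‖ ≤ Rw ∧
          |(Θ S u).2 r - θ₀.2 r| ≤ Ra) ∧
          sqLoss ψ τ 1 (Θ S u) ≤ √(m : ℝ) * sqLoss ψ τ 1 θ₀} := by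
  have hm1 : (1 : ℝ) ≤ m := by exact_mod_cast hm
  have hm0 : (0 : ℝ) < m := by linarith
  have hsm : 1 ≤ √(m : ℝ) := by rw [Real.one_le_sqrt]; exact hm1
  set good : (Fin m → V) × (Fin m → ℝ) → Prop := fun θ =>
    ∀ r, ‖θ.1 r - θ₀.1 r‖ ≤ Rw ∧ |θ.2 r - θ₀.2 r| ≤ Ra with hgood
  have hgW : ∀ θ, good θ → ∀ r, θ.1 r ∈ W := fun θ h r => hW r _ (h r).1
  have hgA : ∀ θ, good θ → ∀ r, |θ.2 r| ≤ 2 := by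
    intro θ h r
    have e1 := abs_add_le (θ.2 r - θ₀.2 r) (θ₀.2 r)
    rw [sub_add_cancel, ha₀] at e1
    linarith [(h r).2]
  -- A loss below `√m L₀` meets the requirement of `sqLoss_le_taylor` because the initial loss
  -- satisfies a bound with `√m` in place of `m`.
  have hLQ : ∀ θ : (Fin m → V) × (Fin m → ℝ), sqLoss ψ τ 1 θ ≤ √(m : ℝ) * sqLoss ψ τ 1 θ₀ → 2 * sqLoss ψ τ 1 θ ≤ m * Q ^ 2 := by
    intro θ h
    have e1 := mul_le_mul_of_nonneg_left hL₀Q (Real.sqrt_nonneg (m : ℝ))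
    rw [← mul_assoc (√(m : ℝ)) (√(m : ℝ)), Real.mul_self_sqrt hm0.le] at e1
    linarith
  let step : β → (Fin m → V) × (Fin m → ℝ) → (Fin m → V) × (Fin m → ℝ) := fun s θ =>
    (fun r => θ.1 r - η • sqGradW ψ D τ (Ω s) θ r, fun r => θ.2 r - η * sqGradA ψ τ (Ω s) θ r)
  have hΘs : ∀ S t, Θ S (t + 1) = step (S t) (Θ S t) := fun S t =>
    Prod.ext (funext fun r => hΘ1 S t r) (funext fun r => hΘ2 S t r)
  -- The root of the constant `16 Q² / m` in `sqGradW_bound`; it also covers the outer weights,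
  -- where the constant is `4 Q² / m`.
  set α := η * (4 * Q / √(m : ℝ)) with hα
  have hα0 : 0 ≤ α := by positivity
  have hmin : 0 < min Rw Ra := lt_min hRw hRa
  have hmoveW : ∀ θ s r, good θ → η * ‖sqGradW ψ D τ (Ω s) θ r‖ ≤ α * √(sqLoss ψ τ (Ω s) θ) := by
    intro θ s r h
    rw [hα, mul_assoc]
    refine mul_le_mul_of_nonneg_left ?_ hη.le
    refine abs_le_of_sq_le_sq' ?_ (by positivity) |>.2
    refine (sqGradW_bound hF hm (hΩ0 s) (hΩq s) (hgW θ h) (hgA θ h) r).trans (le_of_eq ?_)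
    rw [mul_pow, div_pow, Real.sq_sqrt hm0.le, Real.sq_sqrt (sqLoss_nonneg (hΩ0 s))]
    ring
  have hmoveA : ∀ θ s r, good θ → η * |sqGradA ψ τ (Ω s) θ r| ≤ α * √(sqLoss ψ τ (Ω s) θ) := by
    intro θ s r h
    have h0 : 0 ≤ sqLoss ψ τ (Ω s) θ := sqLoss_nonneg (hΩ0 s)
    rw [hα, mul_assoc]
    refine mul_le_mul_of_nonneg_left ?_ hη.le
    refine abs_le_of_sq_le_sq' ?_ (by positivity) |>.2
    rw [sq_abs]
    refine (sqGradA_bound hF hm (hΩ0 s) (hΩq s) (hgW θ h) r).trans ?_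
    rw [mul_pow, div_pow, Real.sq_sqrt hm0.le, Real.sq_sqrt h0, mul_pow, mul_div_right_comm]
    refine mul_le_mul_of_nonneg_right ?_ h0
    gcongr
    norm_num
  have hmain := stopped_descent (ν := ν) (step := step) (Θ := Θ) (x₀ := θ₀)
    (Lo := fun θ => sqLoss ψ τ 1 θ) (U := fun s θ => stepBound ψ D τ Q η (Ω s) θ)
    (Bt := fun s θ => sqLoss ψ τ (Ω s) θ) (good := good) (ρ := 1 - η * lam / 2)
    (M := √(m : ℝ)) (α := α) (R := min Rw Ra) hΘ₀ hΘs
    (fun θ => sqLoss_nonneg fun _ => zero_le_one) (fun s θ => sqLoss_nonneg (hΩ0 s))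
    (by linarith) (by nlinarith [mul_pos hη hlam]) hsm hα0 hmin
    (fun r => by simp [hRw.le, hRa.le]) hL₀
    (fun θ h hl s => stepBound_nonneg hF hm hη.le (hΩ0 s) hq (hΩq s) (hgW θ h) (hgA θ h))
    (fun θ h hl s h' => sqLoss_step_le hF hm (hΩ0 s) hq (hΩq s) (hgW θ h) (hgA θ h) (hgW _ h')
      (hLQ θ hl) (fun r => rfl) (fun r => rfl))
    ?_ (fun θ => (integral_sqLoss hΩ).le) ?_
  · refine ⟨hmain.1, ?_⟩
    refine le_trans (le_of_eq ?_) hmain.2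
    congr 2
    rw [hα]
    -- The step length and the decay rate are both proportional to `η`, so `η` cancels from the
    -- failure probability.
    have : 1 - (1 - η * lam / 2) = η * lam / 2 := by ring
    rw [this]
    field_simp
    ring
  · intro θ h hl
    -- The two perturbations cost `Q² (8 Rw + 6 Ra) ≤ lam / 4`, which lowers `3/4 lam` to the
    -- required `lam / 2`.
    refine integral_stepBound_le hΩ hη.le (fun v => ?_) hηQ
    have h0 : ∀ r, θ₀.1 r ∈ W := fun r => hW r _ (by simpa using hRw.le)
    have e1 := quadW_perturb hF hm hq (hgW θ h) h0 ha₀ hRw.le hRa1 (fun r => (h r).1)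
      (fun r => (h r).2) v
    have e2 := quadA_perturb hF hm hq (hgW θ h) h0 hRw.le (fun r => (h r).1) v
    have hv0 : 0 ≤ ∑ j, v j ^ 2 := Finset.sum_nonneg fun _ _ => sq_nonneg _
    nlinarith [hquad v, mul_le_mul_of_nonneg_right hR hv0]
  · intro S t hg hsum r
    have hsum' := hsum
    constructor
    · refine le_trans ?_ (hsum.trans (min_le_left _ _))
      -- Telescoping: the displacement of a neuron is at most the sum of its step lengths.
      have : ∀ n ≤ t + 1, ‖(Θ S n).1 r - θ₀.1 r‖ ≤
          ∑ u ∈ Finset.range n, α * √(sqLoss ψ τ (Ω (S u)) (Θ S u)) := by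
        intro n
        induction n with
        | zero => intro _; simp [hΘ₀]
        | succ n ih =>
          intro hn
          rw [Finset.sum_range_succ, hΘ1, sub_right_comm]
          refine (norm_sub_le _ _).trans (add_le_add (ih (by omega)) ?_)
          rw [norm_smul, Real.norm_eq_abs, abs_of_pos hη]
          exact hmoveW _ _ _ (hg n (by omega))
      exact this _ le_rfl
    · refine le_trans ?_ (hsum.trans (min_le_right _ _))
      have : ∀ n ≤ t + 1, |(Θ S n).2 r - θ₀.2 r| ≤
          ∑ u ∈ Finset.range n, α * √(sqLoss ψ τ (Ω (S u)) (Θ S u)) := by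
        intro n
        induction n with
        | zero => intro _; simp [hΘ₀]
        | succ n ih =>
          intro hn
          rw [Finset.sum_range_succ, hΘ2, sub_right_comm]
          refine (abs_sub _ _).trans (add_le_add (ih (by omega)) ?_)
          rw [abs_mul, abs_of_pos hη]
          exact hmoveA _ _ _ (hg n (by omega))
      exact this _ le_rfl

end FeatureSGD
end PINN
end

noncomputable section
namespace PINN

/-! ### The network residuals as outputs of a two-layer model -/

section Network

variable {d n₁ n₂ m : ℕ}

/-- The projection onto the first `d` coordinates. -/
def spatial (d : ℕ) : EuclideanSpace ℝ (Fin (d + 1)) →L[ℝ] EuclideanSpace ℝ (Fin d) :=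
  LinearMap.toContinuousLinearMap
    { toFun := fun w => WithLp.toLp 2 fun i => w i.castSucc
      map_add' := fun _ _ => rfl
      map_smul' := fun _ _ => rfl }

theorem spatial_apply (w : EuclideanSpace ℝ (Fin (d + 1))) (i : Fin d) :
    spatial d w i = w i.castSucc := rfl

theorem norm_sq_eq_spatial (w : EuclideanSpace ℝ (Fin (d + 1))) :
    ‖w‖ ^ 2 = ‖spatial d w‖ ^ 2 + w (Fin.last d) ^ 2 := by
  rw [EuclideanSpace.norm_sq_eq, EuclideanSpace.norm_sq_eq, Fin.sum_univ_castSucc]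
  simp [spatial_apply]

theorem norm_spatial_le (w : EuclideanSpace ℝ (Fin (d + 1))) : ‖spatial d w‖ ≤ ‖w‖ := by
  refine abs_le_of_sq_le_sq' ?_ (norm_nonneg _) |>.2
  rw [norm_sq_eq_spatial w]
  nlinarith [sq_nonneg (w (Fin.last d))]

theorem norm_spatial_clm_le : ‖spatial d‖ ≤ 1 :=
  ContinuousLinearMap.opNorm_le_bound _ zero_le_one fun w => by simpa using norm_spatial_le w

theorem norm_adjoint_spatial_le (u : EuclideanSpace ℝ (Fin d)) :
    ‖ContinuousLinearMap.adjoint (spatial d) u‖ ≤ ‖u‖ := by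
  have h := (ContinuousLinearMap.adjoint (spatial d)).le_opNorm u
  rw [LinearIsometryEquiv.norm_map] at h
  exact h.trans (mul_le_of_le_one_left (norm_nonneg _) norm_spatial_clm_le)

theorem inner_extendedPoint (w : EuclideanSpace ℝ (Fin (d + 1))) (x : EuclideanSpace ℝ (Fin d)) :
    inner ℝ w (extendedPoint x) = inner ℝ (spatial d w) x + w (Fin.last d) := by
  simp only [PiLp.inner_apply, RCLike.inner_apply, conj_trivial]
  rw [Fin.sum_univ_castSucc]
  simp [extendedPoint, spatial_apply]

theorem norm_extendedPoint_sq (x : EuclideanSpace ℝ (Fin d)) :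
    ‖extendedPoint x‖ ^ 2 = ‖x‖ ^ 2 + 1 := by
  rw [EuclideanSpace.norm_sq_eq, EuclideanSpace.norm_sq_eq, Fin.sum_univ_castSucc]
  simp [extendedPoint]

theorem norm_extendedPoint_le {x : EuclideanSpace ℝ (Fin d)} (hx : ‖x‖ ≤ 1) :
    ‖extendedPoint x‖ ≤ √2 := by
  refine Real.le_sqrt_of_sq_le ?_
  rw [norm_extendedPoint_sq]
  nlinarith [norm_nonneg x]

theorem hasDerivAt_iteratedDeriv {σ : ℝ → ℝ} (hσ : ContDiff ℝ 3 σ) {k : ℕ} (hk : k < 3) (z : ℝ) :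
    HasDerivAt (iteratedDeriv k σ) (iteratedDeriv (k + 1) σ z) z := by
  rw [iteratedDeriv_succ]
  exact ((hσ.differentiable_iteratedDeriv k (by exact_mod_cast hk)) z).hasDerivAt

/-- Second derivatives along an orthonormal basis give `⟪u, eᵢ⟫² σ''`; Parseval's identity sums the
squares to `‖u‖²`. -/
theorem laplacian_ridge {σ : ℝ → ℝ} (hσ : ContDiff ℝ 3 σ) (u : EuclideanSpace ℝ (Fin d)) (b : ℝ)
    (x : EuclideanSpace ℝ (Fin d)) :
    Laplacian.laplacian (fun x => σ (inner ℝ u x + b)) x =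
      ‖u‖ ^ 2 * iteratedDeriv 2 σ (inner ℝ u x + b) := by
  have h0 : ∀ k < 3, ∀ x : EuclideanSpace ℝ (Fin d),
      HasFDerivAt (fun x => iteratedDeriv k σ (inner ℝ u x + b))
        (iteratedDeriv (k + 1) σ (inner ℝ u x + b) • innerSL ℝ u) x := by
    intro k hk x
    have h1 := hasDerivAt_iteratedDeriv hσ hk (inner ℝ u x + b)
    have h2 : HasFDerivAt (fun x => inner ℝ u x + b) (innerSL ℝ u) x :=
      ((innerSL ℝ u).hasFDerivAt).add_const b
    exact h1.comp_hasFDerivAt x h2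
  rw [InnerProductSpace.laplacian_eq_iteratedFDeriv_orthonormalBasis _ (EuclideanSpace.basisFun (Fin d) ℝ)]
  have h1 : fderiv ℝ (fun x => σ (inner ℝ u x + b)) =
      fun x => iteratedDeriv 1 σ (inner ℝ u x + b) • innerSL ℝ u := by
    funext x
    have := h0 0 (by norm_num) x
    simp only [iteratedDeriv_zero] at this
    exact this.fderiv
  have h2 : ∀ x, HasFDerivAt (fun x => iteratedDeriv 1 σ (inner ℝ u x + b) • innerSL ℝ u)
      ((iteratedDeriv 2 σ (inner ℝ u x + b) • innerSL ℝ u).smulRight (innerSL ℝ u)) x := by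
    intro x
    exact (h0 1 (by norm_num) x).smul_const (innerSL ℝ u)
  have h3 : ‖u‖ ^ 2 = ∑ i, inner ℝ u (EuclideanSpace.basisFun (Fin d) ℝ i) ^ 2 := by
    rw [← (EuclideanSpace.basisFun (Fin d) ℝ).sum_sq_norm_inner_left u]
    simp
  rw [h3, Finset.sum_mul]
  refine Finset.sum_congr rfl fun i _ => ?_
  rw [iteratedFDeriv_two_apply, h1, (h2 x).fderiv]
  simp
  ring

theorem laplacian_network {σ : ℝ → ℝ} (hσ : ContDiff ℝ 3 σ) (θ : Params m d)
    (x : EuclideanSpace ℝ (Fin d)) :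
    Laplacian.laplacian (network σ θ) x = 1 / √(m : ℝ) * ∑ r, θ.2 r *
      (‖spatial d (θ.1 r)‖ ^ 2 * iteratedDeriv 2 σ (inner ℝ (θ.1 r) (extendedPoint x))) := by
  have hc : ∀ r, ContDiff ℝ 2 fun x => σ (inner ℝ (spatial d (θ.1 r)) x + θ.1 r (Fin.last d)) := by
    intro r
    refine (hσ.of_le (by norm_num)).comp ?_
    exact ((innerSL ℝ (spatial d (θ.1 r))).contDiff).add contDiff_const
  have hs : ∀ r, ContDiff ℝ 2
      (θ.2 r • fun x => σ (inner ℝ (spatial d (θ.1 r)) x + θ.1 r (Fin.last d))) :=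
    fun r => contDiff_const.smul (hc r)
  have h1 : network σ θ = (1 / √(m : ℝ)) • fun x => ∑ r, (θ.2 r •
      fun x => σ (inner ℝ (spatial d (θ.1 r)) x + θ.1 r (Fin.last d))) x := by
    funext x
    simp [network, inner_extendedPoint]
  have hsum : ∀ s : Finset (Fin m), Laplacian.laplacian (fun x => ∑ r ∈ s, (θ.2 r •
      fun x => σ (inner ℝ (spatial d (θ.1 r)) x + θ.1 r (Fin.last d))) x) x =
      ∑ r ∈ s, θ.2 r *
      (‖spatial d (θ.1 r)‖ ^ 2 * iteratedDeriv 2 σ (inner ℝ (θ.1 r) (extendedPoint x))) := by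
    intro s
    classical
    induction s using Finset.induction_on with
    | empty => simp
    | insert r s hr ih =>
      simp_rw [Finset.sum_insert hr]
      have e := ContDiffAt.laplacian_add (x := x)
        (f₁ := θ.2 r • fun x => σ (inner ℝ (spatial d (θ.1 r)) x + θ.1 r (Fin.last d)))
        (f₂ := fun x => ∑ r ∈ s, (θ.2 r •
          fun x => σ (inner ℝ (spatial d (θ.1 r)) x + θ.1 r (Fin.last d))) x)
        (hs r).contDiffAt (ContDiff.sum fun r _ => hs r).contDiffAt
      have e2 : ((θ.2 r • fun x => σ (inner ℝ (spatial d (θ.1 r)) x + θ.1 r (Fin.last d))) +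
        fun x => ∑ r ∈ s, (θ.2 r •
          fun x => σ (inner ℝ (spatial d (θ.1 r)) x + θ.1 r (Fin.last d))) x) =
        fun x => (θ.2 r • fun x => σ (inner ℝ (spatial d (θ.1 r)) x + θ.1 r (Fin.last d))) x +
          ∑ r ∈ s, (θ.2 r •
          fun x => σ (inner ℝ (spatial d (θ.1 r)) x + θ.1 r (Fin.last d))) x := rfl
      rw [← e2, e, ih, InnerProductSpace.laplacian_smul _ (hc r).contDiffAt,
        laplacian_ridge hσ, inner_extendedPoint]
      rfl
  have hS : ContDiff ℝ 2 fun x => ∑ r, (θ.2 r •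
      fun x => σ (inner ℝ (spatial d (θ.1 r)) x + θ.1 r (Fin.last d))) x :=
    ContDiff.sum fun r _ => hs r
  rw [h1, InnerProductSpace.laplacian_smul _ hS.contDiffAt, hsum]
  rfl

namespace Problem

/-- The feature of a single neuron that enters the entry `j` of the loss vector. -/
def feature (P : Problem d n₁ n₂) (j : Fin n₁ ⊕ Fin n₂) (w : EuclideanSpace ℝ (Fin (d + 1))) : ℝ :=
  Sum.elim (fun p => 1 / √(n₁ : ℝ) *
      (‖spatial d w‖ ^ 2 * iteratedDeriv 2 P.σ (inner ℝ w (extendedPoint (P.x p)))))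
    (fun q => √(P.γ / (n₂ : ℝ)) * P.σ (inner ℝ w (extendedPoint (P.y q)))) j

/-- The gradient of `feature`. -/
def featureGrad (P : Problem d n₁ n₂) (j : Fin n₁ ⊕ Fin n₂) (w : EuclideanSpace ℝ (Fin (d + 1))) :
    EuclideanSpace ℝ (Fin (d + 1)) :=
  Sum.elim (fun p => (1 / √(n₁ : ℝ)) •
      ((2 * iteratedDeriv 2 P.σ (inner ℝ w (extendedPoint (P.x p)))) •
        ContinuousLinearMap.adjoint (spatial d) (spatial d w) +
      (‖spatial d w‖ ^ 2 * iteratedDeriv 3 P.σ (inner ℝ w (extendedPoint (P.x p)))) •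
        extendedPoint (P.x p)))
    (fun q => (√(P.γ / (n₂ : ℝ)) * iteratedDeriv 1 P.σ (inner ℝ w (extendedPoint (P.y q)))) •
      extendedPoint (P.y q)) j

/-- The scaled data `f(x_p)`, `g(y_q)`. -/
def target (P : Problem d n₁ n₂) (j : Fin n₁ ⊕ Fin n₂) : ℝ :=
  Sum.elim (fun p => 1 / √(n₁ : ℝ) * P.f (P.x p)) (fun q => √(P.γ / (n₂ : ℝ)) * P.g (P.y q)) j

variable {P : Problem d n₁ n₂}

/-- Linearity of the Laplacian in the neurons: the differential equation only changes the feature,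
so both kinds of residuals are treated alike. -/
theorem lossVector_eq_output (hσ : ContDiff ℝ 3 P.σ) (j : Fin n₁ ⊕ Fin n₂) (θ : Params m d) :
    P.lossVector j θ = output P.feature P.target θ j := by
  rcases j with p | q
  · simp only [lossVector, interiorResidual, output, feature, target, Sum.elim_inl,
      laplacian_network hσ, Finset.mul_sum, mul_sub]
    congr 1
    refine Finset.sum_congr rfl fun r _ => ?_
    ring
  · simp only [lossVector, boundaryResidual, output, feature, target, Sum.elim_inr, network,
      Finset.mul_sum, mul_sub]
    congr 1
    refine Finset.sum_congr rfl fun r _ => ?_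
    ring

theorem hasGradientAt_feature (hσ : ContDiff ℝ 3 P.σ) (j : Fin n₁ ⊕ Fin n₂)
    (w : EuclideanSpace ℝ (Fin (d + 1))) : HasGradientAt (P.feature j) (P.featureGrad j w) w := by
  have h0 : ∀ k < 3, ∀ x : EuclideanSpace ℝ (Fin d),
      HasFDerivAt (fun w => iteratedDeriv k P.σ (inner ℝ w (extendedPoint x)))
        (iteratedDeriv (k + 1) P.σ (inner ℝ w (extendedPoint x)) •
          innerSL ℝ (extendedPoint x)) w := by
    intro k hk x
    have h1 := hasDerivAt_iteratedDeriv hσ hk (inner ℝ w (extendedPoint x))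
    have h2 : HasFDerivAt (fun w => inner ℝ w (extendedPoint x)) (innerSL ℝ (extendedPoint x)) w := by
      have h3 : (fun w => inner ℝ w (extendedPoint x)) = innerSL ℝ (extendedPoint x) := by
        funext w
        exact real_inner_comm _ _
      rw [h3]
      exact (innerSL ℝ (extendedPoint x)).hasFDerivAt
    exact h1.comp_hasFDerivAt w h2
  rw [hasGradientAt_iff_hasFDerivAt]
  rcases j with p | q
  · have h1 : HasFDerivAt (fun w => ‖spatial d w‖ ^ 2)
        ((2 : ℝ) • (innerSL ℝ (spatial d w)).comp (spatial d)) w := by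
      refine HasFDerivAt.congr_fderiv ((spatial d).hasFDerivAt (x := w)).norm_sq ?_
      ext v
      simp [two_mul]
    have h2 := (h1.mul (h0 2 (by norm_num) (P.x p))).const_mul (1 / √(n₁ : ℝ))
    refine HasFDerivAt.congr_fderiv h2 ?_
    ext v
    simp [featureGrad, ContinuousLinearMap.adjoint_inner_left]
    ring
  · have h2 := (h0 0 (by norm_num) (P.y q)).const_mul √(P.γ / (n₂ : ℝ))
    simp only [iteratedDeriv_zero] at h2
    refine HasFDerivAt.congr_fderiv h2 ?_
    ext v
    simp [featureGrad]
    ring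

end Problem

end Network
end PINN
end

noncomputable section
namespace PINN

/-! ### Identification of the partial gradients with the explicit formulas -/

section Gradients

variable {ι : Type*} {d m : ℕ} {ψ : ι → EuclideanSpace ℝ (Fin (d + 1)) → ℝ}
  {D : ι → EuclideanSpace ℝ (Fin (d + 1)) → EuclideanSpace ℝ (Fin (d + 1))} {τ ω : ι → ℝ}

theorem hasGradientAt_output (hψ : ∀ j w, HasGradientAt (ψ j) (D j w) w) (θ : Params m d)
    (r : Fin m) (j : ι) :
    HasGradientAt (fun v => output ψ τ (Function.update θ.1 r v, θ.2) j)
      ((1 / √(m : ℝ) * θ.2 r) • D j (θ.1 r)) (θ.1 r) := by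
  have h1 : (fun v => output ψ τ (Function.update θ.1 r v, θ.2) j) = fun v =>
      1 / √(m : ℝ) * (θ.2 r * ψ j v + ∑ s ∈ Finset.univ.erase r, θ.2 s * ψ j (θ.1 s)) - τ j := by
    funext v
    unfold output
    rw [← Finset.add_sum_erase _ _ (Finset.mem_univ r)]
    simp only [Function.update_self]
    congr 3
    refine Finset.sum_congr rfl fun s hs => ?_
    rw [Function.update_of_ne (Finset.ne_of_mem_erase hs)]
  rw [h1]
  have h2 := hasGradientAt_iff_hasFDerivAt.1 (hψ j (θ.1 r))
  rw [hasGradientAt_iff_hasFDerivAt]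
  refine HasFDerivAt.congr_fderiv ((((h2.const_mul (θ.2 r)).add_const _).const_mul
    (1 / √(m : ℝ))).sub_const _) ?_
  rw [map_smul, smul_smul]

theorem hasDerivAt_output (θ : Params m d) (r : Fin m) (j : ι) :
    HasDerivAt (fun b => output ψ τ (θ.1, Function.update θ.2 r b) j)
      (1 / √(m : ℝ) * ψ j (θ.1 r)) (θ.2 r) := by
  have h1 : (fun b => output ψ τ (θ.1, Function.update θ.2 r b) j) = fun b =>
      1 / √(m : ℝ) * (b * ψ j (θ.1 r) + ∑ s ∈ Finset.univ.erase r, θ.2 s * ψ j (θ.1 s)) - τ j := by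
    funext v
    unfold output
    rw [← Finset.add_sum_erase _ _ (Finset.mem_univ r)]
    simp only [Function.update_self]
    congr 3
    refine Finset.sum_congr rfl fun s hs => ?_
    rw [Function.update_of_ne (Finset.ne_of_mem_erase hs)]
  rw [h1]
  have h2 := (((((hasDerivAt_id (θ.2 r)).mul_const (ψ j (θ.1 r))).add_const
    (∑ s ∈ Finset.univ.erase r, θ.2 s * ψ j (θ.1 s))).const_mul (1 / √(m : ℝ))).sub_const (τ j))
  simpa using h2

variable [Fintype ι]

theorem gradW_sqLoss (hψ : ∀ j w, HasGradientAt (ψ j) (D j w) w) (θ : Params m d) (r : Fin m) :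
    gradW (sqLoss ψ τ ω) θ r = sqGradW ψ D τ ω θ r := by
  unfold gradW
  refine HasGradientAt.gradient ?_
  rw [hasGradientAt_iff_hasFDerivAt]
  have h1 := fun j => hasGradientAt_iff_hasFDerivAt.1 (hasGradientAt_output (τ := τ) hψ θ r j)
  have h2 := (HasFDerivAt.fun_sum (u := Finset.univ) fun j _ =>
    ((h1 j).pow 2).const_mul (ω j)).const_mul (1 / 2 : ℝ)
  refine HasFDerivAt.congr_fderiv h2 ?_
  ext v
  simp only [sqGradW, Function.update_eq_self, Finset.smul_sum, map_sum, map_smul,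
    _root_.smul_apply, _root_.sum_apply, smul_eq_mul]
  refine Finset.sum_congr rfl fun j _ => ?_
  simp
  ring

theorem gradA_sqLoss (θ : Params m d) (r : Fin m) :
    gradA (sqLoss ψ τ ω) θ r = sqGradA ψ τ ω θ r := by
  unfold gradA
  refine HasDerivAt.deriv ?_
  have h1 := fun j => hasDerivAt_output (ψ := ψ) (τ := τ) θ r j
  have h2 := (HasDerivAt.fun_sum (u := Finset.univ) fun j _ =>
    ((h1 j).pow 2).const_mul (ω j)).const_mul (1 / 2 : ℝ)
  refine HasDerivAt.congr_deriv h2 ?_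
  simp only [sqGradA, Function.update_eq_self, Finset.mul_sum]
  refine Finset.sum_congr rfl fun j _ => ?_
  simp
  ring

end Gradients

/-! ### Sampled losses as reweighted losses, Gram matrices and the stopping time -/

namespace Problem

variable {d n₁ n₂ m : ℕ} {P : Problem d n₁ n₂}

/-- The weights of the entries of the loss vector in the mini-batch loss. -/
def batchWeight (S : Finset (Fin n₁) × Finset (Fin n₂)) (j : Fin n₁ ⊕ Fin n₂) : ℝ :=
  Sum.elim (fun p => if p ∈ S.1 then (n₁ : ℝ) / S.1.card else 0)
    (fun q => if q ∈ S.2 then (n₂ : ℝ) / S.2.card else 0) j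

theorem batchWeight_nonneg (S : Finset (Fin n₁) × Finset (Fin n₂)) (j : Fin n₁ ⊕ Fin n₂) :
    0 ≤ batchWeight S j := by
  rcases j with p | q <;> simp only [batchWeight, Sum.elim_inl, Sum.elim_inr] <;> split_ifs <;>
    positivity

theorem loss_eq_sqLoss (hσ : ContDiff ℝ 3 P.σ) (hγ : 0 ≤ P.γ) (θ : Params m d) :
    P.loss θ = sqLoss P.feature P.target 1 θ := by
  unfold loss sqLoss
  rw [Fintype.sum_sum_type, mul_add, Finset.mul_sum, Finset.mul_sum]
  simp_rw [← lossVector_eq_output hσ]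
  congr 1
  · refine Finset.sum_congr rfl fun p _ => ?_
    simp only [lossVector, Sum.elim_inl, Pi.one_apply, mul_pow, div_pow]
    rw [Real.sq_sqrt (by positivity)]
    ring
  · refine Finset.sum_congr rfl fun p _ => ?_
    simp only [lossVector, Sum.elim_inr, Pi.one_apply, mul_pow]
    rw [Real.sq_sqrt (by positivity)]
    ring

/-- The ratio of the normalizations `1/(2b)` and `1/(2n)` is the weight `n/b` on the chosen indices;
the others get weight `0`. -/
theorem batchLoss_eq_sqLoss (hσ : ContDiff ℝ 3 P.σ) (hγ : 0 ≤ P.γ)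
    (S : Finset (Fin n₁) × Finset (Fin n₂)) :
    (P.batchLoss S : Params m d → ℝ) = sqLoss P.feature P.target (batchWeight S) := by
  funext θ
  unfold batchLoss sqLoss
  rw [Fintype.sum_sum_type, mul_add, Finset.mul_sum, Finset.mul_sum]
  simp_rw [← lossVector_eq_output hσ]
  congr 1
  · rw [← Finset.sum_subset (Finset.subset_univ S.1)]
    · refine Finset.sum_congr rfl fun p hp => ?_
      have hn : (0 : ℝ) < n₁ := by exact_mod_cast p.pos
      simp only [batchWeight, lossVector, Sum.elim_inl, mul_pow, div_pow, if_pos hp]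
      rw [Real.sq_sqrt hn.le]
      field_simp
    · intro p _ hp
      simp [batchWeight, hp]
  · rw [← Finset.sum_subset (Finset.subset_univ S.2)]
    · refine Finset.sum_congr rfl fun p hp => ?_
      have hn : (0 : ℝ) < n₂ := by exact_mod_cast p.pos
      simp only [batchWeight, lossVector, Sum.elim_inr, mul_pow, if_pos hp]
      rw [Real.sq_sqrt (by positivity)]
      field_simp
    · intro p _ hp
      simp [batchWeight, hp]

theorem sgd_succ_fst (hσ : ContDiff ℝ 3 P.σ) (hγ : 0 ≤ P.γ) (η : ℝ) (θ₀ : Params m d)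
    (S : ℕ → Finset (Fin n₁) × Finset (Fin n₂)) (t : ℕ) (r : Fin m) :
    (P.sgd η θ₀ S (t + 1)).1 r = (P.sgd η θ₀ S t).1 r -
      η • sqGradW P.feature P.featureGrad P.target (batchWeight (S t)) (P.sgd η θ₀ S t) r := by
  rw [← gradW_sqLoss (hasGradientAt_feature hσ), ← batchLoss_eq_sqLoss hσ hγ]
  rfl

theorem sgd_succ_snd (hσ : ContDiff ℝ 3 P.σ) (hγ : 0 ≤ P.γ) (η : ℝ) (θ₀ : Params m d)
    (S : ℕ → Finset (Fin n₁) × Finset (Fin n₂)) (t : ℕ) (r : Fin m) :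
    (P.sgd η θ₀ S (t + 1)).2 r = (P.sgd η θ₀ S t).2 r -
      η * sqGradA P.feature P.target (batchWeight (S t)) (P.sgd η θ₀ S t) r := by
  rw [← gradA_sqLoss, ← batchLoss_eq_sqLoss hσ hγ]
  rfl

theorem gradW_lossVector (hσ : ContDiff ℝ 3 P.σ) (j : Fin n₁ ⊕ Fin n₂) (θ : Params m d)
    (r : Fin m) :
    gradW (P.lossVector j) θ r = (1 / √(m : ℝ) * θ.2 r) • P.featureGrad j (θ.1 r) := by
  unfold gradW
  simp_rw [lossVector_eq_output hσ]
  exact (hasGradientAt_output (hasGradientAt_feature hσ) θ r j).gradient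

theorem gradA_lossVector (hσ : ContDiff ℝ 3 P.σ) (j : Fin n₁ ⊕ Fin n₂) (θ : Params m d)
    (r : Fin m) :
    gradA (P.lossVector j) θ r = 1 / √(m : ℝ) * P.feature j (θ.1 r) := by
  unfold gradA
  simp_rw [lossVector_eq_output hσ]
  exact (hasDerivAt_output θ r j).deriv

theorem gramW_apply (hσ : ContDiff ℝ 3 P.σ) (θ : Params m d) (j k : Fin n₁ ⊕ Fin n₂) :
    P.gramW θ j k = 1 / (m : ℝ) * ∑ r, θ.2 r ^ 2 *
      inner ℝ (P.featureGrad j (θ.1 r)) (P.featureGrad k (θ.1 r)) := by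
  simp only [gramW, Matrix.of_apply, gradW_lossVector hσ, Finset.mul_sum]
  refine Finset.sum_congr rfl fun r _ => ?_
  have e : (1 / √(m : ℝ)) * (1 / √(m : ℝ)) = 1 / m := by
    rw [← sq, div_pow, Real.sq_sqrt (by positivity), one_pow]
  rw [inner_smul_left, inner_smul_right, ← e]
  simp only [conj_trivial]
  ring

theorem gramA_apply (hσ : ContDiff ℝ 3 P.σ) (θ : Params m d) (j k : Fin n₁ ⊕ Fin n₂) :
    P.gramA θ j k = 1 / (m : ℝ) * ∑ r, P.feature j (θ.1 r) * P.feature k (θ.1 r) := by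
  simp only [gramA, Matrix.of_apply, gradA_lossVector hσ, Finset.mul_sum]
  refine Finset.sum_congr rfl fun r _ => ?_
  have e : (1 / √(m : ℝ)) * (1 / √(m : ℝ)) = 1 / m := by
    rw [← sq, div_pow, Real.sq_sqrt (by positivity), one_pow]
  rw [← e]
  ring

theorem lt_stoppingTime_iff {η Rw Ra : ℝ} {θ₀ : Params m d}
    {S : ℕ → Finset (Fin n₁) × Finset (Fin n₂)} {t : ℕ} :
    (t : ℕ∞) < P.stoppingTime η Rw Ra θ₀ S ↔ ∀ u ≤ t,
      (∀ r, ‖(P.sgd η θ₀ S u).1 r - θ₀.1 r‖ ≤ Rw ∧ |(P.sgd η θ₀ S u).2 r - θ₀.2 r| ≤ Ra) ∧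
        P.loss (P.sgd η θ₀ S u) ≤ √(m : ℝ) * P.loss θ₀ := by
  unfold stoppingTime
  constructor
  · intro h u hu
    by_contra hn
    have h2 := h.trans_le (sInf_le ⟨u, hn, rfl⟩)
    rw [Nat.cast_lt] at h2
    omega
  · intro h
    have h1 : ((t + 1 : ℕ) : ℕ∞) ≤ sInf ((fun t : ℕ => (t : ℕ∞)) '' {t : ℕ |
        ¬ ((∀ r, ‖(P.sgd η θ₀ S t).1 r - θ₀.1 r‖ ≤ Rw ∧
          |(P.sgd η θ₀ S t).2 r - θ₀.2 r| ≤ Ra) ∧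
          P.loss (P.sgd η θ₀ S t) ≤ √(m : ℝ) * P.loss θ₀)}) := by
      refine le_sInf ?_
      rintro _ ⟨u, hu, rfl⟩
      by_contra hlt
      rw [not_le, Nat.cast_lt] at hlt
      exact hu (h u (by omega))
    refine lt_of_lt_of_le ?_ h1
    rw [Nat.cast_lt]
    omega

theorem stoppingTime_eq_top_iff {η Rw Ra : ℝ} {θ₀ : Params m d}
    {S : ℕ → Finset (Fin n₁) × Finset (Fin n₂)} :
    P.stoppingTime η Rw Ra θ₀ S = ⊤ ↔ ∀ u,
      (∀ r, ‖(P.sgd η θ₀ S u).1 r - θ₀.1 r‖ ≤ Rw ∧ |(P.sgd η θ₀ S u).2 r - θ₀.2 r| ≤ Ra) ∧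
        P.loss (P.sgd η θ₀ S u) ≤ √(m : ℝ) * P.loss θ₀ := by
  constructor
  · intro h u
    have : ((u : ℕ) : ℕ∞) < P.stoppingTime η Rw Ra θ₀ S := by rw [h]; exact ENat.natCast_lt_top u
    exact lt_stoppingTime_iff.1 this u le_rfl
  · intro h
    rw [ENat.eq_top_iff_forall_gt]
    intro t
    exact lt_stoppingTime_iff.2 fun u _ => h u

end Problem

/-! ### Uniform mini-batches: weights of mean one and sums of squared scales -/

section BatchLaw

/-- The sets avoiding `p` are the `b`-subsets of the remaining `n - 1` indices. Pascal's rule leaves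
`(n - 1).choose (b - 1)` sets containing `p`. -/
theorem card_filter_mem_powersetCard {n b : ℕ} (hb : 1 ≤ b) (p : Fin n) :
    n * ((Finset.powersetCard b (Finset.univ : Finset (Fin n))).filter fun I => p ∈ I).card =
      b * n.choose b := by
  have h1 : (Finset.powersetCard b (Finset.univ : Finset (Fin n))).filter (fun I => p ∉ I) =
      Finset.powersetCard b (Finset.univ.erase p) := by
    ext I
    simp only [Finset.mem_filter, Finset.mem_powersetCard, Finset.subset_univ, true_and,
      Finset.subset_erase]
    tauto
  have h2 := Finset.card_filter_add_card_filter_not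
    (s := Finset.powersetCard b (Finset.univ : Finset (Fin n))) (fun I => p ∈ I)
  rw [h1, Finset.card_powersetCard, Finset.card_powersetCard, Finset.card_erase_of_mem
    (Finset.mem_univ p), Finset.card_univ, Fintype.card_fin] at h2
  obtain ⟨k, rfl⟩ : ∃ k, n = k + 1 := ⟨n - 1, by have := p.pos; omega⟩
  obtain ⟨c, rfl⟩ : ∃ c, b = c + 1 := ⟨b - 1, by omega⟩
  rw [Nat.add_sub_cancel, Nat.choose_succ_succ] at h2
  have h3 := Nat.add_one_mul_choose_eq k c
  have h4 : ((Finset.powersetCard (c + 1) (Finset.univ : Finset (Fin (k + 1)))).filter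
      fun I => p ∈ I).card = k.choose c := by
    simp only [Nat.succ_eq_add_one] at h2
    omega
  rw [h4, h3, mul_comm]

instance {n b : ℕ} (hb : b ≤ n) : IsProbabilityMeasure (batchLaw hb) := by
  unfold batchLaw; infer_instance

theorem integral_batchLaw_weight {n b : ℕ} (hb : b ≤ n) (hb1 : 1 ≤ b) (p : Fin n) :
    ∫ I, (if p ∈ I then (n : ℝ) / (I : Finset (Fin n)).card else 0) ∂(batchLaw hb) = 1 := by
  unfold batchLaw
  rw [PMF.integral_eq_sum]
  have h1 : ∀ I : Finset (Fin n), ((PMF.uniformOfFinset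
      (Finset.powersetCard b (Finset.univ : Finset (Fin n)))
      (Finset.powersetCard_nonempty.2 (by simpa using hb))) I).toReal •
        (if p ∈ I then (n : ℝ) / I.card else 0) =
      if I ∈ (Finset.powersetCard b (Finset.univ : Finset (Fin n))).filter (fun I => p ∈ I) then
        (n : ℝ) / (b * n.choose b) else 0 := by
    intro I
    rw [PMF.uniformOfFinset_apply]
    simp only [Finset.mem_filter, Finset.mem_powersetCard, Finset.subset_univ, true_and,
      Finset.card_powersetCard, Finset.card_univ, Fintype.card_fin]
    by_cases hI : I.card = b <;> by_cases hp : p ∈ I <;> simp [hI, hp]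
    field_simp
  rw [Finset.sum_congr rfl fun I _ => h1 I, Finset.sum_ite_mem, Finset.univ_inter,
    Finset.sum_const, nsmul_eq_mul]
  have h2 := card_filter_mem_powersetCard hb1 p
  have h3 : (0 : ℝ) < b * n.choose b := by
    have := Nat.choose_pos hb
    positivity
  have h4 : (n : ℝ) * ((Finset.powersetCard b (Finset.univ : Finset (Fin n))).filter
      fun I => p ∈ I).card = b * n.choose b := by exact_mod_cast h2
  rw [mul_div_assoc', mul_comm, h4, div_self h3.ne']

theorem integral_batchWeight {n₁ n₂ b₁ b₂ : ℕ} (h₁ : b₁ ≤ n₁) (h₂ : b₂ ≤ n₂) (hb₁ : 1 ≤ b₁)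
    (hb₂ : 1 ≤ b₂) (j : Fin n₁ ⊕ Fin n₂) :
    ∫ S, Problem.batchWeight S j ∂((batchLaw h₁).prod (batchLaw h₂)) = 1 := by
  rcases j with p | q
  · simp only [Problem.batchWeight, Sum.elim_inl]
    rw [integral_fun_fst (μ := batchLaw h₁) (ν := batchLaw h₂)
      fun I => if p ∈ I then (n₁ : ℝ) / (I : Finset (Fin n₁)).card else 0]
    simp [integral_batchLaw_weight h₁ hb₁ p]
  · simp only [Problem.batchWeight, Sum.elim_inr]
    rw [integral_fun_snd (μ := batchLaw h₁) (ν := batchLaw h₂)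
      fun I => if q ∈ I then (n₂ : ℝ) / (I : Finset (Fin n₂)).card else 0]
    simp [integral_batchLaw_weight h₂ hb₂ q]

/-- The inverse square root of the number of sampling points of the kind of `j`. -/
def sampleScale {n₁ n₂ : ℕ} (j : Fin n₁ ⊕ Fin n₂) : ℝ :=
  Sum.elim (fun _ => 1 / √(n₁ : ℝ)) (fun _ => 1 / √(n₂ : ℝ)) j

theorem sampleScale_nonneg {n₁ n₂ : ℕ} (j : Fin n₁ ⊕ Fin n₂) : 0 ≤ sampleScale j := by
  rcases j with p | q <;> simp only [sampleScale, Sum.elim_inl, Sum.elim_inr] <;> positivity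

theorem sum_sampleScale_sq {n₁ n₂ : ℕ} : ∑ j : Fin n₁ ⊕ Fin n₂, sampleScale j ^ 2 ≤ 2 := by
  rw [Fintype.sum_sum_type]
  simp only [sampleScale, Sum.elim_inl, Sum.elim_inr, div_pow, one_pow]
  rw [Real.sq_sqrt (by positivity), Real.sq_sqrt (by positivity)]
  simp only [Finset.sum_const, Finset.card_univ, Fintype.card_fin, nsmul_eq_mul]
  have h : ∀ n : ℕ, (n : ℝ) * (1 / n) ≤ 1 := fun n => by
    rw [mul_one_div]; exact div_self_le_one _
  linarith [h n₁, h n₂]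

/-- A nonempty batch consists of `b` indices of weight `n/b` and squared scale `1/n`: the batch size
cancels. This is why it enters neither the rate nor the conditions. -/
theorem sum_batchWeight_sampleScale_sq {n₁ n₂ : ℕ} (S : Finset (Fin n₁) × Finset (Fin n₂)) :
    ∑ j, Problem.batchWeight S j * sampleScale j ^ 2 ≤ 2 := by
  have key : ∀ (n : ℕ) (I : Finset (Fin n)),
      ∑ p : Fin n, (if p ∈ I then (n : ℝ) / I.card else 0) * (1 / √(n : ℝ)) ^ 2 ≤ 1 := by
    intro n I
    simp only [ite_mul, zero_mul, Finset.sum_ite_mem, Finset.univ_inter, Finset.sum_const,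
      nsmul_eq_mul, div_pow, one_pow]
    rw [Real.sq_sqrt (by positivity)]
    calc (I.card : ℝ) * (n / I.card * (1 / n)) = (I.card / I.card) * (n / n : ℝ) := by ring
      _ ≤ 1 * 1 := by
        gcongr
        · exact div_self_le_one _
        · exact div_self_le_one _
      _ = 1 := one_mul 1
  rw [Fintype.sum_sum_type]
  have h1 := key n₁ S.1
  have h2 := key n₂ S.2
  simp only [Problem.batchWeight, sampleScale, Sum.elim_inl, Sum.elim_inr]
  linarith

end BatchLaw
end PINN
end

noncomputable section
namespace PINN

/-! ### Bounds for the features on the region of admissible weights -/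

section LocalBounds

variable {ι V : Type*} [NormedAddCommGroup V] [InnerProductSpace ℝ V] [CompleteSpace V]

theorem FeatureBounds.of_grad {W : Set V} {ψ : ι → V → ℝ} {D : ι → V → V} {q : ι → ℝ}
    (hW : Convex ℝ W) (hψ : ∀ j w, HasGradientAt (ψ j) (D j w) w) (hq : ∀ j, 0 ≤ q j)
    (hval : ∀ j, ∀ w ∈ W, |ψ j w| ≤ q j) (hgrad : ∀ j, ∀ w ∈ W, ‖D j w‖ ≤ q j)
    (hlip : ∀ j, ∀ w ∈ W, ∀ w' ∈ W, ‖D j w' - D j w‖ ≤ q j * ‖w' - w‖) :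
    FeatureBounds W ψ D q where
  nonneg := hq
  val := hval
  grad := hgrad
  gradLip := hlip
  lip j w hw w' hw' := by
    have h := hW.norm_image_sub_le_of_norm_hasFDerivWithin_le (C := q j)
      (fun x _ => (hasGradientAt_iff_hasFDerivAt.1 (hψ j x)).hasFDerivWithinAt)
      (fun x hx => by rw [LinearIsometryEquiv.norm_map]; exact hgrad j x hx) hw hw'
    simpa using h
  taylor j w hw w' hw' := by
    have hseg : segment ℝ w w' ⊆ W := hW.segment_subset hw hw'
    -- Mean value inequality for `ψ j` minus its linearization at `w`: on the segment the gradients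
    -- differ by at most `q j * ‖w' - w‖`.
    have h := (convex_segment w w').norm_image_sub_le_of_norm_hasFDerivWithin_le'
      (C := q j * ‖w' - w‖) (φ := InnerProductSpace.toDual ℝ V (D j w))
      (fun x _ => (hasGradientAt_iff_hasFDerivAt.1 (hψ j x)).hasFDerivWithinAt)
      (fun x hx => by
        rw [← map_sub, LinearIsometryEquiv.norm_map]
        refine (hlip j w hw x (hseg hx)).trans (mul_le_mul_of_nonneg_left ?_ (hq j))
        exact norm_sub_le_of_mem_segment hx)
      (left_mem_segment ℝ w w') (right_mem_segment ℝ w w')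
    rw [InnerProductSpace.toDual_apply_apply, Real.norm_eq_abs] at h
    rw [sq, ← mul_assoc]
    exact h

/-- The set of inner weights of norm at most `B` whose preactivations on the unit ball are bounded
by `B`. -/
def weightRegion (d : ℕ) (B : ℝ) : Set (EuclideanSpace ℝ (Fin (d + 1))) :=
  {w | ‖w‖ ≤ B ∧ ∀ x : EuclideanSpace ℝ (Fin d), ‖x‖ ≤ 1 → |inner ℝ w (extendedPoint x)| ≤ B}

variable {d n₁ n₂ : ℕ}

theorem convex_weightRegion (B : ℝ) : Convex ℝ (weightRegion d B) := by
  intro w hw w' hw' a b ha hb hab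
  have hB : a * B + b * B = B := by rw [← add_mul, hab, one_mul]
  constructor
  · refine (norm_add_le _ _).trans ?_
    rw [norm_smul, norm_smul, Real.norm_of_nonneg ha, Real.norm_of_nonneg hb]
    nlinarith [mul_le_mul_of_nonneg_left hw.1 ha, mul_le_mul_of_nonneg_left hw'.1 hb]
  · intro x hx
    rw [inner_add_left, inner_smul_left, inner_smul_left]
    refine (abs_add_le _ _).trans ?_
    simp only [conj_trivial]
    rw [abs_mul, abs_mul, abs_of_nonneg ha, abs_of_nonneg hb]
    nlinarith [mul_le_mul_of_nonneg_left (hw.2 x hx) ha,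
      mul_le_mul_of_nonneg_left (hw'.2 x hx) hb]

/-- This is what the summand `1` in `radius` is for: extended points have norm at most `2`, so a
displacement of `1/2` changes a preactivation by at most `1`. -/
theorem weightRegion_add {B R : ℝ} {w w' : EuclideanSpace ℝ (Fin (d + 1))}
    (hw : w ∈ weightRegion d (B - 1)) (hR : R ≤ 1 / 2) (h : ‖w' - w‖ ≤ R) :
    w' ∈ weightRegion d B := by
  have h2 : √2 ≤ 2 := by rw [Real.sqrt_le_left (by norm_num)]; norm_num
  constructor
  · have := norm_add_le (w' - w) w
    rw [sub_add_cancel] at this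
    linarith [hw.1]
  · intro x hx
    have e1 : inner ℝ w' (extendedPoint x) =
        inner ℝ (w' - w) (extendedPoint x) + inner ℝ w (extendedPoint x) := by
      rw [inner_sub_left]; ring
    have e2 := abs_real_inner_le_norm (w' - w) (extendedPoint x)
    have e3 : ‖w' - w‖ * ‖extendedPoint x‖ ≤ 1 / 2 * 2 :=
      mul_le_mul (h.trans hR) ((norm_extendedPoint_le hx).trans h2) (norm_nonneg _) (by norm_num)
    rw [e1]
    refine (abs_add_le _ _).trans ?_
    linarith [hw.2 x hx]

theorem ActivationBound.abs_le {σ CM : ℝ → ℝ} {C ℓ B : ℝ} (h : ActivationBound σ CM C ℓ)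
    (hB : 1 ≤ B) {k : ℕ} (hk : k ≤ 3) {z : ℝ} (hz : |z| ≤ B) :
    |iteratedDeriv k σ z| ≤ 2 * CM B * B := by
  have hB0 : 0 < B := by linarith
  have h1 := h.lipschitz B hB0 k hk z 0 hz (by simpa using hB0.le)
  have h2 := h.at_zero B hB0 k hk
  have h3 := h.one_le B hB0
  rw [sub_zero] at h1
  have h4 := abs_add_le (iteratedDeriv k σ z - iteratedDeriv k σ 0) (iteratedDeriv k σ 0)
  rw [sub_add_cancel] at h4
  nlinarith [mul_le_mul_of_nonneg_left hz (by linarith : 0 ≤ CM B)]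

/-- The common bound for the features and their gradients on `weightRegion d B`. -/
def featureScale (γ CB B : ℝ) : ℝ := 16 * (1 + γ) * CB * B ^ 3

theorem abs_norm_sq_sub_le {E : Type*} [NormedAddCommGroup E] {u v : E} {B : ℝ} (hu : ‖u‖ ≤ B)
    (hv : ‖v‖ ≤ B) : |‖u‖ ^ 2 - ‖v‖ ^ 2| ≤ 2 * B * ‖u - v‖ := by
  have h1 : ‖u‖ ^ 2 - ‖v‖ ^ 2 = (‖u‖ + ‖v‖) * (‖u‖ - ‖v‖) := by ring
  rw [h1, abs_mul, abs_of_nonneg (by positivity)]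
  exact mul_le_mul (by linarith) (abs_norm_sub_norm_le u v) (abs_nonneg _)
    (by linarith [norm_nonneg u])

theorem sqrt_le_one_add {γ : ℝ} (hγ : 0 ≤ γ) : √γ ≤ 1 + γ := by
  rw [Real.sqrt_le_left (by linarith)]; nlinarith

/-- On the region the derivatives of `σ` up to order three are at most `2 C_B B` and Lipschitz with
constant `C_B`. The factor `‖w‖² ≤ B²` of an interior feature raises this to order `C_B B³`; `√γ ≤ 1
+ γ` covers the boundary weight. -/
theorem Problem.featureBounds {P : Problem d n₁ n₂} {CM : ℝ → ℝ} {C ℓ B : ℝ}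
    (hσ : ActivationBound P.σ CM C ℓ) (hγ : 0 ≤ P.γ) (hB : 1 ≤ B)
    (hx : ∀ p, ‖P.x p‖ ≤ 1) (hy : ∀ q, ‖P.y q‖ ≤ 1) :
    FeatureBounds (weightRegion d B) P.feature P.featureGrad
      (fun j => featureScale P.γ (CM B) B * sampleScale j) := by
  have hB0 : 0 < B := by linarith
  have hC := hσ.one_le B hB0
  have hs2 : √2 ≤ 3 / 2 := by rw [Real.sqrt_le_left (by norm_num)]; norm_num
  have hs20 : 0 ≤ √2 := Real.sqrt_nonneg 2
  have hs22 : √2 * √2 = 2 := Real.mul_self_sqrt (by norm_num)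
  set K := CM B with hK
  have hK0 : 0 ≤ K := by linarith
  have hBB : B ≤ B ^ 3 := by nlinarith [mul_nonneg hB0.le (sq_nonneg (B - 1))]
  have hB2 : B ^ 2 ≤ B ^ 3 := by nlinarith [sq_nonneg B]
  have hB3 : 1 ≤ B ^ 3 := one_le_pow₀ hB
  have hsg := sqrt_le_one_add hγ
  have hscale : ∀ c, 0 ≤ c → c ≤ 16 → c * (K * B ^ 3) ≤ featureScale P.γ K B := by
    intro c h0 hc
    unfold featureScale
    have : 0 ≤ K * B ^ 3 := by positivity
    nlinarith [mul_le_mul_of_nonneg_right hc this, mul_nonneg hγ this]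
  have hscale' : ∀ c, 0 ≤ c → c ≤ 16 → √P.γ * (c * (K * B ^ 3)) ≤ featureScale P.γ K B := by
    intro c h0 hc
    unfold featureScale
    have : 0 ≤ K * B ^ 3 := by positivity
    calc √P.γ * (c * (K * B ^ 3)) ≤ (1 + P.γ) * (16 * (K * B ^ 3)) := by gcongr
      _ = _ := by ring
  have hsplit : √(P.γ / (n₂ : ℝ)) = 1 / √(n₂ : ℝ) * √P.γ := by
    rw [Real.sqrt_div hγ]; ring
  have hz : ∀ x : EuclideanSpace ℝ (Fin d), ‖x‖ ≤ 1 → ∀ w w' : EuclideanSpace ℝ (Fin (d + 1)),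
      |inner ℝ w' (extendedPoint x) - inner ℝ w (extendedPoint x)| ≤ √2 * ‖w' - w‖ := by
    intro x hx w w'
    rw [← inner_sub_left]
    refine (abs_real_inner_le_norm _ _).trans ?_
    rw [mul_comm]
    exact mul_le_mul_of_nonneg_right (norm_extendedPoint_le hx) (norm_nonneg _)
  have hlipσ : ∀ x : EuclideanSpace ℝ (Fin d), ‖x‖ ≤ 1 → ∀ k ≤ 3, ∀ w ∈ weightRegion d B,
      ∀ w' ∈ weightRegion d B,
      |iteratedDeriv k P.σ (inner ℝ w' (extendedPoint x)) -
        iteratedDeriv k P.σ (inner ℝ w (extendedPoint x))| ≤ K * (√2 * ‖w' - w‖) := by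
    intro x hx k hk w hw w' hw'
    refine (hσ.lipschitz B hB0 k hk _ _ (hw'.2 x hx) (hw.2 x hx)).trans ?_
    exact mul_le_mul_of_nonneg_left (hz x hx w w') hK0
  refine FeatureBounds.of_grad (convex_weightRegion B) (hasGradientAt_feature hσ.contDiff)
    (fun j => mul_nonneg (le_trans (by positivity) (hscale 0 le_rfl (by norm_num)))
      (sampleScale_nonneg j)) ?_ ?_ ?_
  · rintro (p | q) w hw
    · simp only [feature, sampleScale, Sum.elim_inl]
      rw [abs_mul, abs_of_nonneg (by positivity), mul_comm (featureScale _ _ _)]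
      refine mul_le_mul_of_nonneg_left ?_ (by positivity)
      rw [abs_mul, abs_of_nonneg (by positivity)]
      have e1 := hσ.abs_le hB (k := 2) (by norm_num) (hw.2 _ (hx p))
      have e2 : ‖spatial d w‖ ^ 2 ≤ B ^ 2 :=
        pow_le_pow_left₀ (norm_nonneg _) ((norm_spatial_le w).trans hw.1) 2
      calc _ ≤ B ^ 2 * (2 * K * B) := by gcongr
        _ = 2 * (K * B ^ 3) := by ring
        _ ≤ _ := hscale 2 (by norm_num) (by norm_num)
    · simp only [feature, sampleScale, Sum.elim_inr]
      rw [hsplit, mul_assoc, abs_mul, abs_of_nonneg (by positivity), mul_comm (featureScale _ _ _)]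
      refine mul_le_mul_of_nonneg_left ?_ (by positivity)
      rw [abs_mul, abs_of_nonneg (by positivity)]
      have e1 := hσ.abs_le hB (k := 0) (by norm_num) (hw.2 _ (hy q))
      rw [iteratedDeriv_zero] at e1
      refine le_trans ?_ (hscale' 2 (by norm_num) (by norm_num))
      refine mul_le_mul_of_nonneg_left (e1.trans ?_) (Real.sqrt_nonneg _)
      nlinarith [mul_le_mul_of_nonneg_left hBB hK0]
  · rintro (p | q) w hw
    · simp only [featureGrad, sampleScale, Sum.elim_inl]
      rw [norm_smul, Real.norm_of_nonneg (by positivity), mul_comm (featureScale _ _ _)]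
      refine mul_le_mul_of_nonneg_left ?_ (by positivity)
      refine (norm_add_le _ _).trans ?_
      rw [norm_smul, norm_smul, Real.norm_eq_abs, Real.norm_eq_abs, abs_mul, abs_mul, abs_two,
        abs_of_nonneg (sq_nonneg ‖spatial d w‖)]
      have e1 := hσ.abs_le hB (k := 2) (by norm_num) (hw.2 _ (hx p))
      have e1' := hσ.abs_le hB (k := 3) (by norm_num) (hw.2 _ (hx p))
      have e0 : ‖spatial d w‖ ≤ B := (norm_spatial_le w).trans hw.1
      have e3 := (norm_adjoint_spatial_le (spatial d w)).trans e0
      have e4 := norm_extendedPoint_le (hx p)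
      calc _ ≤ 2 * (2 * K * B) * B + B ^ 2 * (2 * K * B) * (3 / 2) := by
            gcongr; exact e4.trans hs2
        _ ≤ 7 * (K * B ^ 3) := by nlinarith [mul_le_mul_of_nonneg_left hB2 hK0]
        _ ≤ _ := hscale 7 (by norm_num) (by norm_num)
    · simp only [featureGrad, sampleScale, Sum.elim_inr]
      rw [norm_smul, hsplit, mul_assoc, norm_mul, Real.norm_of_nonneg (by positivity),
        mul_comm (featureScale _ _ _), mul_assoc]
      refine mul_le_mul_of_nonneg_left ?_ (by positivity)
      rw [norm_mul, Real.norm_of_nonneg (Real.sqrt_nonneg _), Real.norm_eq_abs, mul_assoc]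
      have e1 := hσ.abs_le hB (k := 1) (by norm_num) (hw.2 _ (hy q))
      have e4 := (norm_extendedPoint_le (hy q)).trans hs2
      refine le_trans ?_ (hscale' 3 (by norm_num) (by norm_num))
      refine mul_le_mul_of_nonneg_left ?_ (Real.sqrt_nonneg _)
      calc _ ≤ 2 * K * B * (3 / 2) := by gcongr
        _ ≤ _ := by nlinarith [mul_le_mul_of_nonneg_left hBB hK0]
  · rintro (p | q) w hw w' hw'
    · simp only [featureGrad, sampleScale, Sum.elim_inl]
      rw [← smul_sub, norm_smul, Real.norm_of_nonneg (by positivity), mul_comm (featureScale _ _ _),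
        mul_assoc]
      refine mul_le_mul_of_nonneg_left ?_ (by positivity)
      have e1 := hσ.abs_le hB (k := 2) (by norm_num) (hw'.2 _ (hx p))
      have e1' := hσ.abs_le hB (k := 3) (by norm_num) (hw.2 _ (hx p))
      have l1 := hlipσ _ (hx p) 2 (by norm_num) w hw w' hw'
      have l2 := hlipσ _ (hx p) 3 (by norm_num) w hw w' hw'
      have e0 : ‖spatial d w‖ ≤ B := (norm_spatial_le w).trans hw.1
      have e0' : ‖spatial d w'‖ ≤ B := (norm_spatial_le w').trans hw'.1
      have e3 := (norm_adjoint_spatial_le (spatial d w)).trans e0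
      have e4 := (norm_extendedPoint_le (hx p)).trans hs2
      have e5 : ‖spatial d w' - spatial d w‖ ≤ ‖w' - w‖ := by
        rw [← map_sub]; exact norm_spatial_le _
      have e6 := abs_norm_sq_sub_le e0' e0
      have e7 : ‖spatial d w'‖ ^ 2 ≤ B ^ 2 := pow_le_pow_left₀ (norm_nonneg _) e0' 2
      set z := iteratedDeriv 2 P.σ (inner ℝ w (extendedPoint (P.x p)))
      set z' := iteratedDeriv 2 P.σ (inner ℝ w' (extendedPoint (P.x p)))
      set y := iteratedDeriv 3 P.σ (inner ℝ w (extendedPoint (P.x p)))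
      set y' := iteratedDeriv 3 P.σ (inner ℝ w' (extendedPoint (P.x p)))
      set A := ContinuousLinearMap.adjoint (spatial d)
      set X := extendedPoint (P.x p)
      set s := spatial d w
      set s' := spatial d w'
      set δ := ‖w' - w‖
      have hδ : 0 ≤ δ := norm_nonneg _
      -- Changing one factor at a time. The four terms `n1` to `n4` add up to at most `(7B + 33/4
      -- B²) K δ`, and this is where the constant `16` of `featureScale` is needed.
      have e8 : (2 * z') • A s' + (‖s'‖ ^ 2 * y') • X - ((2 * z) • A s + (‖s‖ ^ 2 * y) • X) =
          (2 * (z' - z)) • A s + (2 * z') • A (s' - s) + ((‖s'‖ ^ 2 - ‖s‖ ^ 2) * y) • X +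
            (‖s'‖ ^ 2 * (y' - y)) • X := by
        rw [map_sub]; module
      rw [e8]
      have n1 : ‖(2 * (z' - z)) • A s‖ ≤ 2 * (K * (3 / 2 * δ)) * B := by
        rw [norm_smul, Real.norm_eq_abs, abs_mul, abs_two]
        gcongr
        exact l1.trans (by gcongr)
      have n2 : ‖(2 * z') • A (s' - s)‖ ≤ 2 * (2 * K * B) * δ := by
        rw [norm_smul, Real.norm_eq_abs, abs_mul, abs_two]
        gcongr
        exact (norm_adjoint_spatial_le _).trans e5
      have n3 : ‖((‖s'‖ ^ 2 - ‖s‖ ^ 2) * y) • X‖ ≤ 2 * B * δ * (2 * K * B) * (3 / 2) := by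
        rw [norm_smul, Real.norm_eq_abs, abs_mul]
        gcongr
        exact e6.trans (by gcongr)
      have n4 : ‖(‖s'‖ ^ 2 * (y' - y)) • X‖ ≤ B ^ 2 * (K * (3 / 2 * δ)) * (3 / 2) := by
        rw [norm_smul, Real.norm_eq_abs, abs_mul, abs_of_nonneg (sq_nonneg ‖s'‖)]
        gcongr
        exact l2.trans (by gcongr)
      have hn := norm_add₄_le (a := (2 * (z' - z)) • A s) (b := (2 * z') • A (s' - s))
        (c := ((‖s'‖ ^ 2 - ‖s‖ ^ 2) * y) • X) (d := (‖s'‖ ^ 2 * (y' - y)) • X)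
      refine hn.trans ?_
      have hKδ : 0 ≤ K * δ := mul_nonneg hK0 hδ
      calc _ ≤ 2 * (K * (3 / 2 * δ)) * B + 2 * (2 * K * B) * δ +
            2 * B * δ * (2 * K * B) * (3 / 2) + B ^ 2 * (K * (3 / 2 * δ)) * (3 / 2) := by
            linarith
        _ ≤ 16 * (K * B ^ 3) * δ := by
            nlinarith [mul_le_mul_of_nonneg_left hBB hKδ, mul_le_mul_of_nonneg_left hB2 hKδ]
        _ ≤ _ := mul_le_mul_of_nonneg_right (hscale 16 (by norm_num) le_rfl) hδ
    · simp only [featureGrad, sampleScale, Sum.elim_inr]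
      rw [← sub_smul, ← mul_sub, norm_smul, hsplit, mul_assoc, norm_mul,
        Real.norm_of_nonneg (by positivity), mul_comm (featureScale _ _ _), mul_assoc, mul_assoc]
      refine mul_le_mul_of_nonneg_left ?_ (by positivity)
      rw [norm_mul, Real.norm_of_nonneg (Real.sqrt_nonneg _), Real.norm_eq_abs, mul_assoc]
      have l1 := hlipσ _ (hy q) 1 (by norm_num) w hw w' hw'
      have e4 := norm_extendedPoint_le (hy q)
      have hδ : 0 ≤ ‖w' - w‖ := norm_nonneg _
      refine le_trans ?_ (mul_le_mul_of_nonneg_right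
        (hscale' 2 (by norm_num) (by norm_num)) hδ)
      rw [mul_assoc]
      refine mul_le_mul_of_nonneg_left ?_ (Real.sqrt_nonneg _)
      calc _ ≤ K * (√2 * ‖w' - w‖) * √2 := by gcongr
        _ = 2 * K * ‖w' - w‖ := by linear_combination K * ‖w' - w‖ * hs22
        _ ≤ _ := by nlinarith [mul_nonneg (mul_nonneg hK0 hδ) (sub_nonneg.2 hB3)]

end LocalBounds
end PINN
end

noncomputable section
namespace PINN

/-! ### Tails of linear forms and of the norm of a Gaussian vector -/

section GaussianVector

variable {E : Type*} [NormedAddCommGroup E] [InnerProductSpace ℝ E] [FiniteDimensional ℝ E]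
  [MeasurableSpace E] [BorelSpace E]

theorem stdGaussian_map_inner (v : E) :
    (stdGaussian E).map (fun w => inner ℝ w v) = gaussianReal 0 (‖v‖ ^ 2).toNNReal := by
  have h := IsGaussian.map_eq_gaussianReal (μ := stdGaussian E) (innerSL ℝ v)
  rw [integral_strongDual_stdGaussian, variance_dual_stdGaussian, innerSL_apply_norm] at h
  rw [← h]
  congr 1
  funext w
  exact real_inner_comm _ _

theorem integrable_exp_inner_stdGaussian (v : E) (t : ℝ) :
    Integrable (fun w => Real.exp (t * inner ℝ w v)) (stdGaussian E) := by
  have h := integrable_exp_mul_gaussianReal (μ := 0) (v := (‖v‖ ^ 2).toNNReal) t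
  rw [← stdGaussian_map_inner v] at h
  exact h.comp_measurable (by fun_prop)

theorem integral_exp_inner_stdGaussian (v : E) (t : ℝ) :
    ∫ w, Real.exp (t * inner ℝ w v) ∂(stdGaussian E) = Real.exp (t ^ 2 * ‖v‖ ^ 2 / 2) := by
  have h := mgf_gaussianReal (stdGaussian_map_inner v) t
  rw [mgf] at h
  rw [h, Real.coe_toNNReal _ (sq_nonneg _)]
  congr 1; ring

theorem exp_mul_abs_le (t x : ℝ) :
    Real.exp (t * |x|) ≤ Real.exp (t * x) + Real.exp (-t * x) := by
  rcases abs_cases x with ⟨h, _⟩ | ⟨h, _⟩ <;> rw [h]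
  · linarith [Real.exp_pos (-t * x)]
  · rw [mul_neg, ← neg_mul]; linarith [Real.exp_pos (t * x)]

theorem integrable_exp_abs_inner_stdGaussian (v : E) (t : ℝ) :
    Integrable (fun w => Real.exp (t * |inner ℝ w v|)) (stdGaussian E) := by
  refine ((integrable_exp_inner_stdGaussian v t).add
    (integrable_exp_inner_stdGaussian v (-t))).mono'
    (Continuous.aestronglyMeasurable (by fun_prop)) (ae_of_all _ fun w => ?_)
  rw [Real.norm_of_nonneg (Real.exp_pos _).le]
  exact exp_mul_abs_le t _

theorem integral_exp_abs_inner_stdGaussian_le (v : E) (t : ℝ) :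
    ∫ w, Real.exp (t * |inner ℝ w v|) ∂(stdGaussian E) ≤ 2 * Real.exp (t ^ 2 * ‖v‖ ^ 2 / 2) := by
  calc _ ≤ ∫ w, (Real.exp (t * inner ℝ w v) + Real.exp (-t * inner ℝ w v)) ∂(stdGaussian E) :=
        integral_mono (integrable_exp_abs_inner_stdGaussian v t)
          ((integrable_exp_inner_stdGaussian v t).add (integrable_exp_inner_stdGaussian v (-t)))
          fun w => exp_mul_abs_le t _
    _ = _ := by
        rw [integral_add (integrable_exp_inner_stdGaussian v t)
          (integrable_exp_inner_stdGaussian v (-t)), integral_exp_inner_stdGaussian,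
          integral_exp_inner_stdGaussian, neg_sq, two_mul]

/-- Chernoff's bound: the linear form has variance `2`, so the optimal exponent is `u / 2`. -/
theorem measureReal_abs_inner_stdGaussian_le (v : E) {u : ℝ} (hu : 0 ≤ u) (hv : ‖v‖ ^ 2 = 2) :
    (stdGaussian E).real {w | u ≤ |inner ℝ w v|} ≤ 2 * Real.exp (-(u ^ 2 / 4)) := by
  have h1 := mul_meas_ge_le_integral_of_nonneg (μ := stdGaussian E)
    (ae_of_all _ fun w => (Real.exp_pos (u / 2 * |inner ℝ w v|)).le)
    (integrable_exp_abs_inner_stdGaussian v (u / 2)) (Real.exp (u / 2 * u))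
  have h2 : {w : E | u ≤ |inner ℝ w v|} ⊆
      {w | Real.exp (u / 2 * u) ≤ Real.exp (u / 2 * |inner ℝ w v|)} := by
    intro w hw
    have hw' : u ≤ |inner ℝ w v| := hw
    show Real.exp _ ≤ Real.exp _
    gcongr
  have h3 := h1.trans (integral_exp_abs_inner_stdGaussian_le v (u / 2))
  have h4 := measureReal_mono (μ := stdGaussian E) h2
  rw [hv] at h3
  calc _ ≤ _ := h4
    _ = Real.exp (-(u / 2 * u)) * (Real.exp (u / 2 * u) * (stdGaussian E).real
        {w | Real.exp (u / 2 * u) ≤ Real.exp (u / 2 * |inner ℝ w v|)}) := by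
      rw [← mul_assoc, ← Real.exp_add]; simp
    _ ≤ Real.exp (-(u / 2 * u)) * (2 * Real.exp ((u / 2) ^ 2 * 2 / 2)) := by gcongr
    _ = _ := by
      rw [mul_left_comm, ← Real.exp_add]; congr 2; ring

end GaussianVector

section GaussianNorm

variable {k : ℕ}

theorem integral_exp_mul_sq_gaussianReal {s : ℝ} (hs : s < 1 / 2) :
    ∫ x, Real.exp (s * x ^ 2) ∂(gaussianReal 0 1) = √(1 / (1 - 2 * s)) := by
  rw [integral_gaussianReal_eq_integral_smul (by norm_num)]
  have h1 : ∀ x : ℝ, gaussianPDFReal 0 1 x • Real.exp (s * x ^ 2) =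
      (√(2 * Real.pi))⁻¹ * Real.exp (-(1 / 2 - s) * x ^ 2) := by
    intro x
    rw [gaussianPDFReal, smul_eq_mul, mul_assoc, ← Real.exp_add]
    congr 2
    · simp
    · simp; ring
  simp_rw [h1]
  rw [integral_const_mul, integral_gaussian, ← Real.sqrt_inv, ← Real.sqrt_mul (by positivity)]
  congr 1
  have : 1 / 2 - s ≠ 0 := by linarith
  have h2 : 1 - 2 * s ≠ 0 := by linarith
  have := Real.pi_pos.ne'
  field_simp

/-- The integral was computed without integrability and is positive, whereas the integral of a
non-integrable function is `0` by convention. -/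
theorem integrable_exp_mul_sq_gaussianReal {s : ℝ} (hs : s < 1 / 2) :
    Integrable (fun x => Real.exp (s * x ^ 2)) (gaussianReal 0 1) := by
  by_contra h
  have h1 := integral_exp_mul_sq_gaussianReal hs
  rw [integral_undef h] at h1
  have : 0 < √(1 / (1 - 2 * s)) := Real.sqrt_pos.2 (by apply one_div_pos.2; linarith)
  linarith

theorem exp_mul_norm_sq_toLp (s : ℝ) (x : Fin k → ℝ) :
    Real.exp (s * ‖(WithLp.toLp 2 x : EuclideanSpace ℝ (Fin k))‖ ^ 2) =
      ∏ i, Real.exp (s * x i ^ 2) := by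
  rw [← Real.exp_sum, EuclideanSpace.real_norm_sq_eq, Finset.mul_sum]

theorem integrable_exp_norm_sq_stdGaussian {s : ℝ} (hs : s < 1 / 2) :
    Integrable (fun w => Real.exp (s * ‖w‖ ^ 2)) (stdGaussian (EuclideanSpace ℝ (Fin k))) := by
  rw [← map_pi_eq_stdGaussian, integrable_map_measure (Continuous.aestronglyMeasurable (by fun_prop))
    (by fun_prop)]
  have h : (fun w : EuclideanSpace ℝ (Fin k) => Real.exp (s * ‖w‖ ^ 2)) ∘ WithLp.toLp 2 =
      fun x : Fin k → ℝ => ∏ i, Real.exp (s * x i ^ 2) := funext fun x => exp_mul_norm_sq_toLp s x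
  rw [h]
  exact Integrable.fintype_prod fun i => integrable_exp_mul_sq_gaussianReal hs

theorem integral_exp_norm_sq_stdGaussian {s : ℝ} (hs : s < 1 / 2) :
    ∫ w, Real.exp (s * ‖w‖ ^ 2) ∂(stdGaussian (EuclideanSpace ℝ (Fin k))) =
      √(1 / (1 - 2 * s)) ^ k := by
  rw [← map_pi_eq_stdGaussian, integral_map (by fun_prop)
    (Continuous.aestronglyMeasurable (by fun_prop))]
  simp_rw [exp_mul_norm_sq_toLp]
  rw [integral_fintype_prod_eq_pow (fun x : ℝ => Real.exp (s * x ^ 2)),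
    integral_exp_mul_sq_gaussianReal hs, Fintype.card_fin]

/-- The left side tends to `e`, so the linear bound is crude; it is chosen to give the factor `2(d +
1)` that the logarithm in `radius` absorbs. After squaring, `k = 3, 4` are direct, and for `k = n +
2 ≥ 5` one has `(1 + 2/n)^n ≤ e²`. -/
theorem sqrt_pow_le_two_mul (hk : 3 ≤ k) : √(1 / (1 - 2 * (1 / (k : ℝ)))) ^ k ≤ 2 * k := by
  have hk' : (3 : ℝ) ≤ k := by exact_mod_cast hk
  refine abs_le_of_sq_le_sq' ?_ (by positivity) |>.2
  have h0 : (0 : ℝ) < k - 2 := by linarith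
  have h1 : 1 / (1 - 2 * (1 / (k : ℝ))) = k / (k - 2) := by field_simp
  rw [← pow_mul, mul_comm k 2, pow_mul, h1, Real.sq_sqrt (by positivity)]
  have h2 : (k : ℝ) / (k - 2) = 1 + 2 / (k - 2) := by field_simp; ring
  rcases (by omega : k = 3 ∨ k = 4 ∨ 5 ≤ k) with rfl | rfl | h5
  · norm_num
  · norm_num
  · have h5' : (5 : ℝ) ≤ k := by exact_mod_cast h5
    obtain ⟨n, rfl⟩ : ∃ n, k = n + 2 := ⟨k - 2, by omega⟩
    rw [pow_add]
    have e1 : ((n + 2 : ℕ) : ℝ) - 2 = n := by push_cast; ring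
    rw [e1] at h0 h2 ⊢
    rw [h2]
    have hn : (3 : ℝ) ≤ n := by push_cast at h5'; linarith
    have e2 : (1 + 2 / (n : ℝ)) ^ n ≤ Real.exp 2 := by
      calc (1 + 2 / (n : ℝ)) ^ n ≤ Real.exp (2 / n) ^ n := by
            gcongr
            rw [add_comm]; exact Real.add_one_le_exp _
        _ = Real.exp 2 := by rw [← Real.exp_nat_mul]; congr 1; field_simp
    have e3 : Real.exp 2 ≤ 9 := by
      have : Real.exp 2 = Real.exp 1 ^ 2 := by rw [← Real.exp_nat_mul]; norm_num
      rw [this]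
      nlinarith [Real.exp_one_lt_d9, Real.exp_pos 1]
    have e4 : (1 + 2 / (n : ℝ)) ^ 2 ≤ 3 := by
      have : 2 / (n : ℝ) ≤ 2 / 3 := by gcongr
      have h0' : 0 ≤ 2 / (n : ℝ) := by positivity
      nlinarith
    calc _ ≤ (9 : ℝ) * 3 := by
          gcongr
          exact e2.trans e3
      _ ≤ _ := by push_cast; nlinarith

theorem measureReal_norm_stdGaussian_le (hk : 3 ≤ k) (L : ℝ) :
    (stdGaussian (EuclideanSpace ℝ (Fin k))).real {w | k * L ≤ ‖w‖ ^ 2} ≤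
      2 * k * Real.exp (-L) := by
  have hk' : (3 : ℝ) ≤ k := by exact_mod_cast hk
  have hk0 : (0 : ℝ) < k := by linarith
  have hs : 1 / (k : ℝ) < 1 / 2 := by
    rw [div_lt_div_iff₀ hk0 (by norm_num)]; linarith
  have h1 := mul_meas_ge_le_integral_of_nonneg (μ := stdGaussian (EuclideanSpace ℝ (Fin k)))
    (ae_of_all _ fun w => (Real.exp_pos (1 / (k : ℝ) * ‖w‖ ^ 2)).le)
    (integrable_exp_norm_sq_stdGaussian hs) (Real.exp L)
  rw [integral_exp_norm_sq_stdGaussian hs] at h1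
  have h2 : {w : EuclideanSpace ℝ (Fin k) | k * L ≤ ‖w‖ ^ 2} ⊆
      {w | Real.exp L ≤ Real.exp (1 / (k : ℝ) * ‖w‖ ^ 2)} := by
    intro w hw
    have hw' : k * L ≤ ‖w‖ ^ 2 := hw
    show Real.exp _ ≤ Real.exp _
    gcongr
    rw [one_div, ← div_eq_inv_mul, le_div_iff₀ hk0]; linarith
  have h4 := measureReal_mono (μ := stdGaussian (EuclideanSpace ℝ (Fin k))) h2
  calc _ ≤ _ := h4
    _ = Real.exp (-L) * (Real.exp L * (stdGaussian (EuclideanSpace ℝ (Fin k))).real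
        {w | Real.exp L ≤ Real.exp (1 / (k : ℝ) * ‖w‖ ^ 2)}) := by
      rw [← mul_assoc, ← Real.exp_add]; simp
    _ ≤ Real.exp (-L) * (2 * k) :=
      mul_le_mul_of_nonneg_left (h1.trans (sqrt_pow_le_two_mul hk)) (Real.exp_pos _).le
    _ = _ := by ring

/-- A standard Gaussian weight lies in the region of radius `√(2 (d + 1) L)` with probability at
least `1 - 2 (d + 1) exp (-L)`. -/
theorem measureReal_compl_weightRegion_le {d : ℕ} (hd : 1 ≤ d) {L : ℝ} (hL : 0 ≤ L) :
    (stdGaussian (EuclideanSpace ℝ (Fin (d + 1)))).real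
      (weightRegion d √(2 * ((d : ℝ) + 1) * L))ᶜ ≤ 2 * ((d : ℝ) + 1) * Real.exp (-L) := by
  have hu0 : 0 ≤ 2 * ((d : ℝ) + 1) * L := by positivity
  set u := √(2 * ((d : ℝ) + 1) * L) with hu
  have hu2 : u ^ 2 = 2 * ((d : ℝ) + 1) * L := Real.sq_sqrt hu0
  have hun : 0 ≤ u := Real.sqrt_nonneg _
  -- The Chernoff parameter `1/(d + 1)` has to be below `1/2`, which excludes `d = 1`. In that case
  -- `x ↦ w₀ x + w₁` on `[-1, 1]` is extremal at the ends, so `|w₀ ± w₁| < u` suffices; it also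
  -- gives `‖w‖ ≤ u`, as the squares add up to `2‖w‖²`. The two tails are `2 exp(-L)` each.
  rcases (by omega : d = 1 ∨ 3 ≤ d + 1) with rfl | hd3
  · set v₁ : EuclideanSpace ℝ (Fin 2) := !₂[1, 1] with hv₁
    set v₂ : EuclideanSpace ℝ (Fin 2) := !₂[1, -1] with hv₂
    have n₁ : ‖v₁‖ ^ 2 = 2 := by
      rw [EuclideanSpace.real_norm_sq_eq]; simp [hv₁, Fin.sum_univ_two]; norm_num
    have n₂ : ‖v₂‖ ^ 2 = 2 := by
      rw [EuclideanSpace.real_norm_sq_eq]; simp [hv₂, Fin.sum_univ_two]; norm_num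
    have hsub : (weightRegion 1 u)ᶜ ⊆ {w | u ≤ |inner ℝ w v₁|} ∪ {w | u ≤ |inner ℝ w v₂|} := by
      intro w hw
      by_contra hn
      simp only [Set.mem_union, Set.mem_ofPred_eq, not_or, not_le] at hn
      have i₁ : inner ℝ w v₁ = w 0 + w 1 := by
        simp [PiLp.inner_apply, hv₁, Fin.sum_univ_two]
      have i₂ : inner ℝ w v₂ = w 0 - w 1 := by
        simp [PiLp.inner_apply, hv₂, Fin.sum_univ_two]; ring
      rw [i₁, i₂, abs_lt, abs_lt] at hn
      obtain ⟨⟨h1, h2⟩, h3, h4⟩ := hn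
      refine hw ⟨?_, fun x hx => ?_⟩
      · refine abs_le_of_sq_le_sq' ?_ hun |>.2
        rw [EuclideanSpace.real_norm_sq_eq, Fin.sum_univ_two]
        nlinarith
      · have hx1 : |x 0| ≤ 1 := by
          refine le_trans ?_ hx
          rw [EuclideanSpace.norm_eq, Fin.sum_univ_one]
          simp [Real.sqrt_sq_eq_abs]
        rw [inner_extendedPoint]
        have e1 : inner ℝ (spatial 1 w) x = w 0 * x 0 := by
          simp [PiLp.inner_apply, spatial_apply]; ring
        have e2 : w (Fin.last 1) = w 1 := rfl
        rw [e1, e2, abs_le]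
        rw [abs_le] at hx1
        constructor <;> nlinarith
    refine (measureReal_mono hsub).trans ((measureReal_union_le _ _).trans ?_)
    have e1 := measureReal_abs_inner_stdGaussian_le v₁ hun n₁
    have e2 := measureReal_abs_inner_stdGaussian_le v₂ hun n₂
    have e3 : u ^ 2 / 4 = L := by rw [hu2]; push_cast; ring
    rw [e3] at e1 e2
    push_cast
    linarith
  · have hsub : (weightRegion d u)ᶜ ⊆
        {w | ((d + 1 : ℕ) : ℝ) * L ≤ ‖w‖ ^ 2} := by
      intro w hw
      by_contra hn
      have hn' : ‖w‖ ^ 2 < ((d + 1 : ℕ) : ℝ) * L := not_le.1 hn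
      push_cast at hn'
      -- The factor `2` in `u² = 2(d + 1)L` pays for the norm `√2` of the extended points.
      have h1 : √2 * ‖w‖ ≤ u := by
        refine abs_le_of_sq_le_sq' ?_ hun |>.2
        rw [mul_pow, Real.sq_sqrt (by norm_num), hu2]
        linarith
      have h2 : 1 ≤ √2 := by rw [Real.one_le_sqrt]; norm_num
      refine hw ⟨?_, fun x hx => ?_⟩
      · nlinarith [norm_nonneg w]
      · refine (abs_real_inner_le_norm _ _).trans (le_trans ?_ h1)
        rw [mul_comm]
        exact mul_le_mul_of_nonneg_right (norm_extendedPoint_le hx) (norm_nonneg _)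
    refine (measureReal_mono hsub).trans ?_
    have := measureReal_norm_stdGaussian_le hd3 L
    push_cast at this ⊢
    exact this

end GaussianNorm
end PINN
end

noncomputable section
namespace PINN

/-! ### Gaussian moments of the dominating function, with explicit dependence on the dimension -/

section Moments

variable {d : ℕ}

/-- A dominating function for products of features and of their gradients. -/
def growth (v₁ v₂ w : EuclideanSpace ℝ (Fin (d + 1))) : ℝ :=
  (1 + ‖w‖) ^ 4 * Real.exp (|inner ℝ w v₁| + |inner ℝ w v₂|)

/-- A bound for the second moment of `growth` in terms of `d ^ 4`. -/
def momentConst : ℝ := 2 ^ 23 * (1 + 4 * (Nat.factorial 16 : ℝ)) + 4 * Real.exp 64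

theorem one_le_momentConst : 1 ≤ momentConst := by
  unfold momentConst
  have h1 : (0 : ℝ) ≤ (Nat.factorial 16 : ℝ) := by positivity
  have h2 := Real.exp_pos 64
  linarith

theorem growth_pos (v₁ v₂ w : EuclideanSpace ℝ (Fin (d + 1))) : 0 < growth v₁ v₂ w := by
  unfold growth; positivity

theorem continuous_growth (v₁ v₂ : EuclideanSpace ℝ (Fin (d + 1))) : Continuous (growth v₁ v₂) := by
  unfold growth; fun_prop

/-- The power mean inequality for the eighth power of `∑ wᵢ²` gives `k⁷ ∑ wᵢ¹⁶`; the series of the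
exponential reduces the moments to exponential ones. In expectation the result is of the sharp order
`k⁸`. -/
theorem norm_pow_le_sum_exp {k : ℕ} (w : EuclideanSpace ℝ (Fin k)) :
    ‖w‖ ^ 16 ≤ (k : ℝ) ^ 7 * ∑ i, (Nat.factorial 16 : ℝ) *
      Real.exp (1 * |inner ℝ w (EuclideanSpace.single i (1 : ℝ))|) := by
  have h3 := pow_sum_div_card_le_sum_pow (s := Finset.univ) (f := fun i => w i ^ 2)
    (fun i _ => sq_nonneg (w i)) 7
  have h4 : ‖w‖ ^ 16 = (∑ i, w i ^ 2) ^ 8 := by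
    rw [← EuclideanSpace.real_norm_sq_eq]; ring
  rcases Nat.eq_zero_or_pos k with rfl | hk
  · rw [h4]; simp
  have hk' : (0 : ℝ) < k := by exact_mod_cast hk
  simp only [Finset.card_univ, Fintype.card_fin] at h3
  rw [div_le_iff₀ (by positivity)] at h3
  rw [h4]
  refine h3.trans ?_
  rw [mul_comm]
  refine mul_le_mul_of_nonneg_left (Finset.sum_le_sum fun i _ => ?_) (by positivity)
  have e1 : inner ℝ w (EuclideanSpace.single i (1 : ℝ)) = w i := by
    rw [EuclideanSpace.inner_single_right]; simp
  rw [e1, one_mul]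
  have e2 := Real.pow_div_factorial_le_exp |w i| (abs_nonneg _) 16
  rw [div_le_iff₀ (by positivity)] at e2
  have e3 : (w i ^ 2) ^ (7 + 1) = |w i| ^ 16 := by
    rw [← sq_abs]; ring
  rw [e3]; linarith

theorem integrable_one_add_norm_pow (n : ℕ) {k : ℕ} :
    Integrable (fun w => (1 + ‖w‖) ^ n) (stdGaussian (EuclideanSpace ℝ (Fin k))) := by
  have h0 : MemLp id (n : ENNReal) (stdGaussian (EuclideanSpace ℝ (Fin k))) :=
    IsGaussian.memLp_id (stdGaussian (EuclideanSpace ℝ (Fin k))) (n : ENNReal) (by simp)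
  have hc : MemLp (fun _ : EuclideanSpace ℝ (Fin k) => (1 : ℝ)) (n : ENNReal)
      (stdGaussian (EuclideanSpace ℝ (Fin k))) := memLp_const 1
  have h1 : MemLp (fun w : EuclideanSpace ℝ (Fin k) => (1 : ℝ) + ‖w‖) (n : ENNReal)
      (stdGaussian (EuclideanSpace ℝ (Fin k))) := hc.add h0.norm
  have h2 := h1.integrable_norm_pow'
  refine h2.congr (ae_of_all _ fun w => ?_)
  have h3 : 0 ≤ 1 + ‖w‖ := by positivity
  change ‖1 + ‖w‖‖ ^ n = (1 + ‖w‖) ^ n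
  rw [Real.norm_of_nonneg h3]

theorem integral_one_add_norm_pow_le (hd : 1 ≤ d) :
    ∫ w, (1 + ‖w‖) ^ 16 ∂(stdGaussian (EuclideanSpace ℝ (Fin (d + 1)))) ≤
      2 ^ 23 * (1 + 4 * (Nat.factorial 16 : ℝ)) * (d : ℝ) ^ 8 := by
  have hd' : (1 : ℝ) ≤ d := by exact_mod_cast hd
  have hexp : ∀ i : Fin (d + 1), ∫ w, Real.exp (1 * |inner ℝ w (EuclideanSpace.single i (1 : ℝ))|)
      ∂(stdGaussian (EuclideanSpace ℝ (Fin (d + 1)))) ≤ 4 := by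
    intro i
    refine (integral_exp_abs_inner_stdGaussian_le _ 1).trans ?_
    have h1 : Real.exp (1 ^ 2 * ‖(EuclideanSpace.single i (1 : ℝ) :
        EuclideanSpace ℝ (Fin (d + 1)))‖ ^ 2 / 2) = Real.exp (1 / 2) := by simp
    rw [h1]
    have h2 : Real.exp (1 / 2) ^ 2 = Real.exp 1 := by rw [← Real.exp_nat_mul]; norm_num
    nlinarith [Real.exp_one_lt_d9, Real.exp_pos (1 / 2)]
  have hint : ∀ i : Fin (d + 1), Integrable (fun w => (Nat.factorial 16 : ℝ) *
      Real.exp (1 * |inner ℝ w (EuclideanSpace.single i (1 : ℝ))|))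
      (stdGaussian (EuclideanSpace ℝ (Fin (d + 1)))) := fun i =>
    (integrable_exp_abs_inner_stdGaussian _ 1).const_mul _
  have hle : ∀ w : EuclideanSpace ℝ (Fin (d + 1)), (1 + ‖w‖) ^ 16 ≤ 2 ^ 15 * (1 +
      ((d + 1 : ℕ) : ℝ) ^ 7 * ∑ i, (Nat.factorial 16 : ℝ) *
      Real.exp (1 * |inner ℝ w (EuclideanSpace.single i (1 : ℝ))|)) := by
    intro w
    refine (add_pow_le zero_le_one (norm_nonneg w) 16).trans ?_
    rw [one_pow]
    gcongr
    exact norm_pow_le_sum_exp w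
  refine (integral_mono (integrable_one_add_norm_pow 16)
    (((integrable_const 1).add ((integrable_finsetSum _ fun i _ => hint i).const_mul _)).const_mul
      _) hle).trans ?_
  simp only [Pi.add_apply]
  rw [integral_const_mul, integral_add (integrable_const 1)
    ((integrable_finsetSum _ fun i _ => hint i).const_mul _), integral_const_mul,
    integral_finsetSum _ fun i _ => hint i]
  simp only [integral_const, probReal_univ, one_smul, integral_const_mul]
  have h5 : ∑ i : Fin (d + 1), (Nat.factorial 16 : ℝ) *
      ∫ w, Real.exp (1 * |inner ℝ w (EuclideanSpace.single i (1 : ℝ))|)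
        ∂(stdGaussian (EuclideanSpace ℝ (Fin (d + 1)))) ≤
      ((d : ℝ) + 1) * ((Nat.factorial 16 : ℝ) * 4) := by
    refine (Finset.sum_le_sum fun i _ => mul_le_mul_of_nonneg_left (hexp i)
      (by positivity)).trans (le_of_eq ?_)
    simp
  set f : ℝ := (Nat.factorial 16 : ℝ) with hf
  have hf0 : 0 ≤ f := by positivity
  have hd2 : ((d : ℝ) + 1) ≤ 2 * d := by linarith
  have hd8 : (1 : ℝ) ≤ (d : ℝ) ^ 8 := one_le_pow₀ hd'
  calc _ ≤ (2 : ℝ) ^ 15 * (1 + ((d + 1 : ℕ) : ℝ) ^ 7 * (((d : ℝ) + 1) * (f * 4))) := by gcongr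
    _ = 2 ^ 15 * (1 + ((d : ℝ) + 1) ^ 8 * (f * 4)) := by push_cast; ring
    _ ≤ 2 ^ 15 * ((2 : ℝ) ^ 8 * (d : ℝ) ^ 8 + (2 * (d : ℝ)) ^ 8 * (f * 4)) := by
      gcongr
      linarith
    _ = _ := by ring

/-- The inequality `abc ≤ a² + b⁴ + c⁴` separates the norm from the two preactivations, whose laws
do not involve the dimension beyond the norms of `v₁, v₂`. Dividing the norm factor by `d⁴` first
puts all dependence on `d` in front. -/
theorem growth_sq_le (hd : 1 ≤ d) (v₁ v₂ w : EuclideanSpace ℝ (Fin (d + 1))) :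
    growth v₁ v₂ w ^ 2 ≤ (d : ℝ) ^ 4 * ((1 + ‖w‖) ^ 16 / (d : ℝ) ^ 8 +
      Real.exp (8 * |inner ℝ w v₁|) + Real.exp (8 * |inner ℝ w v₂|)) := by
  have hd' : (0 : ℝ) < d := by exact_mod_cast hd
  unfold growth
  set s := (1 + ‖w‖) ^ 8 with hs
  set b := Real.exp (2 * |inner ℝ w v₁|) with hb
  set c := Real.exp (2 * |inner ℝ w v₂|) with hc
  have hb4 : Real.exp (8 * |inner ℝ w v₁|) = b ^ 4 := by
    rw [hb, ← Real.exp_nat_mul]; congr 1; push_cast; ring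
  have hc4 : Real.exp (8 * |inner ℝ w v₂|) = c ^ 4 := by
    rw [hc, ← Real.exp_nat_mul]; congr 1; push_cast; ring
  have h1 : ((1 + ‖w‖) ^ 4 * Real.exp (|inner ℝ w v₁| + |inner ℝ w v₂|)) ^ 2 = s * (b * c) := by
    rw [mul_pow, ← Real.exp_nat_mul, hb, hc, ← Real.exp_add, hs]
    congr 1
    · ring
    · congr 1; push_cast; ring
  have h2 : (1 + ‖w‖) ^ 16 / (d : ℝ) ^ 8 = (s / (d : ℝ) ^ 4) ^ 2 := by
    rw [hs, div_pow]; ring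
  rw [h1, h2, hb4, hc4]
  set a := s / (d : ℝ) ^ 4 with ha
  have h3 : s = (d : ℝ) ^ 4 * a := by rw [ha]; field_simp
  rw [h3, mul_assoc]
  refine mul_le_mul_of_nonneg_left ?_ (by positivity)
  nlinarith [sq_nonneg (a - b * c), sq_nonneg (b ^ 2 - c ^ 2), sq_nonneg a, sq_nonneg (b ^ 2),
    sq_nonneg (c ^ 2)]

variable {v₁ v₂ : EuclideanSpace ℝ (Fin (d + 1))}

theorem integrable_growth_sq (hd : 1 ≤ d) :
    Integrable (fun w => growth v₁ v₂ w ^ 2) (stdGaussian _) := by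
  refine (((((integrable_one_add_norm_pow 16).div_const ((d : ℝ) ^ 8)).add
    (integrable_exp_abs_inner_stdGaussian v₁ 8)).add
    (integrable_exp_abs_inner_stdGaussian v₂ 8)).const_mul ((d : ℝ) ^ 4)).mono'
    ((continuous_growth v₁ v₂).pow 2).aestronglyMeasurable (ae_of_all _ fun w => ?_)
  rw [Real.norm_of_nonneg (sq_nonneg _)]
  exact growth_sq_le hd v₁ v₂ w

theorem integral_growth_sq_le (hd : 1 ≤ d) (h₁ : ‖v₁‖ ≤ √2) (h₂ : ‖v₂‖ ≤ √2) :
    ∫ w, growth v₁ v₂ w ^ 2 ∂(stdGaussian _) ≤ momentConst * (d : ℝ) ^ 4 := by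
  have hd' : (0 : ℝ) < d := by exact_mod_cast hd
  have hexp : ∀ v : EuclideanSpace ℝ (Fin (d + 1)), ‖v‖ ≤ √2 →
      ∫ w, Real.exp (8 * |inner ℝ w v|) ∂(stdGaussian _) ≤ 2 * Real.exp 64 := by
    intro v hv
    refine (integral_exp_abs_inner_stdGaussian_le v 8).trans ?_
    have : ‖v‖ ^ 2 ≤ 2 := by
      calc ‖v‖ ^ 2 ≤ √2 ^ 2 := by gcongr
        _ = 2 := Real.sq_sqrt (by norm_num)
    gcongr
    linarith
  have i1 := (integrable_one_add_norm_pow (k := d + 1) 16).div_const ((d : ℝ) ^ 8)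
  have i2 := integrable_exp_abs_inner_stdGaussian v₁ 8
  have i3 := integrable_exp_abs_inner_stdGaussian v₂ 8
  have i12 : Integrable (fun w => (1 + ‖w‖) ^ 16 / (d : ℝ) ^ 8 + Real.exp (8 * |inner ℝ w v₁|))
      (stdGaussian (EuclideanSpace ℝ (Fin (d + 1)))) := i1.add i2
  refine (integral_mono (integrable_growth_sq hd) ((i12.add i3).const_mul ((d : ℝ) ^ 4))
    (growth_sq_le hd v₁ v₂)).trans ?_
  simp only [Pi.add_apply]
  rw [integral_const_mul, integral_add i12 i3, integral_add i1 i2, integral_div,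
    mul_comm momentConst]
  refine mul_le_mul_of_nonneg_left ?_ (by positivity)
  have h3 := integral_one_add_norm_pow_le hd
  have h4 : (∫ w, (1 + ‖w‖) ^ 16 ∂(stdGaussian (EuclideanSpace ℝ (Fin (d + 1))))) / (d : ℝ) ^ 8 ≤
      2 ^ 23 * (1 + 4 * (Nat.factorial 16 : ℝ)) := by
    rw [div_le_iff₀ (by positivity)]; exact h3
  unfold momentConst
  linarith [hexp v₁ h₁, hexp v₂ h₂]

theorem integrable_growth (hd : 1 ≤ d) : Integrable (growth v₁ v₂) (stdGaussian _) := by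
  refine ((integrable_growth_sq (v₁ := v₁) (v₂ := v₂) hd).add (integrable_const 1)).mono'
    (continuous_growth v₁ v₂).aestronglyMeasurable (ae_of_all _ fun w => ?_)
  rw [Real.norm_of_nonneg (growth_pos v₁ v₂ w).le]
  simp only [Pi.add_apply]
  nlinarith [sq_nonneg (growth v₁ v₂ w - 1)]

/-- Cauchy-Schwarz against the indicator of `A`, in the form `g ≤ (g²/t + t)/2` on `A`; the choice
`t = d²/s` balances the second moment of order `d⁴` and the measure `s²`. -/
theorem setIntegral_growth_le (hd : 1 ≤ d) (h₁ : ‖v₁‖ ≤ √2) (h₂ : ‖v₂‖ ≤ √2)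
    {A : Set (EuclideanSpace ℝ (Fin (d + 1)))} (hA : MeasurableSet A) {s : ℝ} (hs : 0 < s)
    (hAs : (stdGaussian (EuclideanSpace ℝ (Fin (d + 1)))).real A ≤ s ^ 2) :
    ∫ w in A, growth v₁ v₂ w ∂(stdGaussian _) ≤ momentConst * (d : ℝ) ^ 2 * s := by
  have hd' : (0 : ℝ) < d := by exact_mod_cast hd
  rw [← integral_indicator hA]
  set t := (d : ℝ) ^ 2 / s with ht
  have ht0 : 0 < t := by positivity
  have hle : ∀ w, A.indicator (growth v₁ v₂) w ≤
      (growth v₁ v₂ w ^ 2 / t + A.indicator (fun _ => t) w) / 2 := by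
    intro w
    by_cases hw : w ∈ A
    · rw [Set.indicator_of_mem hw, Set.indicator_of_mem hw, div_add' _ _ _ ht0.ne', div_div,
        le_div_iff₀ (by positivity)]
      nlinarith [sq_nonneg (growth v₁ v₂ w - t)]
    · rw [Set.indicator_of_notMem hw, Set.indicator_of_notMem hw]
      positivity
  have i1 := (integrable_growth_sq (v₁ := v₁) (v₂ := v₂) hd).div_const t
  have i2 : Integrable (A.indicator fun _ => t) (stdGaussian (EuclideanSpace ℝ (Fin (d + 1)))) :=
    (integrable_const t).indicator hA
  refine (integral_mono ((integrable_growth hd).indicator hA) ((i1.add i2).div_const 2) hle).trans ?_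
  simp only [Pi.add_apply]
  rw [integral_div, integral_add i1 i2, integral_div, integral_indicator_const _ hA, smul_eq_mul]
  have h3 := integral_growth_sq_le hd h₁ h₂
  have h4 : (∫ w, growth v₁ v₂ w ^ 2 ∂(stdGaussian _)) / t ≤ momentConst * (d : ℝ) ^ 2 * s := by
    rw [div_le_iff₀ ht0, ht]
    refine h3.trans (le_of_eq ?_)
    field_simp
  have h5 : (stdGaussian (EuclideanSpace ℝ (Fin (d + 1)))).real A * t ≤
      momentConst * (d : ℝ) ^ 2 * s := by
    calc _ ≤ s ^ 2 * t := by gcongr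
      _ = 1 * (d : ℝ) ^ 2 * s := by rw [ht]; field_simp
      _ ≤ _ := by gcongr; exact one_le_momentConst
  linarith

theorem integral_growth_le (hd : 1 ≤ d) (h₁ : ‖v₁‖ ≤ √2) (h₂ : ‖v₂‖ ≤ √2) :
    ∫ w, growth v₁ v₂ w ∂(stdGaussian _) ≤ momentConst * (d : ℝ) ^ 2 := by
  have := setIntegral_growth_le hd h₁ h₂ MeasurableSet.univ one_pos (by simp)
  simpa using this

end Moments

/-! ### Exponential bounds for the features on the whole space -/

section GlobalBounds

/-- The constant in the exponential growth bound of the activation function. -/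
def activationConst (C ℓ : ℝ) : ℝ :=
  2 * C * (Nat.factorial (⌈ℓ⌉₊ + 1) : ℝ) * Real.exp 1

/-- The local bounds are used with `M = 1 + |z|`, which gives polynomial growth of degree `⌈ℓ⌉ + 1`
in `M`. Passing to an exponential moves `ℓ` into the constant, so that one family of Gaussian
moments serves all activations. -/
theorem ActivationBound.abs_le_exp {σ CM : ℝ → ℝ} {C ℓ : ℝ} (h : ActivationBound σ CM C ℓ)
    (hC : 0 < C) {k : ℕ} (hk : k ≤ 3) (z : ℝ) :
    |iteratedDeriv k σ z| ≤ activationConst C ℓ * Real.exp |z| := by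
  set M := 1 + |z| with hM
  have hM1 : 1 ≤ M := by linarith [abs_nonneg z]
  have hM0 : 0 < M := by linarith
  have h1 := h.lipschitz M hM0 k hk z 0 (by linarith) (by simpa using hM0.le)
  have h2 := h.at_zero M hM0 k hk
  have h3 := h.growth M hM0
  rw [sub_zero] at h1
  have h4 := abs_add_le (iteratedDeriv k σ z - iteratedDeriv k σ 0) (iteratedDeriv k σ 0)
  rw [sub_add_cancel] at h4
  have h5 : M ^ ℓ ≤ M ^ ⌈ℓ⌉₊ := by
    rw [← Real.rpow_natCast]
    exact Real.rpow_le_rpow_of_exponent_le hM1 (Nat.le_ceil ℓ)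
  have h6 : 1 ≤ M ^ ⌈ℓ⌉₊ := one_le_pow₀ hM1
  have h7 := Real.pow_div_factorial_le_exp M hM0.le (⌈ℓ⌉₊ + 1)
  rw [div_le_iff₀ (by positivity)] at h7
  have h8 : Real.exp M = Real.exp 1 * Real.exp |z| := by rw [hM, Real.exp_add]
  calc |iteratedDeriv k σ z| ≤ CM M * |z| + CM M := by linarith
    _ = CM M * M := by rw [hM]; ring
    _ ≤ C * (1 + M ^ ℓ) * M := by gcongr
    _ ≤ C * (M ^ ⌈ℓ⌉₊ + M ^ ⌈ℓ⌉₊) * M := by gcongr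
    _ = 2 * C * M ^ (⌈ℓ⌉₊ + 1) := by ring
    _ ≤ 2 * C * (Real.exp M * (Nat.factorial (⌈ℓ⌉₊ + 1) : ℝ)) := by gcongr
    _ = _ := by rw [h8, activationConst]; ring

/-- The constant in the growth bound of the features. -/
def growthConst (γ C ℓ : ℝ) : ℝ := 2 * (1 + γ) * activationConst C ℓ

variable {d n₁ n₂ : ℕ}

namespace Problem

/-- The extended sampling point of the entry `j` of the loss vector. -/
def samplePoint (P : Problem d n₁ n₂) (j : Fin n₁ ⊕ Fin n₂) : EuclideanSpace ℝ (Fin (d + 1)) :=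
  Sum.elim (fun p => extendedPoint (P.x p)) (fun q => extendedPoint (P.y q)) j

variable {P : Problem d n₁ n₂} {CM : ℝ → ℝ} {C ℓ : ℝ}

theorem norm_samplePoint_le (hx : ∀ p, ‖P.x p‖ ≤ 1) (hy : ∀ q, ‖P.y q‖ ≤ 1)
    (j : Fin n₁ ⊕ Fin n₂) : ‖P.samplePoint j‖ ≤ √2 := by
  rcases j with p | q
  · exact norm_extendedPoint_le (hx p)
  · exact norm_extendedPoint_le (hy q)

theorem activationConst_nonneg (hC : 0 < C) : 0 ≤ activationConst C ℓ := by
  unfold activationConst; positivity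

theorem growthConst_nonneg (hC : 0 < C) {γ : ℝ} (hγ : 0 ≤ γ) : 0 ≤ growthConst γ C ℓ := by
  have := activationConst_nonneg (ℓ := ℓ) hC
  unfold growthConst; positivity

/-- Without the factor `(1 + ‖w‖)²` of the general bound, the second moment is independent of the
dimension; this is needed for `eigenvalueBound`. -/
theorem feature_boundary_abs_le (hσ : ActivationBound P.σ CM C ℓ) (hC : 0 < C) (hγ : 0 ≤ P.γ)
    (q : Fin n₂) (w : EuclideanSpace ℝ (Fin (d + 1))) :
    |P.feature (Sum.inr q) w| ≤ sampleScale (n₁ := n₁) (Sum.inr q) * growthConst P.γ C ℓ *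
      Real.exp |inner ℝ w (P.samplePoint (Sum.inr q))| := by
  simp only [feature, samplePoint, sampleScale, Sum.elim_inr]
  have hc := activationConst_nonneg (ℓ := ℓ) hC
  have e1 := hσ.abs_le_exp hC (k := 0) (by norm_num) (inner ℝ w (extendedPoint (P.y q)))
  rw [iteratedDeriv_zero] at e1
  rw [Real.sqrt_div hγ, div_eq_mul_one_div, mul_comm √P.γ, mul_assoc, abs_mul,
    abs_of_nonneg (by positivity), mul_assoc]
  refine mul_le_mul_of_nonneg_left ?_ (by positivity)
  rw [abs_mul, abs_of_nonneg (Real.sqrt_nonneg _)]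
  calc _ ≤ (1 + P.γ) * (activationConst C ℓ * Real.exp |inner ℝ w (extendedPoint (P.y q))|) := by
        gcongr; exact sqrt_le_one_add hγ
    _ ≤ _ := by
        unfold growthConst
        have : 0 ≤ (1 + P.γ) * (activationConst C ℓ *
          Real.exp |inner ℝ w (extendedPoint (P.y q))|) := by positivity
        linarith

theorem norm_featureGrad_boundary_le (hσ : ActivationBound P.σ CM C ℓ) (hC : 0 < C)
    (hγ : 0 ≤ P.γ) (hy : ∀ q, ‖P.y q‖ ≤ 1)
    (q : Fin n₂) (w : EuclideanSpace ℝ (Fin (d + 1))) :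
    ‖P.featureGrad (Sum.inr q) w‖ ≤ sampleScale (n₁ := n₁) (Sum.inr q) * growthConst P.γ C ℓ *
      Real.exp |inner ℝ w (P.samplePoint (Sum.inr q))| := by
  simp only [featureGrad, samplePoint, sampleScale, Sum.elim_inr]
  have hc := activationConst_nonneg (ℓ := ℓ) hC
  have hs2 : √2 ≤ 2 := by rw [Real.sqrt_le_left (by norm_num)]; norm_num
  have e1 := hσ.abs_le_exp hC (k := 1) (by norm_num) (inner ℝ w (extendedPoint (P.y q)))
  have e2 := (norm_extendedPoint_le (hy q)).trans hs2
  rw [norm_smul, Real.sqrt_div hγ, div_eq_mul_one_div, mul_comm √P.γ, mul_assoc, norm_mul,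
    Real.norm_of_nonneg (by positivity), mul_assoc, mul_assoc]
  refine mul_le_mul_of_nonneg_left ?_ (by positivity)
  rw [norm_mul, Real.norm_of_nonneg (Real.sqrt_nonneg _), Real.norm_eq_abs]
  calc _ ≤ (1 + P.γ) * (activationConst C ℓ * Real.exp |inner ℝ w (extendedPoint (P.y q))|) * 2 := by
        gcongr; exact sqrt_le_one_add hγ
    _ = _ := by unfold growthConst; ring

theorem feature_abs_le (hσ : ActivationBound P.σ CM C ℓ) (hC : 0 < C) (hγ : 0 ≤ P.γ)
    (j : Fin n₁ ⊕ Fin n₂) (w : EuclideanSpace ℝ (Fin (d + 1))) :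
    |P.feature j w| ≤ sampleScale j * growthConst P.γ C ℓ *
      ((1 + ‖w‖) ^ 2 * Real.exp |inner ℝ w (P.samplePoint j)|) := by
  have hc := activationConst_nonneg (ℓ := ℓ) hC
  have hg := growthConst_nonneg (ℓ := ℓ) hC hγ
  rcases j with p | q
  · simp only [feature, samplePoint, sampleScale, Sum.elim_inl]
    have e1 := hσ.abs_le_exp hC (k := 2) (by norm_num) (inner ℝ w (extendedPoint (P.x p)))
    rw [abs_mul, abs_of_nonneg (by positivity), mul_assoc]
    refine mul_le_mul_of_nonneg_left ?_ (by positivity)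
    rw [abs_mul, abs_of_nonneg (sq_nonneg _)]
    calc _ ≤ (1 + ‖w‖) ^ 2 * (activationConst C ℓ *
          Real.exp |inner ℝ w (extendedPoint (P.x p))|) := by
          gcongr
          exact (norm_spatial_le w).trans (by linarith)
      _ = activationConst C ℓ * ((1 + ‖w‖) ^ 2 *
          Real.exp |inner ℝ w (extendedPoint (P.x p))|) := by ring
      _ ≤ _ := by
          gcongr
          unfold growthConst
          nlinarith
  · refine (feature_boundary_abs_le hσ hC hγ q w).trans ?_
    refine mul_le_mul_of_nonneg_left ?_ (mul_nonneg (sampleScale_nonneg _) hg)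
    refine le_mul_of_one_le_left (Real.exp_pos _).le (one_le_pow₀ ?_)
    linarith [norm_nonneg w]

theorem norm_featureGrad_le (hσ : ActivationBound P.σ CM C ℓ) (hC : 0 < C) (hγ : 0 ≤ P.γ)
    (hx : ∀ p, ‖P.x p‖ ≤ 1) (hy : ∀ q, ‖P.y q‖ ≤ 1)
    (j : Fin n₁ ⊕ Fin n₂) (w : EuclideanSpace ℝ (Fin (d + 1))) :
    ‖P.featureGrad j w‖ ≤ sampleScale j * growthConst P.γ C ℓ *
      ((1 + ‖w‖) ^ 2 * Real.exp |inner ℝ w (P.samplePoint j)|) := by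
  have hc := activationConst_nonneg (ℓ := ℓ) hC
  have hg := growthConst_nonneg (ℓ := ℓ) hC hγ
  rcases j with p | q
  · simp only [featureGrad, samplePoint, sampleScale, Sum.elim_inl]
    have hs2 : √2 ≤ 2 := by rw [Real.sqrt_le_left (by norm_num)]; norm_num
    have e1 := hσ.abs_le_exp hC (k := 2) (by norm_num) (inner ℝ w (extendedPoint (P.x p)))
    have e1' := hσ.abs_le_exp hC (k := 3) (by norm_num) (inner ℝ w (extendedPoint (P.x p)))
    have e2 := (norm_extendedPoint_le (hx p)).trans hs2
    have e3 := (norm_adjoint_spatial_le (spatial d w)).trans (norm_spatial_le w)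
    have e4 := norm_spatial_le w
    rw [norm_smul, Real.norm_of_nonneg (by positivity), mul_assoc]
    refine mul_le_mul_of_nonneg_left ?_ (by positivity)
    refine (norm_add_le _ _).trans ?_
    rw [norm_smul, norm_smul, norm_mul, norm_mul, Real.norm_of_nonneg (sq_nonneg ‖spatial d w‖),
      Real.norm_of_nonneg zero_le_two, Real.norm_eq_abs, Real.norm_eq_abs]
    set e := Real.exp |inner ℝ w (extendedPoint (P.x p))|
    have he : 0 < e := Real.exp_pos _
    calc _ ≤ 2 * (activationConst C ℓ * e) * ‖w‖ + ‖w‖ ^ 2 * (activationConst C ℓ * e) * 2 := by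
          gcongr
      _ ≤ 2 * activationConst C ℓ * ((1 + ‖w‖) ^ 2 * e) := by
          nlinarith [mul_nonneg hc he.le, mul_nonneg (mul_nonneg hc he.le) (norm_nonneg w)]
      _ ≤ _ := by
          gcongr
          unfold growthConst
          nlinarith
  · refine (norm_featureGrad_boundary_le hσ hC hγ hy q w).trans ?_
    refine mul_le_mul_of_nonneg_left ?_ (mul_nonneg (sampleScale_nonneg _) hg)
    refine le_mul_of_one_le_left (Real.exp_pos _).le (one_le_pow₀ ?_)
    linarith [norm_nonneg w]

theorem continuous_feature (hσ : ContDiff ℝ 3 P.σ) (j : Fin n₁ ⊕ Fin n₂) :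
    Continuous (P.feature j) :=
  continuous_iff_continuousAt.2 fun w =>
    (hasGradientAt_iff_hasFDerivAt.1 (hasGradientAt_feature hσ j w)).continuousAt

theorem continuous_featureGrad (hσ : ContDiff ℝ 3 P.σ) (j : Fin n₁ ⊕ Fin n₂) :
    Continuous (P.featureGrad j) := by
  have h : ∀ k ≤ 3, Continuous (iteratedDeriv k P.σ) := fun k hk =>
    hσ.continuous_iteratedDeriv k (by exact_mod_cast hk)
  have h1 := h 1 (by norm_num)
  have h2 := h 2 (by norm_num)
  have h3 := h 3 (by norm_num)
  unfold featureGrad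
  rcases j with p | q
  · simp only [Sum.elim_inl]
    fun_prop
  · simp only [Sum.elim_inr]
    fun_prop

end Problem

end GlobalBounds
end PINN
end

noncomputable section
namespace PINN

/-! ### Hoeffding's inequality, random signs and smallest eigenvalues -/

section Hoeffding

variable {X : Type*} [MeasurableSpace X]

/-- Hoeffding's inequality for a sum of functions of independent coordinates. -/
theorem measureReal_lt_sq_sum_sub_integral_le (μ : Measure X) [IsProbabilityMeasure μ] {m : ℕ}
    {f : Fin m → X → ℝ} {c : Fin m → ℝ} (hf : ∀ r, Measurable (f r))
    (hfc : ∀ r, ∀ᵐ x ∂μ, |f r x| ≤ c r) {t : ℝ} (ht : 0 ≤ t) :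
    (Measure.pi fun _ : Fin m => μ).real
      {x | 2 * t * ∑ r, c r ^ 2 < (∑ r, (f r (x r) - ∫ y, f r y ∂μ)) ^ 2} ≤ 2 * Real.exp (-t) := by
  set π := Measure.pi fun _ : Fin m => μ with hπ
  have hc : ∀ r, 0 ≤ c r := fun r => by
    obtain ⟨x, hx⟩ := (hfc r).exists
    exact (abs_nonneg _).trans hx
  have hsub : ∀ r, HasSubgaussianMGF (fun x : Fin m → X => f r (x r) - ∫ y, f r y ∂μ)
      ((c r) ^ 2).toNNReal π := by
    intro r
    have h1 := hasSubgaussianMGF_of_mem_Icc (a := -c r) (b := c r) (hf r).aemeasurable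
      ((hfc r).mono fun x hx => abs_le.1 hx)
    have h2 : ((‖c r - -c r‖₊ / 2) ^ 2 : NNReal) = ((c r) ^ 2).toNNReal := by
      apply NNReal.eq
      rw [Real.coe_toNNReal _ (sq_nonneg _)]
      push_cast
      rw [sub_neg_eq_add, Real.norm_of_nonneg (by linarith [hc r])]
      ring
    rw [h2] at h1
    have h3 := measurePreserving_eval (fun _ : Fin m => μ) r
    have h4 : HasSubgaussianMGF (fun y => f r y - ∫ y, f r y ∂μ) ((c r) ^ 2).toNNReal
        (π.map (Function.eval r)) := by rw [h3.map_eq]; exact h1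
    exact HasSubgaussianMGF.of_map h3.measurable.aemeasurable h4
  have hind : iIndepFun (fun r (x : Fin m → X) => f r (x r) - ∫ y, f r y ∂μ) π :=
    iIndepFun_pi (X := fun r y => f r y - ∫ y, f r y ∂μ)
      fun r => ((hf r).sub_const _).aemeasurable
  have hsum := HasSubgaussianMGF.sum_of_iIndepFun hind (s := Finset.univ) fun r _ => hsub r
  set v := ∑ r, ((c r) ^ 2).toNNReal with hv
  have hvc : (v : ℝ) = ∑ r, c r ^ 2 := by
    rw [hv]
    push_cast
    exact Finset.sum_congr rfl fun r _ => Real.coe_toNNReal _ (sq_nonneg _)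
  rw [← hvc]
  -- With variance proxy `0` the exponent of the tail bound degenerates. The sum then vanishes
  -- almost surely, and the strict inequality in the event excludes it.
  by_cases hv0 : v = 0
  · rw [hv0] at hsum
    have h4 := hsum.ae_eq_zero_of_hasSubgaussianMGF_zero
    have h5 : π {x | 2 * t * (v : ℝ) < (∑ r, (f r (x r) - ∫ y, f r y ∂μ)) ^ 2} = 0 := by
      refine measure_mono_null (fun x hx => ?_) h4
      intro h6
      simp only [Pi.zero_apply, Set.mem_ofPred_eq] at h6 hx
      rw [h6, hv0] at hx
      simp at hx
    rw [measureReal_def, h5]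
    simp only [ENNReal.toReal_zero]
    positivity
  · have hvpos : (0 : ℝ) < v := by exact_mod_cast pos_iff_ne_zero.2 hv0
    set u := √(2 * t * v) with hu
    have hu0 : 0 ≤ u := Real.sqrt_nonneg _
    have hu2 : u ^ 2 = 2 * t * v := Real.sq_sqrt (by positivity)
    have h6 := hsum.measure_ge_le hu0
    have h7 := hsum.neg.measure_ge_le hu0
    have he : -u ^ 2 / (2 * (v : ℝ)) = -t := by rw [hu2]; field_simp
    rw [he] at h6 h7
    refine (measureReal_mono (s₂ := {x | u ≤ ∑ r, (f r (x r) - ∫ y, f r y ∂μ)} ∪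
      {x | u ≤ (-fun x : Fin m → X => ∑ r, (f r (x r) - ∫ y, f r y ∂μ)) x}) ?_).trans
      ((measureReal_union_le _ _).trans (by linarith))
    intro x hx
    simp only [Set.mem_ofPred_eq] at hx
    rw [← hu2] at hx
    have h8 := (sq_lt_sq.1 hx).le
    rw [abs_of_nonneg hu0, le_abs] at h8
    exact h8

end Hoeffding

section Rademacher

instance : IsProbabilityMeasure rademacher := ⟨by
  simp [rademacher, ENNReal.inv_two_add_inv_two]⟩

theorem ae_rademacher_iff {p : ℝ → Prop} (hp : MeasurableSet {a | p a}) :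
    (∀ᵐ a ∂rademacher, p a) ↔ p (-1) ∧ p 1 := by
  unfold rademacher
  rw [ae_add_measure_iff, Measure.ae_ennreal_smul_measure_iff (by simp),
    Measure.ae_ennreal_smul_measure_iff (by simp), ae_dirac_iff hp, ae_dirac_iff hp]

theorem ae_abs_eq_one_rademacher : ∀ᵐ a ∂rademacher, |a| = 1 := by
  rw [ae_rademacher_iff (measurableSet_eq_fun (by fun_prop) (by fun_prop))]
  simp

theorem integral_id_rademacher : ∫ a, a ∂rademacher = 0 := by
  unfold rademacher
  rw [integral_add_measure]
  · simp
  · exact (integrable_dirac (by simp)).smul_measure (by simp)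
  · exact (integrable_dirac (by simp)).smul_measure (by simp)

end Rademacher

section LambdaMin

variable {ι : Type} [Fintype ι] [DecidableEq ι] {A : Matrix ι ι ℝ}

theorem lambdaMin_mem_spectrum [Nonempty ι] (hA : A.PosDef) : lambdaMin A ∈ spectrum ℝ A := by
  have h1 := hA.isHermitian.spectrum_real_eq_range_eigenvalues
  unfold lambdaMin
  refine Set.Nonempty.csInf_mem ?_ ?_
  · rw [h1]; exact Set.range_nonempty _
  · rw [h1]; exact Set.finite_range _

theorem lambdaMin_pos [Nonempty ι] (hA : A.PosDef) : 0 < lambdaMin A := by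
  have h1 := lambdaMin_mem_spectrum hA
  rw [hA.isHermitian.spectrum_real_eq_range_eigenvalues] at h1
  obtain ⟨i, hi⟩ := h1
  rw [← hi]
  exact hA.eigenvalues_pos i

theorem posSemidef_sub_lambdaMin (hA : A.PosDef) :
    (A - algebraMap ℝ (Matrix ι ι ℝ) (lambdaMin A)).PosSemidef := by
  have h2 : (A - algebraMap ℝ (Matrix ι ι ℝ) (lambdaMin A)).IsHermitian := by
    refine hA.isHermitian.sub ?_
    rw [Matrix.algebraMap_eq_diagonal]
    exact Matrix.isHermitian_diagonal _
  rw [h2.posSemidef_iff_eigenvalues_nonneg]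
  intro i
  have h3 : h2.eigenvalues i ∈ spectrum ℝ (A - algebraMap ℝ (Matrix ι ι ℝ) (lambdaMin A)) := by
    rw [h2.spectrum_real_eq_range_eigenvalues]; exact Set.mem_range_self i
  rw [← spectrum.sub_singleton_eq] at h3
  obtain ⟨a, ha, b, hb, hab⟩ := h3
  rw [Set.mem_singleton_iff.1 hb] at hab
  have h4 : lambdaMin A ≤ a := by
    refine csInf_le ?_ ha
    rw [hA.isHermitian.spectrum_real_eq_range_eigenvalues]
    exact (Set.finite_range _).bddBelow
  change 0 ≤ h2.eigenvalues i
  rw [← hab]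
  simpa using h4

theorem lambdaMin_mul_le (hA : A.PosDef) (v : ι → ℝ) :
    lambdaMin A * ∑ j, v j ^ 2 ≤ ∑ j, ∑ k, v j * v k * A j k := by
  have h1 := (posSemidef_sub_lambdaMin hA).dotProduct_mulVec_nonneg v
  rw [Matrix.sub_mulVec, Matrix.algebraMap_eq_diagonal, dotProduct_sub] at h1
  have h2 : star v ⬝ᵥ A.mulVec v = ∑ j, ∑ k, v j * v k * A j k := by
    simp only [dotProduct, Matrix.mulVec, star_trivial, Finset.mul_sum]
    exact Finset.sum_congr rfl fun j _ => Finset.sum_congr rfl fun k _ => by ring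
  have h3 : star v ⬝ᵥ (Matrix.diagonal (algebraMap ℝ (ι → ℝ) (lambdaMin A))).mulVec v =
      lambdaMin A * ∑ j, v j ^ 2 := by
    simp only [dotProduct, Matrix.mulVec_diagonal, star_trivial, Finset.mul_sum]
    exact Finset.sum_congr rfl fun j _ => by simp; ring
  rw [h2, h3] at h1
  linarith

theorem lambdaMin_le_diag (hA : A.PosDef) (j : ι) : lambdaMin A ≤ A j j := by
  have h := lambdaMin_mul_le hA (Pi.single j 1)
  simpa [Pi.single_apply, Finset.sum_ite_eq'] using h

end LambdaMin
end PINN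
end

noncomputable section
namespace PINN

/-! ### Concentration of the Gram matrices around their expectations -/

section Averages

variable {X : Type*} [MeasurableSpace X] {μ : Measure X} [IsProbabilityMeasure μ] {m : ℕ}

/-- Concentration of an empirical mean, restricted to the event that all samples lie in a set on
which the function is bounded. -/
theorem measureReal_average_deviation_le (hm : 1 ≤ m) {W₀ : Set X} (hW₀ : MeasurableSet W₀)
    {f : X → ℝ} (hf : Measurable f) (hfi : Integrable f μ) {c e t : ℝ} (hc : 0 ≤ c)
    (hfc : ∀ x ∈ W₀, |f x| ≤ c) (he : |∫ x in W₀ᶜ, f x ∂μ| ≤ e) (ht : 0 ≤ t) :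
    (Measure.pi fun _ : Fin m => μ).real
      {x | (∀ r, x r ∈ W₀) ∧ c * √(2 * t / m) + e < |1 / (m : ℝ) * ∑ r, f (x r) - ∫ y, f y ∂μ|} ≤
      2 * Real.exp (-t) := by
  have hm0 : (0 : ℝ) < m := by exact_mod_cast hm
  have h1 := measureReal_lt_sq_sum_sub_integral_le μ (m := m) (f := fun _ => W₀.indicator f)
    (c := fun _ => c) (fun _ => hf.indicator hW₀) (fun _ => ae_of_all _ fun x => by
      by_cases hx : x ∈ W₀
      · rw [Set.indicator_of_mem hx]; exact hfc x hx
      · rw [Set.indicator_of_notMem hx]; simpa using hc) ht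
  refine (measureReal_mono ?_).trans h1
  rintro x ⟨hx1, hx2⟩
  simp only [Set.mem_ofPred_eq, Finset.sum_sub_distrib, Finset.sum_const, Finset.card_univ,
    Fintype.card_fin, nsmul_eq_mul]
  have h2 : ∑ r, W₀.indicator f (x r) = ∑ r, f (x r) :=
    Finset.sum_congr rfl fun r _ => Set.indicator_of_mem (hx1 r) f
  have h3 : ∫ y, W₀.indicator f y ∂μ + ∫ y in W₀ᶜ, f y ∂μ = ∫ y, f y ∂μ := by
    rw [integral_indicator hW₀, integral_add_compl hW₀ hfi]
  rw [h2]
  set I := ∫ y, W₀.indicator f y ∂μ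
  set J := ∫ y in W₀ᶜ, f y ∂μ
  set S := ∑ r, f (x r)
  rw [← h3] at hx2
  -- The truncation changes the mean by `J`, with `|J| ≤ e`; the rest of the deviation is left to
  -- Hoeffding's inequality for the truncated function.
  have h4 : c * √(2 * t / m) < |1 / (m : ℝ) * S - I| := by
    have h5 := abs_add_le (1 / (m : ℝ) * S - I) (-J)
    rw [abs_neg, show 1 / (m : ℝ) * S - I + -J = 1 / (m : ℝ) * S - (I + J) by ring] at h5
    linarith
  have h6 : S - m * I = m * (1 / (m : ℝ) * S - I) := by field_simp
  have h7 : (c * √(2 * t / m)) ^ 2 < |1 / (m : ℝ) * S - I| ^ 2 :=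
    pow_lt_pow_left₀ h4 (by positivity) two_ne_zero
  rw [mul_pow, Real.sq_sqrt (by positivity), sq_abs] at h7
  rw [h6, mul_pow]
  calc 2 * t * (m * c ^ 2) = (m : ℝ) ^ 2 * (c ^ 2 * (2 * t / m)) := by field_simp
    _ < _ := by gcongr

end Averages

variable {d n₁ n₂ m : ℕ}

theorem isClosed_weightRegion (B : ℝ) : IsClosed (weightRegion d B) := by
  have h : weightRegion d B = {w | ‖w‖ ≤ B} ∩
      ⋂ x : EuclideanSpace ℝ (Fin d), ⋂ _ : ‖x‖ ≤ 1, {w | |inner ℝ w (extendedPoint x)| ≤ B} := by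
    ext w
    simp [weightRegion]
  rw [h]
  refine IsClosed.inter (isClosed_le (by fun_prop) (by fun_prop)) ?_
  exact isClosed_iInter fun x => isClosed_iInter fun _ => isClosed_le (by fun_prop) (by fun_prop)

theorem weightRegion_mono {B B' : ℝ} (h : B ≤ B') : weightRegion d B ⊆ weightRegion d B' :=
  fun _ hw => ⟨hw.1.trans h, fun x hx => (hw.2 x hx).trans h⟩

namespace Problem

/-- The kernel of the Gram matrix of the derivatives in the inner weights. -/
def kernelW (P : Problem d n₁ n₂) (j k : Fin n₁ ⊕ Fin n₂) (w : EuclideanSpace ℝ (Fin (d + 1))) :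
    ℝ :=
  inner ℝ (P.featureGrad j w) (P.featureGrad k w)

/-- The kernel of the Gram matrix of the derivatives in the outer weights. -/
def kernelA (P : Problem d n₁ n₂) (j k : Fin n₁ ⊕ Fin n₂) (w : EuclideanSpace ℝ (Fin (d + 1))) :
    ℝ :=
  P.feature j w * P.feature k w

variable {P : Problem d n₁ n₂} {CM : ℝ → ℝ} {C ℓ : ℝ}

theorem continuous_kernelW (hσ : ContDiff ℝ 3 P.σ) (j k : Fin n₁ ⊕ Fin n₂) :
    Continuous (P.kernelW j k) :=
  (continuous_featureGrad hσ j).inner (continuous_featureGrad hσ k)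

theorem continuous_kernelA (hσ : ContDiff ℝ 3 P.σ) (j k : Fin n₁ ⊕ Fin n₂) :
    Continuous (P.kernelA j k) :=
  (continuous_feature hσ j).mul (continuous_feature hσ k)

theorem abs_kernelW_le (hσ : ActivationBound P.σ CM C ℓ) (hC : 0 < C) (hγ : 0 ≤ P.γ)
    (hx : ∀ p, ‖P.x p‖ ≤ 1) (hy : ∀ q, ‖P.y q‖ ≤ 1) (j k : Fin n₁ ⊕ Fin n₂)
    (w : EuclideanSpace ℝ (Fin (d + 1))) :
    |P.kernelW j k w| ≤ sampleScale j * sampleScale k * growthConst P.γ C ℓ ^ 2 *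
      growth (P.samplePoint j) (P.samplePoint k) w := by
  unfold kernelW growth
  refine (abs_real_inner_le_norm _ _).trans ((mul_le_mul (norm_featureGrad_le hσ hC hγ hx hy j w)
    (norm_featureGrad_le hσ hC hγ hx hy k w) (norm_nonneg _)
    ((norm_nonneg _).trans (norm_featureGrad_le hσ hC hγ hx hy j w))).trans (le_of_eq ?_))
  rw [Real.exp_add]
  ring

theorem abs_kernelA_le (hσ : ActivationBound P.σ CM C ℓ) (hC : 0 < C) (hγ : 0 ≤ P.γ)
    (j k : Fin n₁ ⊕ Fin n₂) (w : EuclideanSpace ℝ (Fin (d + 1))) :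
    |P.kernelA j k w| ≤ sampleScale j * sampleScale k * growthConst P.γ C ℓ ^ 2 *
      growth (P.samplePoint j) (P.samplePoint k) w := by
  unfold kernelA growth
  rw [abs_mul]
  refine (mul_le_mul (feature_abs_le hσ hC hγ j w)
    (feature_abs_le hσ hC hγ k w) (abs_nonneg _)
    ((abs_nonneg _).trans (feature_abs_le hσ hC hγ j w))).trans (le_of_eq ?_)
  rw [Real.exp_add]
  ring

/-- The deviation of the Gram matrices from their expectations. -/
def gramDeviation (γ C ℓ Q : ℝ) (d m : ℕ) (t : ℝ) : ℝ :=
  Q ^ 2 * √(2 * t / m) + growthConst γ C ℓ ^ 2 * momentConst * (d : ℝ) ^ 2 / √(m : ℝ)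

theorem integrable_of_le_growth (hd : 1 ≤ d) {ker : EuclideanSpace ℝ (Fin (d + 1)) → ℝ}
    (hk : Continuous ker) {v₁ v₂ : EuclideanSpace ℝ (Fin (d + 1))} {a : ℝ}
    (hle : ∀ w, |ker w| ≤ a * growth v₁ v₂ w) :
    Integrable ker (stdGaussian (EuclideanSpace ℝ (Fin (d + 1)))) :=
  ((integrable_growth hd).const_mul a).mono' hk.aestronglyMeasurable
    (ae_of_all _ fun w => by rw [Real.norm_eq_abs]; exact hle w)

/-- The kernels are unbounded, so they are truncated to `W₀`, where `Q²` bounds them. The truncation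
error is of order `d²/√m`, because the complement of `W₀` has measure at most `1/m`. -/
theorem measureReal_kernel_deviation_le (hd : 1 ≤ d) (hm : 1 ≤ m)
    {W₀ : Set (EuclideanSpace ℝ (Fin (d + 1)))} (hW₀ : MeasurableSet W₀)
    (hW₀m : (stdGaussian (EuclideanSpace ℝ (Fin (d + 1)))).real W₀ᶜ ≤ 1 / m)
    (hx : ∀ p, ‖P.x p‖ ≤ 1) (hy : ∀ q, ‖P.y q‖ ≤ 1) {j k : Fin n₁ ⊕ Fin n₂}
    {ker : EuclideanSpace ℝ (Fin (d + 1)) → ℝ} (hk : Continuous ker) {Q : ℝ}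
    (hkQ : ∀ w ∈ W₀, |ker w| ≤ sampleScale j * sampleScale k * Q ^ 2)
    (hle : ∀ w, |ker w| ≤ sampleScale j * sampleScale k * growthConst P.γ C ℓ ^ 2 *
      growth (P.samplePoint j) (P.samplePoint k) w) {t : ℝ} (ht : 0 ≤ t) :
    (Measure.pi fun _ : Fin m => stdGaussian (EuclideanSpace ℝ (Fin (d + 1)))).real
      {w | (∀ r, w r ∈ W₀) ∧ sampleScale j * sampleScale k * gramDeviation P.γ C ℓ Q d m t <
        |1 / (m : ℝ) * ∑ r, ker (w r) - ∫ y, ker y ∂(stdGaussian _)|} ≤ 2 * Real.exp (-t) := by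
  have hm0 : (0 : ℝ) < m := by exact_mod_cast hm
  have hs : 0 ≤ sampleScale j * sampleScale k :=
    mul_nonneg (sampleScale_nonneg j) (sampleScale_nonneg k)
  have hki := integrable_of_le_growth hd hk hle
  have hgi : Integrable (growth (P.samplePoint j) (P.samplePoint k))
    (stdGaussian (EuclideanSpace ℝ (Fin (d + 1)))) := integrable_growth hd
  have h1 : |∫ w in W₀ᶜ, ker w ∂(stdGaussian (EuclideanSpace ℝ (Fin (d + 1))))| ≤
      sampleScale j * sampleScale k * growthConst P.γ C ℓ ^ 2 *
        (momentConst * (d : ℝ) ^ 2 * (1 / √(m : ℝ))) := by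
    refine (abs_integral_le_integral_abs).trans ?_
    refine (integral_mono hki.abs.integrableOn (hgi.const_mul _).integrableOn hle).trans ?_
    rw [integral_const_mul]
    refine mul_le_mul_of_nonneg_left ?_ (mul_nonneg hs (sq_nonneg _))
    refine setIntegral_growth_le hd (norm_samplePoint_le hx hy j) (norm_samplePoint_le hx hy k)
      hW₀.compl (by positivity) ?_
    rw [div_pow, Real.sq_sqrt hm0.le, one_pow]
    exact hW₀m
  have h2 := measureReal_average_deviation_le hm hW₀ hk.measurable hki
    (mul_nonneg hs (sq_nonneg Q)) hkQ h1 ht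
  refine le_trans (le_of_eq ?_) h2
  congr 1
  ext w
  simp only [Set.mem_ofPred_eq]
  rw [show sampleScale j * sampleScale k * gramDeviation P.γ C ℓ Q d m t =
    sampleScale j * sampleScale k * Q ^ 2 * √(2 * t / m) +
      sampleScale j * sampleScale k * growthConst P.γ C ℓ ^ 2 *
        (momentConst * (d : ℝ) ^ 2 * (1 / √(m : ℝ))) by unfold gramDeviation; ring]

/-- The initial inner weights lie in the region `W₀`, and the averages of the kernels are close to
their expectations. -/
def RegularWeights (P : Problem d n₁ n₂) (W₀ : Set (EuclideanSpace ℝ (Fin (d + 1)))) (Δ : ℝ)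
    (w : Fin m → EuclideanSpace ℝ (Fin (d + 1))) : Prop :=
  (∀ r, w r ∈ W₀) ∧ ∀ j k,
    |1 / (m : ℝ) * ∑ r, P.kernelW j k (w r) - ∫ y, P.kernelW j k y ∂(stdGaussian _)| ≤
      sampleScale j * sampleScale k * Δ ∧
    |1 / (m : ℝ) * ∑ r, P.kernelA j k (w r) - ∫ y, P.kernelA j k y ∂(stdGaussian _)| ≤
      sampleScale j * sampleScale k * Δ

theorem isClosed_regularWeights (hσ : ContDiff ℝ 3 P.σ)
    {W₀ : Set (EuclideanSpace ℝ (Fin (d + 1)))} (hW₀ : IsClosed W₀) (Δ : ℝ) :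
    IsClosed {w : Fin m → EuclideanSpace ℝ (Fin (d + 1)) | P.RegularWeights W₀ Δ w} := by
  have h : {w : Fin m → EuclideanSpace ℝ (Fin (d + 1)) | P.RegularWeights W₀ Δ w} =
      (⋂ r, (fun w => w r) ⁻¹' W₀) ∩ ⋂ j, ⋂ k,
      ({w | |1 / (m : ℝ) * ∑ r, P.kernelW j k (w r) - ∫ y, P.kernelW j k y ∂(stdGaussian _)| ≤
      sampleScale j * sampleScale k * Δ} ∩
      {w | |1 / (m : ℝ) * ∑ r, P.kernelA j k (w r) - ∫ y, P.kernelA j k y ∂(stdGaussian _)| ≤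
      sampleScale j * sampleScale k * Δ}) := by
    ext w
    simp [RegularWeights]
  rw [h]
  refine IsClosed.inter (isClosed_iInter fun r => hW₀.preimage (continuous_apply r))
    (isClosed_iInter fun j => isClosed_iInter fun k => IsClosed.inter ?_ ?_)
  · have := continuous_kernelW hσ j k
    exact isClosed_le (by fun_prop) (by fun_prop)
  · have := continuous_kernelA hσ j k
    exact isClosed_le (by fun_prop) (by fun_prop)

/-- Union bound: `m` neurons leave `W₀` with probability `δ/m` each, and two kernels with tails `2
exp(-t)` occur for every pair of entries. -/
theorem measureReal_not_regularWeights_le (hσ : ActivationBound P.σ CM C ℓ) (hC : 0 < C)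
    (hγ : 0 ≤ P.γ) (hx : ∀ p, ‖P.x p‖ ≤ 1) (hy : ∀ q, ‖P.y q‖ ≤ 1) (hd : 1 ≤ d) (hm : 1 ≤ m)
    {W₀ : Set (EuclideanSpace ℝ (Fin (d + 1)))} (hW₀ : MeasurableSet W₀) {δ : ℝ} (hδ : δ ≤ 1)
    (hW₀m : (stdGaussian (EuclideanSpace ℝ (Fin (d + 1)))).real W₀ᶜ ≤ δ / m) {Q : ℝ}
    (hF : FeatureBounds W₀ P.feature P.featureGrad fun j => Q * sampleScale j)
    {t : ℝ} (ht : 0 ≤ t) :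
    (Measure.pi fun _ : Fin m => stdGaussian (EuclideanSpace ℝ (Fin (d + 1)))).real
      {w | ¬ P.RegularWeights W₀ (gramDeviation P.γ C ℓ Q d m t) w} ≤
      δ + 4 * ((n₁ : ℝ) + n₂) ^ 2 * Real.exp (-t) := by
  have hm0 : (0 : ℝ) < m := by exact_mod_cast hm
  have hW₀m' : (stdGaussian (EuclideanSpace ℝ (Fin (d + 1)))).real W₀ᶜ ≤ 1 / m :=
    hW₀m.trans (by gcongr)
  set Δ := gramDeviation P.γ C ℓ Q d m t with hΔ
  set π := Measure.pi fun _ : Fin m => stdGaussian (EuclideanSpace ℝ (Fin (d + 1))) with hπ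
  let E : (Fin n₁ ⊕ Fin n₂) → (Fin n₁ ⊕ Fin n₂) → (EuclideanSpace ℝ (Fin (d + 1)) → ℝ) →
      Set (Fin m → EuclideanSpace ℝ (Fin (d + 1))) := fun j k ker =>
    {w | (∀ r, w r ∈ W₀) ∧ sampleScale j * sampleScale k * Δ <
        |1 / (m : ℝ) * ∑ r, ker (w r) - ∫ y, ker y ∂(stdGaussian _)|}
  have hEW : ∀ j k, π.real (E j k (P.kernelW j k)) ≤ 2 * Real.exp (-t) := fun j k =>
    measureReal_kernel_deviation_le hd hm hW₀ hW₀m' hx hy (continuous_kernelW hσ.contDiff j k)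
      (fun w hw => (abs_real_inner_le_norm _ _).trans ((mul_le_mul (hF.grad j w hw)
        (hF.grad k w hw) (norm_nonneg _) (hF.nonneg j)).trans (le_of_eq (by ring))))
      (abs_kernelW_le hσ hC hγ hx hy j k) ht
  have hEA : ∀ j k, π.real (E j k (P.kernelA j k)) ≤ 2 * Real.exp (-t) := fun j k =>
    measureReal_kernel_deviation_le hd hm hW₀ hW₀m' hx hy (continuous_kernelA hσ.contDiff j k)
      (fun w hw => by
        unfold kernelA
        rw [abs_mul]
        exact (mul_le_mul (hF.val j w hw) (hF.val k w hw) (abs_nonneg _)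
          (hF.nonneg j)).trans (le_of_eq (by ring)))
      (abs_kernelA_le hσ hC hγ j k) ht
  have hr : ∀ r, π.real {w | w r ∉ W₀} ≤ δ / m := by
    intro r
    have h3 := (measurePreserving_eval
      (fun _ : Fin m => stdGaussian (EuclideanSpace ℝ (Fin (d + 1)))) r).measureReal_preimage
      hW₀.compl.nullMeasurableSet
    rw [← h3] at hW₀m
    exact hW₀m
  have hsub : {w | ¬ P.RegularWeights W₀ Δ w} ⊆ (⋃ r, {w | w r ∉ W₀}) ∪
      ⋃ j, ⋃ k, (E j k (P.kernelW j k) ∪ E j k (P.kernelA j k)) := by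
    intro w hw
    by_contra hcon
    simp only [Set.mem_union, Set.mem_iUnion, not_or, not_exists, Set.mem_ofPred_eq,
      not_not] at hcon
    refine hw ⟨hcon.1, fun j k => ⟨?_, ?_⟩⟩
    · exact not_lt.1 fun h => (hcon.2 j k).1 ⟨hcon.1, h⟩
    · exact not_lt.1 fun h => (hcon.2 j k).2 ⟨hcon.1, h⟩
  refine (measureReal_mono hsub).trans ((measureReal_union_le _ _).trans (add_le_add ?_ ?_))
  · refine (measureReal_iUnion_fintype_le _).trans ((Finset.sum_le_sum fun r _ => hr r).trans ?_)
    rw [Finset.sum_const, Finset.card_univ, Fintype.card_fin, nsmul_eq_mul,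
      mul_div_cancel₀ _ hm0.ne']
  · refine (measureReal_iUnion_fintype_le _).trans ((Finset.sum_le_sum fun j _ =>
      (measureReal_iUnion_fintype_le _).trans (Finset.sum_le_sum fun k _ =>
        (measureReal_union_le _ _).trans (add_le_add (hEW j k) (hEA j k)))).trans (le_of_eq ?_))
    simp only [Finset.sum_const, Finset.card_univ, Fintype.card_sum, Fintype.card_fin, nsmul_eq_mul]
    push_cast
    ring

/-- The infinite Gram matrix of the derivatives in the inner weights as a Gaussian integral. -/
theorem gramWInf_apply (hσ : ContDiff ℝ 3 P.σ) (hm : 1 ≤ m) {j k : Fin n₁ ⊕ Fin n₂}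
    (hi : Integrable (P.kernelW j k) (stdGaussian _)) :
    P.gramWInf m j k = ∫ w, P.kernelW j k w ∂(stdGaussian _) := by
  have hm0 : (0 : ℝ) < m := by exact_mod_cast hm
  simp only [gramWInf, Matrix.of_apply, gramW_apply hσ]
  have ha : ∀ r : Fin m, ∀ᵐ a ∂(Measure.pi fun _ : Fin m => rademacher), a r ^ 2 = 1 := fun r =>
    ((measurePreserving_eval (fun _ : Fin m => rademacher) r).quasiMeasurePreserving.ae
      ae_abs_eq_one_rademacher).mono fun a h => by
        rw [← sq_abs]
        change |a r| = 1 at h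
        rw [h, one_pow]
  have hae : ∀ᵐ θ ∂(initLaw m d), ∀ r, θ.2 r ^ 2 = 1 :=
    ae_all_iff.2 fun r => (Measure.quasiMeasurePreserving_snd).ae (ha r)
  have h1 : ∀ r : Fin m, Integrable (fun θ : Params m d => P.kernelW j k (θ.1 r)) (initLaw m d) :=
    fun r => (integrable_comp_eval (μ := fun _ : Fin m => stdGaussian _) (i := r) hi).comp_fst _
  have h2 : ∫ θ, 1 / (m : ℝ) * ∑ r, θ.2 r ^ 2 *
      inner ℝ (P.featureGrad j (θ.1 r)) (P.featureGrad k (θ.1 r)) ∂(initLaw m d) =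
      ∫ θ, 1 / (m : ℝ) * ∑ r, P.kernelW j k (θ.1 r) ∂(initLaw m d) := by
    refine integral_congr_ae (hae.mono fun θ hθ => ?_)
    simp only [hθ, one_mul, kernelW]
  rw [h2, integral_const_mul, integral_finsetSum _ fun r _ => h1 r]
  have h3 : ∀ r : Fin m, ∫ θ, P.kernelW j k (θ.1 r) ∂(initLaw m d) =
      ∫ w, P.kernelW j k w ∂(stdGaussian _) := fun r => by
    unfold initLaw
    rw [integral_fun_fst (fun w : Fin m → EuclideanSpace ℝ (Fin (d + 1)) => P.kernelW j k (w r)),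
      integral_comp_eval (μ := fun _ : Fin m => stdGaussian (EuclideanSpace ℝ (Fin (d + 1))))
        hi.aestronglyMeasurable]
    simp
  simp only [h3, Finset.sum_const, Finset.card_univ, Fintype.card_fin, nsmul_eq_mul]
  field_simp

/-- The infinite Gram matrix of the derivatives in the outer weights as a Gaussian integral. -/
theorem gramAInf_apply (hσ : ContDiff ℝ 3 P.σ) (hm : 1 ≤ m) {j k : Fin n₁ ⊕ Fin n₂}
    (hi : Integrable (P.kernelA j k) (stdGaussian _)) :
    P.gramAInf m j k = ∫ w, P.kernelA j k w ∂(stdGaussian _) := by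
  have hm0 : (0 : ℝ) < m := by exact_mod_cast hm
  simp only [gramAInf, Matrix.of_apply, gramA_apply hσ]
  have h1 : ∀ r : Fin m, Integrable (fun θ : Params m d => P.kernelA j k (θ.1 r)) (initLaw m d) :=
    fun r => (integrable_comp_eval (μ := fun _ : Fin m => stdGaussian _) (i := r) hi).comp_fst _
  have h3 : ∀ r : Fin m, ∫ θ, P.kernelA j k (θ.1 r) ∂(initLaw m d) =
      ∫ w, P.kernelA j k w ∂(stdGaussian _) := fun r => by
    unfold initLaw
    rw [integral_fun_fst (fun w : Fin m → EuclideanSpace ℝ (Fin (d + 1)) => P.kernelA j k (w r)),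
      integral_comp_eval (μ := fun _ : Fin m => stdGaussian (EuclideanSpace ℝ (Fin (d + 1))))
        hi.aestronglyMeasurable]
    simp
  change ∫ θ, 1 / (m : ℝ) * ∑ r, P.kernelA j k (θ.1 r) ∂(initLaw m d) = _
  rw [integral_const_mul, integral_finsetSum _ fun r _ => h1 r]
  simp only [h3, Finset.sum_const, Finset.card_univ, Fintype.card_fin, nsmul_eq_mul]
  field_simp

end Problem
end PINN
end

noncomputable section
namespace PINN

/-! ### Regular initializations: eigenvalues, initial loss and probability -/

namespace Problem

variable {d n₁ n₂ m : ℕ} {P : Problem d n₁ n₂} {CM : ℝ → ℝ} {C ℓ : ℝ}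

/-- A bound for the smallest eigenvalues of the infinite Gram matrices. -/
def eigenvalueBound (γ C ℓ : ℝ) : ℝ := growthConst γ C ℓ ^ 2 * (2 * Real.exp 4)

/-- The preactivation at a boundary point is Gaussian with variance at most `2` in every dimension.
The integral is a diagonal entry of an infinite Gram matrix, hence an upper bound for its smallest
eigenvalue. -/
theorem integral_sq_le_eigenvalueBound (hy : ∀ q, ‖P.y q‖ ≤ 1)
    (q : Fin n₂) {g : EuclideanSpace ℝ (Fin (d + 1)) → ℝ}
    (hg : ∀ w, |g w| ≤ sampleScale (n₁ := n₁) (Sum.inr q) * growthConst P.γ C ℓ *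
      Real.exp |inner ℝ w (P.samplePoint (Sum.inr q))|) :
    ∫ w, g w ^ 2 ∂(stdGaussian _) ≤ eigenvalueBound P.γ C ℓ := by
  have hs0 := sampleScale_nonneg (n₁ := n₁) (Sum.inr q)
  have hs1 : sampleScale (n₁ := n₁) (Sum.inr q) ≤ 1 := by
    have : (1 : ℝ) ≤ n₂ := by exact_mod_cast q.pos
    simp only [sampleScale, Sum.elim_inr]
    exact div_le_one_of_le₀ (Real.one_le_sqrt.2 this) (Real.sqrt_nonneg _)
  set v := P.samplePoint (Sum.inr q) with hv
  have hv2 : ‖v‖ ^ 2 ≤ 2 := by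
    calc ‖v‖ ^ 2 ≤ √2 ^ 2 := by gcongr; exact norm_extendedPoint_le (hy q)
      _ = 2 := Real.sq_sqrt (by norm_num)
  have h1 : ∀ w, g w ^ 2 ≤ growthConst P.γ C ℓ ^ 2 * Real.exp (2 * |inner ℝ w v|) := by
    intro w
    calc g w ^ 2 = |g w| ^ 2 := (sq_abs _).symm
      _ ≤ (sampleScale (n₁ := n₁) (Sum.inr q) * growthConst P.γ C ℓ *
          Real.exp |inner ℝ w v|) ^ 2 := by gcongr; exact hg w
      _ = sampleScale (n₁ := n₁) (Sum.inr q) ^ 2 * (growthConst P.γ C ℓ ^ 2 *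
          Real.exp (2 * |inner ℝ w v|)) := by
        rw [mul_pow, mul_pow, ← Real.exp_nat_mul]; push_cast; ring
      _ ≤ 1 * (growthConst P.γ C ℓ ^ 2 * Real.exp (2 * |inner ℝ w v|)) := by
        gcongr
        exact pow_le_one₀ hs0 hs1
      _ = _ := one_mul _
  refine (integral_mono_of_nonneg (ae_of_all _ fun w => sq_nonneg _)
    ((integrable_exp_abs_inner_stdGaussian v 2).const_mul _) (ae_of_all _ h1)).trans ?_
  rw [integral_const_mul]
  refine mul_le_mul_of_nonneg_left ((integral_exp_abs_inner_stdGaussian_le v 2).trans ?_)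
    (sq_nonneg _)
  gcongr
  linarith

theorem integrable_kernelW (hσ : ActivationBound P.σ CM C ℓ) (hC : 0 < C) (hγ : 0 ≤ P.γ)
    (hx : ∀ p, ‖P.x p‖ ≤ 1) (hy : ∀ q, ‖P.y q‖ ≤ 1) (hd : 1 ≤ d) (j k : Fin n₁ ⊕ Fin n₂) :
    Integrable (P.kernelW j k) (stdGaussian _) :=
  integrable_of_le_growth hd (continuous_kernelW hσ.contDiff j k)
    (abs_kernelW_le hσ hC hγ hx hy j k)

theorem integrable_kernelA (hσ : ActivationBound P.σ CM C ℓ) (hC : 0 < C) (hγ : 0 ≤ P.γ)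
    (hd : 1 ≤ d) (j k : Fin n₁ ⊕ Fin n₂) :
    Integrable (P.kernelA j k) (stdGaussian _) :=
  integrable_of_le_growth hd (continuous_kernelA hσ.contDiff j k) (abs_kernelA_le hσ hC hγ j k)

theorem lambdaMin_gramWInf_le (hσ : ActivationBound P.σ CM C ℓ) (hC : 0 < C) (hγ : 0 ≤ P.γ)
    (hx : ∀ p, ‖P.x p‖ ≤ 1) (hy : ∀ q, ‖P.y q‖ ≤ 1) (hd : 1 ≤ d) (hm : 1 ≤ m) (q : Fin n₂)
    (hG : (P.gramWInf m).PosDef) : lambdaMin (P.gramWInf m) ≤ eigenvalueBound P.γ C ℓ := by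
  refine (lambdaMin_le_diag hG (Sum.inr q)).trans ?_
  rw [gramWInf_apply hσ.contDiff hm (integrable_kernelW hσ hC hγ hx hy hd _ _)]
  simp only [kernelW, real_inner_self_eq_norm_sq]
  exact integral_sq_le_eigenvalueBound hy q fun w => by
    rw [abs_norm]; exact norm_featureGrad_boundary_le hσ hC hγ hy q w

theorem lambdaMin_gramAInf_le (hσ : ActivationBound P.σ CM C ℓ) (hC : 0 < C) (hγ : 0 ≤ P.γ)
    (hy : ∀ q, ‖P.y q‖ ≤ 1) (hd : 1 ≤ d) (hm : 1 ≤ m) (q : Fin n₂)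
    (hG : (P.gramAInf m).PosDef) : lambdaMin (P.gramAInf m) ≤ eigenvalueBound P.γ C ℓ := by
  refine (lambdaMin_le_diag hG (Sum.inr q)).trans ?_
  rw [gramAInf_apply hσ.contDiff hm (integrable_kernelA hσ hC hγ hd _ _)]
  simp only [kernelA, ← sq]
  exact integral_sq_le_eigenvalueBound hy q fun w => feature_boundary_abs_le hσ hC hγ q w

/-- A perturbation of the entries of a symmetric matrix perturbs its quadratic form. -/
theorem quadratic_form_perturb {G H : Fin n₁ ⊕ Fin n₂ → Fin n₁ ⊕ Fin n₂ → ℝ} {Δ : ℝ} (hΔ : 0 ≤ Δ)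
    (h : ∀ j k, |H j k - G j k| ≤ sampleScale j * sampleScale k * Δ) (v : Fin n₁ ⊕ Fin n₂ → ℝ) :
    ∑ j, ∑ k, v j * v k * G j k - 2 * Δ * ∑ j, v j ^ 2 ≤ ∑ j, ∑ k, v j * v k * H j k := by
  have h1 : ∑ j, ∑ k, v j * v k * G j k - ∑ j, ∑ k, v j * v k * H j k ≤
      (∑ j, |v j| * sampleScale j) ^ 2 * Δ := by
    rw [← Finset.sum_sub_distrib, sq, Finset.sum_mul_sum, Finset.sum_mul]
    refine Finset.sum_le_sum fun j _ => ?_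
    rw [← Finset.sum_sub_distrib, Finset.sum_mul]
    refine Finset.sum_le_sum fun k _ => ?_
    calc v j * v k * G j k - v j * v k * H j k = -(v j * v k * (H j k - G j k)) := by ring
      _ ≤ |v j * v k * (H j k - G j k)| := neg_le_abs _
      _ = |v j| * |v k| * |H j k - G j k| := by rw [abs_mul, abs_mul]
      _ ≤ |v j| * |v k| * (sampleScale j * sampleScale k * Δ) := by gcongr; exact h j k
      _ = _ := by ring
  -- The squared scales add up to at most `2`, so entrywise errors are not multiplied by the number
  -- of samples.
  have h2 : (∑ j, |v j| * sampleScale j) ^ 2 ≤ 2 * ∑ j, v j ^ 2 := by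
    refine (Finset.sum_mul_sq_le_sq_mul_sq _ _ _).trans ?_
    simp only [sq_abs]
    rw [mul_comm]
    gcongr
    exact sum_sampleScale_sq
  nlinarith [mul_le_mul_of_nonneg_right h2 hΔ]

theorem quadW_eq_sum {θ : Params m d} (ha : ∀ r, |θ.2 r| = 1) (v : Fin n₁ ⊕ Fin n₂ → ℝ) :
    quadW P.featureGrad θ v =
      ∑ j, ∑ k, v j * v k * (1 / (m : ℝ) * ∑ r, P.kernelW j k (θ.1 r)) := by
  unfold quadW kernelW
  have h1 : ∀ r, θ.2 r ^ 2 * ‖∑ j, v j • P.featureGrad j (θ.1 r)‖ ^ 2 =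
      ∑ j, ∑ k, v j * v k * inner ℝ (P.featureGrad j (θ.1 r)) (P.featureGrad k (θ.1 r)) := by
    intro r
    rw [← sq_abs (θ.2 r), ha, one_pow, one_mul, ← real_inner_self_eq_norm_sq, sum_inner]
    refine Finset.sum_congr rfl fun j _ => ?_
    rw [inner_sum]
    refine Finset.sum_congr rfl fun k _ => ?_
    rw [inner_smul_left, inner_smul_right]
    simp only [conj_trivial]
    ring
  simp only [h1]
  rw [Finset.sum_comm, Finset.mul_sum]
  refine Finset.sum_congr rfl fun j _ => ?_
  rw [Finset.sum_comm, Finset.mul_sum]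
  refine Finset.sum_congr rfl fun k _ => ?_
  rw [Finset.mul_sum, Finset.mul_sum, Finset.mul_sum]
  exact Finset.sum_congr rfl fun r _ => by ring

theorem quadA_eq_sum {θ : Params m d} (v : Fin n₁ ⊕ Fin n₂ → ℝ) :
    quadA P.feature θ v =
      ∑ j, ∑ k, v j * v k * (1 / (m : ℝ) * ∑ r, P.kernelA j k (θ.1 r)) := by
  unfold quadA kernelA
  simp only [sq, Finset.sum_mul_sum]
  rw [Finset.sum_comm, Finset.mul_sum]
  refine Finset.sum_congr rfl fun j _ => ?_
  rw [Finset.sum_comm, Finset.mul_sum]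
  refine Finset.sum_congr rfl fun k _ => ?_
  rw [Finset.mul_sum, Finset.mul_sum, Finset.mul_sum]
  exact Finset.sum_congr rfl fun r _ => by ring

/-- At regular weights the Gram matrix inherits the lower bound of its expectation. -/
theorem RegularWeights.le_quad (hσ : ActivationBound P.σ CM C ℓ) (hC : 0 < C) (hγ : 0 ≤ P.γ)
    (hx : ∀ p, ‖P.x p‖ ≤ 1) (hy : ∀ q, ‖P.y q‖ ≤ 1) (hd : 1 ≤ d) (hm : 1 ≤ m)
    (hW : (P.gramWInf m).PosDef) (hA : (P.gramAInf m).PosDef) {θ : Params m d}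
    {W₀ : Set (EuclideanSpace ℝ (Fin (d + 1)))} {Δ : ℝ} (hΔ : 0 ≤ Δ)
    (h : P.RegularWeights W₀ Δ θ.1) (ha : ∀ r, |θ.2 r| = 1)
    (hΔl : 16 * Δ ≤ lambdaMin (P.gramWInf m) + lambdaMin (P.gramAInf m))
    (v : Fin n₁ ⊕ Fin n₂ → ℝ) :
    3 / 4 * (lambdaMin (P.gramWInf m) + lambdaMin (P.gramAInf m)) * ∑ j, v j ^ 2 ≤
      quadW P.featureGrad θ v + quadA P.feature θ v := by
  rw [quadW_eq_sum ha, quadA_eq_sum]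
  have h1 := quadratic_form_perturb (G := P.gramWInf m)
    (H := fun j k => 1 / (m : ℝ) * ∑ r, P.kernelW j k (θ.1 r)) hΔ (fun j k => by
      rw [gramWInf_apply hσ.contDiff hm (integrable_kernelW hσ hC hγ hx hy hd _ _)]
      exact (h.2 j k).1) v
  have h2 := quadratic_form_perturb (G := P.gramAInf m)
    (H := fun j k => 1 / (m : ℝ) * ∑ r, P.kernelA j k (θ.1 r)) hΔ (fun j k => by
      rw [gramAInf_apply hσ.contDiff hm (integrable_kernelA hσ hC hγ hd _ _)]
      exact (h.2 j k).2) v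
  have h3 := lambdaMin_mul_le hW v
  have h4 := lambdaMin_mul_le hA v
  have h5 : 0 ≤ ∑ j, v j ^ 2 := Finset.sum_nonneg fun _ _ => sq_nonneg _
  -- Each of the two matrices loses `2Δ`, together at most a quarter of the sum of the eigenvalues.
  nlinarith [mul_le_mul_of_nonneg_right hΔl h5]

/-- The conditions on the initialization under which the training dynamics is controlled. -/
def RegularInit (P : Problem d n₁ n₂) (W₀ : Set (EuclideanSpace ℝ (Fin (d + 1)))) (Δ t : ℝ)
    (θ : Params m d) : Prop :=
  P.RegularWeights W₀ Δ θ.1 ∧ (∀ r, |θ.2 r| = 1) ∧ ∀ j,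
    (1 / √(m : ℝ) * ∑ r, θ.2 r * P.feature j (θ.1 r)) ^ 2 ≤
      2 * t * (1 / (m : ℝ) * ∑ r, P.kernelA j j (θ.1 r))

theorem isClosed_regularInit (hσ : ContDiff ℝ 3 P.σ)
    {W₀ : Set (EuclideanSpace ℝ (Fin (d + 1)))} (hW₀ : IsClosed W₀) (Δ t : ℝ) :
    IsClosed {θ : Params m d | P.RegularInit W₀ Δ t θ} := by
  have h : {θ : Params m d | P.RegularInit W₀ Δ t θ} =
      (Prod.fst ⁻¹' {w | P.RegularWeights W₀ Δ w}) ∩ ((⋂ r, {θ : Params m d | |θ.2 r| = 1}) ∩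
      ⋂ j, {θ : Params m d | (1 / √(m : ℝ) * ∑ r, θ.2 r * P.feature j (θ.1 r)) ^ 2 ≤
        2 * t * (1 / (m : ℝ) * ∑ r, P.kernelA j j (θ.1 r))}) := by
    ext w
    simp [RegularInit]
  rw [h]
  refine ((isClosed_regularWeights hσ hW₀ Δ).preimage continuous_fst).inter
    ((isClosed_iInter fun r => isClosed_eq (by fun_prop) (by fun_prop)).inter
    (isClosed_iInter fun j => ?_))
  have h1 := continuous_feature hσ j
  have h2 := continuous_kernelA hσ j j
  exact isClosed_le (by fun_prop) (by fun_prop)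

/-- For fixed inner weights the output is a Rademacher sum, and Hoeffding's inequality applies with
its own coefficients. The threshold thus contains the empirical second moment, which concentrates
near its mean of order `d²`, instead of the worst-case bound `Q²`. -/
theorem measureReal_initLaw_output_le (hσ : ContDiff ℝ 3 P.σ) {t : ℝ} (ht : 0 ≤ t)
    (j : Fin n₁ ⊕ Fin n₂) :
    (initLaw m d).real {θ | 2 * t * (1 / (m : ℝ) * ∑ r, P.kernelA j j (θ.1 r)) <
      (1 / √(m : ℝ) * ∑ r, θ.2 r * P.feature j (θ.1 r)) ^ 2} ≤ 2 * Real.exp (-t) := by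
  have h1 := continuous_feature hσ j
  have h2 := continuous_kernelA hσ j j
  have hmeas : MeasurableSet {θ : Params m d | 2 * t * (1 / (m : ℝ) *
      ∑ r, P.kernelA j j (θ.1 r)) < (1 / √(m : ℝ) * ∑ r, θ.2 r * P.feature j (θ.1 r)) ^ 2} :=
    (isOpen_lt (by fun_prop) (by fun_prop)).measurableSet
  rw [measureReal_def]
  refine ENNReal.toReal_le_of_le_ofReal (by positivity) ?_
  unfold initLaw
  rw [Measure.prod_apply hmeas]
  have h3 : ∀ w : Fin m → EuclideanSpace ℝ (Fin (d + 1)),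
      (Measure.pi fun _ : Fin m => rademacher) (Prod.mk w ⁻¹' {θ : Params m d | 2 * t *
        (1 / (m : ℝ) * ∑ r, P.kernelA j j (θ.1 r)) <
          (1 / √(m : ℝ) * ∑ r, θ.2 r * P.feature j (θ.1 r)) ^ 2}) ≤
      ENNReal.ofReal (2 * Real.exp (-t)) := by
    intro w
    have h4 := measureReal_lt_sq_sum_sub_integral_le rademacher (m := m)
      (f := fun r a => a * (1 / √(m : ℝ) * P.feature j (w r)))
      (c := fun r => |1 / √(m : ℝ) * P.feature j (w r)|) (fun r => by fun_prop)
      (fun r => ae_abs_eq_one_rademacher.mono fun a ha => by rw [abs_mul, ha, one_mul]) ht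
    rw [← ENNReal.ofReal_toReal (measure_ne_top _ _)]
    refine ENNReal.ofReal_le_ofReal (le_trans (le_of_eq ?_) h4)
    rw [measureReal_def]
    congr 2
    ext a
    simp only [Set.mem_preimage, Set.mem_ofPred_eq, integral_mul_const, integral_id_rademacher,
      zero_mul, sub_zero, sq_abs, kernelA]
    have h5 : ∑ r, a r * (1 / √(m : ℝ) * P.feature j (w r)) =
        1 / √(m : ℝ) * ∑ r, a r * P.feature j (w r) := by
      rw [Finset.mul_sum]; exact Finset.sum_congr rfl fun r _ => by ring
    have h6 : ∑ r, (1 / √(m : ℝ) * P.feature j (w r)) ^ 2 =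
        1 / (m : ℝ) * ∑ r, P.feature j (w r) * P.feature j (w r) := by
      rw [Finset.mul_sum]
      refine Finset.sum_congr rfl fun r _ => ?_
      rw [mul_pow, div_pow, Real.sq_sqrt (by positivity), one_pow, sq]
    rw [h5, h6]
  refine (lintegral_mono h3).trans ?_
  simp

instance : IsProbabilityMeasure (initLaw m d) := by unfold initLaw; infer_instance

theorem measureReal_not_regularInit_le (hσ : ActivationBound P.σ CM C ℓ) (hC : 0 < C)
    (hγ : 0 ≤ P.γ) (hx : ∀ p, ‖P.x p‖ ≤ 1) (hy : ∀ q, ‖P.y q‖ ≤ 1) (hd : 1 ≤ d) (hm : 1 ≤ m)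
    {W₀ : Set (EuclideanSpace ℝ (Fin (d + 1)))} (hW₀ : IsClosed W₀) {δ : ℝ} (hδ : δ ≤ 1)
    (hW₀m : (stdGaussian (EuclideanSpace ℝ (Fin (d + 1)))).real W₀ᶜ ≤ δ / m) {Q : ℝ}
    (hF : FeatureBounds W₀ P.feature P.featureGrad fun j => Q * sampleScale j)
    {t : ℝ} (ht : 0 ≤ t) :
    (initLaw m d).real {θ | P.RegularInit W₀ (gramDeviation P.γ C ℓ Q d m t) t θ}ᶜ ≤
      δ + 4 * ((n₁ : ℝ) + n₂) ^ 2 * Real.exp (-t) + 2 * ((n₁ : ℝ) + n₂) * Real.exp (-t) := by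
  set Δ := gramDeviation P.γ C ℓ Q d m t with hΔ
  have h1 := measureReal_not_regularWeights_le hσ hC hγ hx hy hd hm hW₀.measurableSet hδ hW₀m hF ht
  have h2 := (measurePreserving_fst (μ := Measure.pi fun _ : Fin m =>
    stdGaussian (EuclideanSpace ℝ (Fin (d + 1)))) (ν := Measure.pi fun _ : Fin m =>
      rademacher)).measureReal_preimage
    (isClosed_regularWeights (m := m) hσ.contDiff hW₀ Δ).measurableSet.compl.nullMeasurableSet
  have h3 : (initLaw m d) {θ : Params m d | ¬ ∀ r, |θ.2 r| = 1} = 0 := by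
    have ha : ∀ r : Fin m, ∀ᵐ a ∂(Measure.pi fun _ : Fin m => rademacher), |a r| = 1 := fun r =>
      (measurePreserving_eval (fun _ : Fin m => rademacher) r).quasiMeasurePreserving.ae
        ae_abs_eq_one_rademacher
    have hae : ∀ᵐ θ ∂(initLaw m d), ∀ r, |θ.2 r| = 1 :=
      ae_all_iff.2 fun r => (Measure.quasiMeasurePreserving_snd).ae (ha r)
    exact hae
  have h4 := fun j => measureReal_initLaw_output_le (m := m) (P := P) hσ.contDiff ht j
  have hsub : {θ | P.RegularInit W₀ Δ t θ}ᶜ ⊆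
      ((Prod.fst ⁻¹' {w | P.RegularWeights W₀ Δ w}ᶜ) ∪ {θ : Params m d | ¬ ∀ r, |θ.2 r| = 1}) ∪
      ⋃ j, {θ | 2 * t * (1 / (m : ℝ) * ∑ r, P.kernelA j j (θ.1 r)) <
        (1 / √(m : ℝ) * ∑ r, θ.2 r * P.feature j (θ.1 r)) ^ 2} := by
    intro θ hθ
    by_contra hcon
    simp only [Set.mem_union, Set.mem_iUnion, not_or, not_exists, Set.mem_ofPred_eq, not_not,
      not_lt, Set.mem_preimage, Set.mem_compl_iff] at hcon
    exact hθ ⟨hcon.1.1, hcon.1.2, hcon.2⟩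
  refine (measureReal_mono hsub).trans ((measureReal_union_le _ _).trans (add_le_add ?_ ?_))
  · refine (measureReal_union_le _ _).trans ?_
    rw [measureReal_def _ {θ : Params m d | ¬ ∀ r, |θ.2 r| = 1}, h3, ENNReal.toReal_zero, add_zero]
    exact h2.le.trans h1
  · refine (measureReal_iUnion_fintype_le _).trans ((Finset.sum_le_sum fun j _ => h4 j).trans
      (le_of_eq ?_))
    simp only [Finset.sum_const, Finset.card_univ, Fintype.card_sum, Fintype.card_fin, nsmul_eq_mul]
    push_cast
    ring

theorem sum_target_sq_le {F : ℝ} (hγ : 0 ≤ P.γ) (hf : ∀ p, |P.f (P.x p)| ≤ F)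
    (hg : ∀ q, |P.g (P.y q)| ≤ F) : ∑ j, P.target j ^ 2 ≤ 2 * (1 + P.γ) * F ^ 2 := by
  have h1 : ∀ j, P.target j ^ 2 ≤ sampleScale j ^ 2 * ((1 + P.γ) * F ^ 2) := by
    rintro (p | q)
    · simp only [target, sampleScale, Sum.elim_inl, mul_pow]
      gcongr
      have h2 := sq_le_sq' (by linarith [abs_le.1 (hf p)]) (abs_le.1 (hf p)).2
      nlinarith [sq_nonneg F]
    · simp only [target, sampleScale, Sum.elim_inr, mul_pow]
      have h2 := sq_le_sq' (by linarith [abs_le.1 (hg q)]) (abs_le.1 (hg q)).2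
      rw [Real.sq_sqrt (by positivity), div_pow, Real.sq_sqrt (by positivity)]
      calc P.γ / n₂ * P.g (P.y q) ^ 2 ≤ (1 + P.γ) / n₂ * F ^ 2 := by
            gcongr; linarith
        _ = _ := by ring
  refine (Finset.sum_le_sum fun j _ => h1 j).trans ?_
  rw [← Finset.sum_mul]
  have h3 : 0 ≤ (1 + P.γ) * F ^ 2 := by positivity
  nlinarith [mul_le_mul_of_nonneg_right (sum_sampleScale_sq (n₁ := n₁) (n₂ := n₂)) h3]

/-- The initial loss at a regular initialization. -/
theorem RegularInit.loss_le (hσ : ActivationBound P.σ CM C ℓ) (hC : 0 < C) (hγ : 0 ≤ P.γ)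
    (hx : ∀ p, ‖P.x p‖ ≤ 1) (hy : ∀ q, ‖P.y q‖ ≤ 1) (hd : 1 ≤ d) {F : ℝ}
    (hf : ∀ p, |P.f (P.x p)| ≤ F) (hg : ∀ q, |P.g (P.y q)| ≤ F) {θ : Params m d}
    {W₀ : Set (EuclideanSpace ℝ (Fin (d + 1)))} {Δ t : ℝ} (hΔ : 0 ≤ Δ) (ht : 0 ≤ t)
    (h : P.RegularInit W₀ Δ t θ) :
    P.loss θ ≤ 4 * t * (growthConst P.γ C ℓ ^ 2 * (momentConst * (d : ℝ) ^ 2) + Δ) +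
      2 * (1 + P.γ) * F ^ 2 := by
  set Γ := growthConst P.γ C ℓ ^ 2 * (momentConst * (d : ℝ) ^ 2) with hΓ
  have hΓ0 : 0 ≤ Γ := by
    have := one_le_momentConst
    positivity
  have h1 : ∀ j, 1 / (m : ℝ) * ∑ r, P.kernelA j j (θ.1 r) ≤ sampleScale j ^ 2 * (Γ + Δ) := by
    intro j
    have h2 := (abs_le.1 (h.1.2 j j).2).2
    have h3 : ∫ w, P.kernelA j j w ∂(stdGaussian _) ≤ sampleScale j ^ 2 * Γ := by
      refine (integral_mono (integrable_kernelA hσ hC hγ hd j j)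
        ((integrable_growth hd).const_mul _)
        (fun w => (le_abs_self _).trans (abs_kernelA_le hσ hC hγ j j w))).trans ?_
      rw [integral_const_mul]
      have h4 := integral_growth_le hd (norm_samplePoint_le hx hy j) (norm_samplePoint_le hx hy j)
      refine (mul_le_mul_of_nonneg_left h4 (mul_nonneg (mul_nonneg (sampleScale_nonneg j)
        (sampleScale_nonneg j)) (sq_nonneg _))).trans (le_of_eq ?_)
      rw [hΓ]; ring
    linarith
  have h5 : ∀ j, output P.feature P.target θ j ^ 2 ≤
      4 * t * (sampleScale j ^ 2 * (Γ + Δ)) + 2 * P.target j ^ 2 := by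
    intro j
    have h6 := h.2.2 j
    have h7 := mul_le_mul_of_nonneg_left (h1 j) (by positivity : 0 ≤ 2 * t)
    unfold output
    -- The target is split off by `(u - τ)² ≤ 2u² + 2τ²`.
    nlinarith [sq_nonneg (1 / √(m : ℝ) * ∑ r, θ.2 r * P.feature j (θ.1 r) + P.target j)]
  rw [loss_eq_sqLoss hσ.contDiff hγ]
  unfold sqLoss
  simp only [Pi.one_apply, one_mul]
  have h8 := Finset.sum_le_sum fun j (_ : j ∈ Finset.univ) => h5 j
  rw [Finset.sum_add_distrib, ← Finset.mul_sum, ← Finset.mul_sum, ← Finset.sum_mul] at h8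
  have h9 := sum_target_sq_le hγ hf hg
  have h10 : 4 * t * ((∑ j : Fin n₁ ⊕ Fin n₂, sampleScale j ^ 2) * (Γ + Δ)) ≤
      4 * t * (2 * (Γ + Δ)) := by
    gcongr
    exact sum_sampleScale_sq
  linarith

end Problem
end PINN
end

/-! ### Numerical consequences of the conditions on width, radii and step size -/

noncomputable section
namespace PINN

/-- The numerical consequences of the lower bound on the square root `r` of the width. -/
theorem width_estimates {κ Λ G K' c' s CB B D X μ lθ δ' r : ℝ} (hκ : 1 ≤ κ) (hΛ : 0 < Λ)
    (hG : 0 ≤ G) (hK' : 0 < K') (hc' : 0 < c')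
    (hs : s = 256 * κ ^ 2 * Λ + 64 * G * Λ + 4 * Λ ^ 2 * K' + 8 * Λ ^ 2 + 64 * κ * √K' / c')
    (hCB : 1 ≤ CB) (hB : 1 ≤ B) (hD : 1 ≤ D) (hDB : D ≤ B ^ 2) (hX : 1 / 2 ≤ X) (hμ : 0 < μ)
    (hμΛ : μ ≤ Λ) (hl : 0 < lθ) (hlΛ : lθ ≤ 2 * Λ) (hδ : 0 < δ') (hδ1 : δ' ≤ 1) (hr : 0 < r)
    (H : s * (CB ^ 4 * B ^ 9 * D * X) ≤ r * (μ * δ' * lθ)) :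
    16 * ((κ * CB * B ^ 3) ^ 2 * (4 * √X / r) + G * D ^ 2 / r) ≤ lθ ∧
    2 * (K' * D ^ 2 * X) ≤ r * (κ * CB * B ^ 3) ^ 2 ∧
    1 / r ≤ δ' / 2 ∧
    16 * (κ * CB * B ^ 3) * √(K' * D ^ 2 * X) / (r * lθ * (c' * (μ / (CB ^ 2 * B ^ 6)))) ≤
      δ' / 2 := by
  have hX0 : 0 < X := by linarith
  have hCB0 : 0 < CB := by linarith
  have hB0 : 0 < B := by linarith
  have hD0 : 0 < D := by linarith
  have hκ0 : 0 < κ := by linarith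
  set p := √X with hp
  have hp2 : p ^ 2 = X := Real.sq_sqrt hX0.le
  have hp12 : 1 / 2 ≤ p := Real.le_sqrt_of_sq_le (by linarith)
  have hp0 : 0 < p := by linarith
  have hkK : 0 < √K' := Real.sqrt_pos.2 hK'
  have hY0 : 0 < CB ^ 4 * B ^ 9 * D * X := by positivity
  -- Each summand of `s` serves one purpose: the first two bound the two parts of the Gram
  -- deviation, the others yield the remaining three claims in order.
  have hle : ∀ k, k ≤ s → k * (CB ^ 4 * B ^ 9 * D * X) ≤ r * (μ * δ' * lθ) := fun k hk =>
    (mul_le_mul_of_nonneg_right hk hY0.le).trans H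
  have t1 : 0 ≤ 256 * κ ^ 2 * Λ := by positivity
  have t2 : 0 ≤ 64 * G * Λ := by positivity
  have t3 : 0 ≤ 4 * Λ ^ 2 * K' := by positivity
  have t4 : 0 ≤ 8 * Λ ^ 2 := by positivity
  have t5 : 0 ≤ 64 * κ * √K' / c' := by positivity
  have hμδ : r * (μ * δ' * lθ) ≤ Λ * (r * lθ) := by
    calc r * (μ * δ' * lθ) = μ * δ' * (r * lθ) := by ring
      _ ≤ Λ * 1 * (r * lθ) := by gcongr
      _ = _ := by ring
  have hB9 : B ^ 6 ≤ B ^ 9 := pow_le_pow_right₀ hB (by norm_num)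
  have hB92 : B ^ 2 ≤ B ^ 9 := pow_le_pow_right₀ hB (by norm_num)
  have hC42 : CB ^ 2 ≤ CB ^ 4 := pow_le_pow_right₀ hCB (by norm_num)
  have hC4 : 1 ≤ CB ^ 4 := one_le_pow₀ hCB
  have hB91 : 1 ≤ B ^ 9 := one_le_pow₀ hB
  refine ⟨?_, ?_, ?_, ?_⟩
  · have h1 := (hle (256 * κ ^ 2 * Λ) (by linarith only [hs, t1, t2, t3, t4, t5])).trans hμδ
    have h2 := (hle (64 * G * Λ) (by linarith only [hs, t1, t2, t3, t4, t5])).trans hμδ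
    have h3 : 256 * κ ^ 2 * (CB ^ 4 * B ^ 9 * D * X) ≤ r * lθ := by
      refine le_of_mul_le_mul_left (le_trans (le_of_eq ?_) h1) hΛ; ring
    have h4 : 64 * G * (CB ^ 4 * B ^ 9 * D * X) ≤ r * lθ := by
      refine le_of_mul_le_mul_left (le_trans (le_of_eq ?_) h2) hΛ; ring
    have h5 : 128 * κ ^ 2 * (CB ^ 2 * B ^ 6 * p) ≤ r * lθ := by
      refine le_trans ?_ h3
      have : CB ^ 2 * B ^ 6 * p ≤ CB ^ 4 * B ^ 9 * (2 * (D * X)) := by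
        gcongr
        rw [← hp2]
        calc p = 1 * (2 * (1 / 2 * p)) := by ring
          _ ≤ D * (2 * (p * p)) := by gcongr
          _ = _ := by ring
      calc 128 * κ ^ 2 * (CB ^ 2 * B ^ 6 * p) ≤
            128 * κ ^ 2 * (CB ^ 4 * B ^ 9 * (2 * (D * X))) := by gcongr
        _ = _ := by ring
    have h6 : 32 * (G * D ^ 2) ≤ r * lθ := by
      refine le_trans ?_ h4
      have : D ^ 2 ≤ 2 * (CB ^ 4 * B ^ 9 * D * X) := by
        calc D ^ 2 = 1 * D * D * 1 := by ring
          _ ≤ CB ^ 4 * B ^ 9 * D * (2 * X) := by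
            gcongr
            · exact hDB.trans hB92
            · linarith
          _ = _ := by ring
      calc 32 * (G * D ^ 2) ≤ 32 * (G * (2 * (CB ^ 4 * B ^ 9 * D * X))) := by gcongr
        _ = _ := by ring
    have h7 : 16 * ((κ * CB * B ^ 3) ^ 2 * (4 * p / r) + G * D ^ 2 / r) =
        (64 * κ ^ 2 * (CB ^ 2 * B ^ 6 * p) + 16 * (G * D ^ 2)) / r := by
      field_simp; ring
    rw [h7, div_le_iff₀ hr]
    calc 64 * κ ^ 2 * (CB ^ 2 * B ^ 6 * p) + 16 * (G * D ^ 2) =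
          (128 * κ ^ 2 * (CB ^ 2 * B ^ 6 * p) + 32 * (G * D ^ 2)) / 2 := by ring
      _ ≤ (r * lθ + r * lθ) / 2 := by gcongr
      _ = lθ * r := by ring
  · have h1 := hle (4 * Λ ^ 2 * K') (by linarith only [hs, t1, t2, t3, t4, t5])
    have h2 : r * (μ * δ' * lθ) ≤ 2 * Λ ^ 2 * r := by
      calc r * (μ * δ' * lθ) ≤ r * (Λ * 1 * (2 * Λ)) := by gcongr
        _ = _ := by ring
    have h3 : 2 * K' * (CB ^ 4 * B ^ 9 * D * X) ≤ r := by
      refine le_of_mul_le_mul_left (le_trans (le_of_eq ?_) (h1.trans h2))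
        (by positivity : 0 < 2 * Λ ^ 2)
      ring
    have h4 : D * D * X ≤ CB ^ 4 * B ^ 9 * D * X := by
      calc D * D * X = 1 * D * D * X := by ring
        _ ≤ CB ^ 4 * B ^ 9 * D * X := by gcongr; exact hDB.trans hB92
    have h5 : 1 ≤ (κ * CB * B ^ 3) ^ 2 :=
      one_le_pow₀ (one_le_mul_of_one_le_of_one_le (one_le_mul_of_one_le_of_one_le hκ hCB)
        (one_le_pow₀ hB))
    calc 2 * (K' * D ^ 2 * X) = 2 * K' * (D * D * X) := by ring
      _ ≤ 2 * K' * (CB ^ 4 * B ^ 9 * D * X) := by gcongr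
      _ ≤ r * 1 := by rw [mul_one]; exact h3
      _ ≤ _ := by gcongr
  · have h1 := hle (8 * Λ ^ 2) (by linarith only [hs, t1, t2, t3, t4, t5])
    have h2 : r * (μ * δ' * lθ) ≤ 2 * Λ ^ 2 * (r * δ') := by
      calc r * (μ * δ' * lθ) ≤ r * (Λ * δ' * (2 * Λ)) := by gcongr
        _ = _ := by ring
    have h3 : 4 * (CB ^ 4 * B ^ 9 * D * X) ≤ r * δ' := by
      refine le_of_mul_le_mul_left (le_trans (le_of_eq ?_) (h1.trans h2))
        (by positivity : 0 < 2 * Λ ^ 2)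
      ring
    have h4 : 1 * 1 * 1 * (1 / 2) ≤ CB ^ 4 * B ^ 9 * D * X := by gcongr
    rw [div_le_iff₀ hr]
    linarith only [h3, h4]
  · have h1 := hle (64 * κ * √K' / c') (by linarith only [hs, t1, t2, t3, t4, t5])
    have h2 : √(K' * D ^ 2 * X) = √K' * D * p := by
      rw [Real.sqrt_mul (by positivity), Real.sqrt_mul hK'.le, Real.sqrt_sq hD0.le]
    rw [h2, div_le_iff₀ (by positivity)]
    have h3 : 64 * κ * √K' * (CB ^ 4 * B ^ 9 * D * X) ≤ c' * (r * (μ * δ' * lθ)) := by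
      rwa [div_mul_eq_mul_div, div_le_iff₀ hc', mul_comm _ c'] at h1
    have h4 : δ' / 2 * (r * lθ * (c' * (μ / (CB ^ 2 * B ^ 6)))) =
        c' * (r * (μ * δ' * lθ)) / 2 / (CB ^ 2 * B ^ 6) := by field_simp
    rw [h4, le_div_iff₀ (by positivity)]
    have h5 : CB ^ 3 * B ^ 9 * D * p ≤ CB ^ 4 * B ^ 9 * D * (2 * X) := by
      have : CB ^ 3 ≤ CB ^ 4 := pow_le_pow_right₀ hCB (by norm_num)
      gcongr
      rw [← hp2]
      calc p = 2 * (1 / 2 * p) := by ring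
        _ ≤ 2 * (p * p) := by gcongr
        _ = _ := by ring
    calc 16 * (κ * CB * B ^ 3) * (√K' * D * p) * (CB ^ 2 * B ^ 6) =
          16 * κ * √K' * (CB ^ 3 * B ^ 9 * D * p) := by ring
      _ ≤ 16 * κ * √K' * (CB ^ 4 * B ^ 9 * D * (2 * X)) := by gcongr
      _ = 64 * κ * √K' * (CB ^ 4 * B ^ 9 * D * X) / 2 := by ring
      _ ≤ _ := by gcongr

/-- The summand `2Λ` keeps the radius below `1/2`; `28 = 2 (8 + 6)` matches the weights of `Rw` and
`Ra` in the perturbation of the Gram forms. -/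
theorem radius_estimates {κ Λ CB B μ c : ℝ} (hΛ : 0 < Λ) (hCB : 1 ≤ CB) (hB : 1 ≤ B)
    (hμ : 0 < μ) (hμΛ : μ ≤ Λ) (hc : c ≤ 1 / (28 * κ ^ 2 + 2 * Λ)) :
    c * (μ / (CB ^ 2 * B ^ 6)) ≤ 1 / 2 ∧
      28 * ((κ * CB * B ^ 3) ^ 2 * (c * (μ / (CB ^ 2 * B ^ 6)))) ≤ μ := by
  have hCB0 : 0 < CB := by linarith
  have hB0 : 0 < B := by linarith
  have hκ := sq_nonneg κ
  have h1 : c * (μ / (CB ^ 2 * B ^ 6)) ≤ 1 / (28 * κ ^ 2 + 2 * Λ) * (μ / (CB ^ 2 * B ^ 6)) := by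
    gcongr
  constructor
  · refine h1.trans ?_
    have h2 : μ / (CB ^ 2 * B ^ 6) ≤ μ := div_le_self hμ.le
      (one_le_mul_of_one_le_of_one_le (one_le_pow₀ hCB) (one_le_pow₀ hB))
    rw [one_div_mul_eq_div, div_le_iff₀ (by positivity)]
    linarith
  · calc 28 * ((κ * CB * B ^ 3) ^ 2 * (c * (μ / (CB ^ 2 * B ^ 6)))) ≤
          28 * ((κ * CB * B ^ 3) ^ 2 * (1 / (28 * κ ^ 2 + 2 * Λ) * (μ / (CB ^ 2 * B ^ 6)))) := by
          gcongr
      _ = 28 * κ ^ 2 * μ / (28 * κ ^ 2 + 2 * Λ) := by field_simp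
      _ ≤ μ := by
        rw [div_le_iff₀ (by positivity)]
        linarith [mul_pos hμ hΛ]

/-- The summand `400 κ⁴` controls the second-order term, and `8Λ²` keeps the contraction factor
positive. -/
theorem step_size_estimates {κ Λ CB B lθ η : ℝ} (hκ : 0 < κ) (hΛ : 0 < Λ) (hCB : 1 ≤ CB)
    (hB : 1 ≤ B) (hl : 0 < lθ) (hlΛ : lθ ≤ 2 * Λ)
    (hη : η ≤ 1 / (400 * κ ^ 4 + 8 * Λ ^ 2) * (lθ / (CB ^ 4 * B ^ 12))) :
    400 * (κ * CB * B ^ 3) ^ 4 * η ≤ lθ ∧ η * lθ < 2 := by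
  have hCB0 : 0 < CB := by linarith
  have hB0 : 0 < B := by linarith
  have h1 : 1 ≤ CB ^ 4 * B ^ 12 :=
    one_le_mul_of_one_le_of_one_le (one_le_pow₀ hCB) (one_le_pow₀ hB)
  constructor
  · calc 400 * (κ * CB * B ^ 3) ^ 4 * η ≤ 400 * (κ * CB * B ^ 3) ^ 4 *
          (1 / (400 * κ ^ 4 + 8 * Λ ^ 2) * (lθ / (CB ^ 4 * B ^ 12))) := by gcongr
      _ = 400 * κ ^ 4 * lθ / (400 * κ ^ 4 + 8 * Λ ^ 2) := by field_simp
      _ ≤ lθ := by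
        rw [div_le_iff₀ (by positivity)]
        linarith [mul_nonneg hl.le (sq_nonneg Λ)]
  · have h2 : η ≤ 1 / (400 * κ ^ 4 + 8 * Λ ^ 2) * lθ :=
      hη.trans (by gcongr; exact div_le_self hl.le h1)
    calc η * lθ ≤ 1 / (400 * κ ^ 4 + 8 * Λ ^ 2) * lθ * lθ := by gcongr
      _ = lθ ^ 2 / (400 * κ ^ 4 + 8 * Λ ^ 2) := by ring
      _ < 2 := by
        rw [div_lt_iff₀ (by positivity)]
        have h3 : lθ ^ 2 ≤ (2 * Λ) ^ 2 := by gcongr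
        have h4 : 0 < Λ ^ 2 := by positivity
        have h5 : 0 < κ ^ 4 := by positivity
        linarith

/-- Since `D ≥ 1` and `X ≥ 1/2`, the additive constants are absorbed into one multiple of `D² X`.
The factor `5X` is the Hoeffding parameter. -/
theorem loss_estimate {g M A F Λ Δ D X : ℝ} (hA : 0 ≤ 2 * A * F ^ 2)
    (hX : 1 / 2 ≤ X) (hD : 1 ≤ D) (hΔ : 0 ≤ Δ) (hΔΛ : Δ ≤ Λ / 8) :
    4 * (5 * X) * (g ^ 2 * (M * D ^ 2) + Δ) + 2 * A * F ^ 2 ≤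
      (20 * (g ^ 2 * M + Λ / 8) + 4 * A * F ^ 2) * D ^ 2 * X := by
  have hX0 : 0 < X := by linarith
  have h1 : 1 ≤ D ^ 2 := one_le_pow₀ hD
  have h2 : Δ ≤ Λ / 8 * D ^ 2 := by
    calc Δ ≤ Λ / 8 * 1 := by linarith
      _ ≤ _ := by gcongr; linarith
  have h3 : 1 ≤ 2 * (D ^ 2 * X) := by
    calc (1 : ℝ) = 2 * (1 * (1 / 2)) := by norm_num
      _ ≤ _ := by gcongr
  calc 4 * (5 * X) * (g ^ 2 * (M * D ^ 2) + Δ) + 2 * A * F ^ 2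
      = 20 * X * (g ^ 2 * M * D ^ 2 + Δ) + 2 * A * F ^ 2 * 1 := by ring
    _ ≤ 20 * X * (g ^ 2 * M * D ^ 2 + Λ / 8 * D ^ 2) + 2 * A * F ^ 2 * (2 * (D ^ 2 * X)) := by
      gcongr
    _ = _ := by ring

/-- Taking the square root of the width condition with the second entry of the maximum. -/
theorem le_sqrt_width {s CB B D X lw la lθ δ' m : ℝ} (hs : 0 < s) (hCB : 0 < CB) (hB : 0 < B)
    (hD : 0 < D) (hX : 0 < X) (hlw : 0 < lw) (hla : 0 < la) (hl : 0 < lθ) (hδ : 0 < δ')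
    (h : s ^ 2 * (CB ^ 4 * D ^ 2 / min (lw ^ 2) (la ^ 2) * X ^ 2 *
      max X (CB ^ 4 * B ^ 18 / (δ' ^ 2 * lθ ^ 2))) ≤ m) :
    0 < m ∧ s * (CB ^ 4 * B ^ 9 * D * X) ≤ √m * (min lw la * δ' * lθ) := by
  have hμ : 0 < min lw la := lt_min hlw hla
  have h1 : min (lw ^ 2) (la ^ 2) = min lw la ^ 2 := by
    rcases le_total lw la with h | h
    · rw [min_eq_left h, min_eq_left (by gcongr)]
    · rw [min_eq_right h, min_eq_right (by gcongr)]
  rw [h1] at h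
  set μ := min lw la
  have h2 : (s * (CB ^ 4 * B ^ 9 * D * X) / (μ * δ' * lθ)) ^ 2 ≤ m := by
    refine le_trans (le_trans (le_of_eq ?_) (mul_le_mul_of_nonneg_left (mul_le_mul_of_nonneg_left
      (le_max_right X (CB ^ 4 * B ^ 18 / (δ' ^ 2 * lθ ^ 2))) (by positivity))
      (sq_nonneg s))) h
    field_simp
  have h3 : 0 < (s * (CB ^ 4 * B ^ 9 * D * X) / (μ * δ' * lθ)) ^ 2 := by positivity
  refine ⟨h3.trans_le h2, ?_⟩
  rw [← div_le_iff₀ (by positivity)]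
  exact Real.le_sqrt_of_sq_le h2

theorem one_le_radius (m d : ℕ) (δ : ℝ) : 1 ≤ radius m d δ := by
  unfold radius; linarith [Real.sqrt_nonneg (2 * ((d : ℝ) + 1) *
    Real.log (2 * (m : ℝ) * ((d : ℝ) + 1) / δ))]

/-- The argument of the logarithm is at least `4 > e`. The bound `d ≤ B²` lets powers of `B` absorb
a surplus factor `d` in `width_estimates`. -/
theorem le_radius_sq {m d : ℕ} {δ : ℝ} (hm : 1 ≤ m) (hd : 1 ≤ d) (hδ : 0 < δ) (hδ1 : δ < 1) :
    (d : ℝ) ≤ radius m d δ ^ 2 ∧ 0 ≤ Real.log (2 * (m : ℝ) * ((d : ℝ) + 1) / δ) := by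
  have hm' : (1 : ℝ) ≤ m := by exact_mod_cast hm
  have hd' : (1 : ℝ) ≤ d := by exact_mod_cast hd
  have h1 : 4 ≤ 2 * (m : ℝ) * ((d : ℝ) + 1) / δ := by
    rw [le_div_iff₀ hδ]
    nlinarith
  have h2 : 1 ≤ Real.log (2 * (m : ℝ) * ((d : ℝ) + 1) / δ) := by
    rw [Real.le_log_iff_exp_le (by linarith)]
    linarith [Real.exp_one_lt_d9]
  refine ⟨?_, by linarith⟩
  have h3 : 2 * ((d : ℝ) + 1) ≤ 2 * ((d : ℝ) + 1) *
      Real.log (2 * (m : ℝ) * ((d : ℝ) + 1) / δ) := by nlinarith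
  have h4 := Real.sq_sqrt (by linarith : 0 ≤ 2 * ((d : ℝ) + 1) *
      Real.log (2 * (m : ℝ) * ((d : ℝ) + 1) / δ))
  unfold radius
  nlinarith [Real.sqrt_nonneg (2 * ((d : ℝ) + 1) *
    Real.log (2 * (m : ℝ) * ((d : ℝ) + 1) / δ))]

theorem measureReal_compl_weightRegion_radius_le {m d : ℕ} {δ : ℝ} (hm : 1 ≤ m) (hd : 1 ≤ d)
    (hδ : 0 < δ) (hδ1 : δ < 1) :
    (stdGaussian (EuclideanSpace ℝ (Fin (d + 1)))).real (weightRegion d (radius m d δ - 1))ᶜ ≤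
      δ / m := by
  have hm' : (0 : ℝ) < m := by exact_mod_cast hm
  have h1 := measureReal_compl_weightRegion_le hd (le_radius_sq hm hd hδ hδ1).2
  rw [show radius m d δ - 1 = √(2 * ((d : ℝ) + 1) *
    Real.log (2 * (m : ℝ) * ((d : ℝ) + 1) / δ)) by unfold radius; ring]
  refine h1.trans (le_of_eq ?_)
  rw [Real.exp_neg, Real.exp_log (by positivity)]
  field_simp

/-- The exponent `5` is the smallest integer `p` with `4n² + 2n ≤ n^p` for all `n ≥ 2`. -/
theorem log_div_estimates {n δ : ℝ} (hn : 2 ≤ n) (hδ : 0 < δ) (hδ1 : δ < 1) :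
    1 / 2 ≤ Real.log (n / δ) ∧ 4 * n ^ 2 * Real.exp (-(5 * Real.log (n / δ))) +
      2 * n * Real.exp (-(5 * Real.log (n / δ))) ≤ δ := by
  have hn0 : 0 < n := by linarith
  constructor
  · have h1 : Real.log 2 ≤ Real.log (n / δ) := by
      refine Real.log_le_log (by norm_num) ?_
      rw [le_div_iff₀ hδ]; nlinarith
    linarith [Real.log_two_gt_d9]
  · have h2 : Real.exp (-(5 * Real.log (n / δ))) = (δ / n) ^ 5 := by
      rw [Real.exp_neg, show 5 * Real.log (n / δ) = ((5 : ℕ) : ℝ) * Real.log (n / δ) by norm_num,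
        Real.exp_nat_mul, Real.exp_log (by positivity), ← inv_pow, inv_div]
    rw [h2, div_pow, ← add_mul, mul_div_assoc', div_le_iff₀ (by positivity)]
    have h3 : δ ^ 5 ≤ δ := pow_le_of_le_one hδ.le hδ1.le (by norm_num)
    have h4 : 4 * n ^ 2 + 2 * n ≤ n ^ 5 := by
      have h5 : 8 ≤ n ^ 3 := by nlinarith [sq_nonneg n]
      nlinarith [mul_le_mul_of_nonneg_right h5 (sq_nonneg n)]
    calc (4 * n ^ 2 + 2 * n) * δ ^ 5 ≤ n ^ 5 * δ := by gcongr
      _ = δ * n ^ 5 := mul_comm _ _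

section Assembly

variable {V ι : Type*} [NormedAddCommGroup V] [InnerProductSpace ℝ V]

theorem FeatureBounds.mono {W W' : Set V} {ψ : ι → V → ℝ} {D : ι → V → V} {q : ι → ℝ}
    (h : FeatureBounds W ψ D q) (hW : W' ⊆ W) : FeatureBounds W' ψ D q where
  nonneg := h.nonneg
  val j w hw := h.val j w (hW hw)
  grad j w hw := h.grad j w (hW hw)
  lip j w hw w' hw' := h.lip j w (hW hw) w' (hW hw')
  gradLip j w hw w' hw' := h.gradLip j w (hW hw) w' (hW hw')
  taylor j w hw w' hw' := h.taylor j w (hW hw) w' (hW hw')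

end Assembly

/-! ### Convergence from a regular initialization -/

namespace Problem

variable {d n₁ n₂ m : ℕ} {P : Problem d n₁ n₂}

theorem gramDeviation_bounds (γ C ℓ Q : ℝ) (d : ℕ) {m : ℕ} (hm : (0 : ℝ) < m) {X : ℝ}
    (hX : 0 < X) : 0 ≤ gramDeviation γ C ℓ Q d m (5 * X) ∧
      gramDeviation γ C ℓ Q d m (5 * X) ≤ Q ^ 2 * (4 * √X / √(m : ℝ)) +
        growthConst γ C ℓ ^ 2 * momentConst * (d : ℝ) ^ 2 / √(m : ℝ) := by
  have hM := one_le_momentConst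
  unfold gramDeviation
  refine ⟨by positivity, ?_⟩
  rw [Real.sqrt_div (by positivity)]
  gcongr
  rw [Real.sqrt_le_left (by positivity), mul_pow, Real.sq_sqrt hX.le]
  linarith

/-- At a global minimum with vanishing loss, stochastic gradient descent does not move. -/
theorem sgd_of_loss_eq_zero (hσ : ContDiff ℝ 3 P.σ) (hγ : 0 ≤ P.γ) (η : ℝ) {θ₀ : Params m d}
    (h : P.loss θ₀ = 0) (S : ℕ → Finset (Fin n₁) × Finset (Fin n₂)) (t : ℕ) :
    P.sgd η θ₀ S t = θ₀ := by
  have hout : ∀ j, output P.feature P.target θ₀ j = 0 := by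
    rw [loss_eq_sqLoss hσ hγ] at h
    unfold sqLoss at h
    simp only [Pi.one_apply, one_mul] at h
    have h1 : ∑ j, output P.feature P.target θ₀ j ^ 2 = 0 := by linarith
    intro j
    have h2 := (Finset.sum_eq_zero_iff_of_nonneg fun j _ => sq_nonneg _).1 h1 j (Finset.mem_univ j)
    exact pow_eq_zero_iff two_ne_zero |>.1 h2
  induction t with
  | zero => rfl
  | succ t ih =>
    refine Prod.ext (funext fun r => ?_) (funext fun r => ?_)
    · rw [sgd_succ_fst hσ hγ, ih]
      simp [sqGradW, hout]
    · rw [sgd_succ_snd hσ hγ, ih]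
      simp [sqGradA, hout]

/-- Convergence of stochastic gradient descent from a regular initialization. -/
theorem RegularInit.sgd_convergence {CM : ℝ → ℝ} {C ℓ B Q lam η Rw Ra Δ t δ' : ℝ}
    {b₁ b₂ : ℕ} (hb₁ : b₁ ≤ n₁) (hb₂ : b₂ ≤ n₂) (h1b₁ : 1 ≤ b₁) (h1b₂ : 1 ≤ b₂)
    (hσ : ActivationBound P.σ CM C ℓ) (hC : 0 < C) (hγ : 0 ≤ P.γ)
    (hx : ∀ p, ‖P.x p‖ ≤ 1) (hy : ∀ q, ‖P.y q‖ ≤ 1) (hd : 1 ≤ d) (hm : 1 ≤ m)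
    (hW : (P.gramWInf m).PosDef) (hA : (P.gramAInf m).PosDef)
    (hlam : lam = lambdaMin (P.gramWInf m) + lambdaMin (P.gramAInf m)) (hlam0 : 0 < lam)
    {θ₀ : Params m d} (hΔ : 0 ≤ Δ) (hΔl : 16 * Δ ≤ lam)
    (h : P.RegularInit (weightRegion d (B - 1)) Δ t θ₀) (hQ : 0 < Q)
    (hF : FeatureBounds (weightRegion d B) P.feature P.featureGrad fun j => Q * sampleScale j)
    (hRw : 0 < Rw) (hRw2 : Rw ≤ 1 / 2) (hRa : 0 < Ra) (hRa1 : Ra ≤ 1) (hη : 0 < η)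
    (hR : Q ^ 2 * (8 * Rw + 6 * Ra) ≤ lam / 4) (hηQ : 400 * Q ^ 4 * η ≤ lam) (hηl : η * lam < 2)
    (hL₀Q : 2 * P.loss θ₀ ≤ √(m : ℝ) * Q ^ 2) (hδ' : 0 < δ') (hδ'1 : δ' < 1)
    (hm2 : 1 / √(m : ℝ) ≤ δ' / 2)
    (hL₀m : 16 * Q * √(P.loss θ₀) / (√(m : ℝ) * lam * min Rw Ra) ≤ δ' / 2) :
    (1 - δ') ^ 2 ≤ (batchesLaw hb₁ hb₂).real {S | P.stoppingTime η Rw Ra θ₀ S = ⊤} ∧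
    ∀ t : ℕ, Integrable (P.stoppedLoss η Rw Ra θ₀ t) (batchesLaw hb₁ hb₂) ∧
      ∫ S, P.stoppedLoss η Rw Ra θ₀ t S ∂(batchesLaw hb₁ hb₂) ≤
        (1 - η * lam / 2) ^ t * P.loss θ₀ := by
  have hloss := fun θ : Params m d => loss_eq_sqLoss hσ.contDiff hγ θ
  -- The two failure probabilities are at most `δ'/2` each, which is slightly better than required.
  have hsq : (1 - δ') ^ 2 ≤ 1 - δ' := by nlinarith
  have hL0 : 0 ≤ P.loss θ₀ := by
    rw [hloss]; exact sqLoss_nonneg fun _ => by simp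
  have : IsProbabilityMeasure (batchesLaw hb₁ hb₂) := by unfold batchesLaw; infer_instance
  -- The crossing estimate divides by the initial loss. If that loss is `0`, the iteration is
  -- stationary and never stopped.
  rcases hL0.eq_or_lt with hL0 | hL0
  · have hconst := sgd_of_loss_eq_zero hσ.contDiff hγ η hL0.symm
    have htop : ∀ S, P.stoppingTime η Rw Ra θ₀ S = ⊤ := fun S => by
      rw [stoppingTime_eq_top_iff]
      intro u
      rw [hconst]
      simp [hRw.le, hRa.le, ← hL0]
    have hzero : ∀ t, P.stoppedLoss η Rw Ra θ₀ t = fun _ => 0 := fun t => by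
      funext S
      unfold stoppedLoss
      simp [hconst, ← hL0]
    refine ⟨?_, fun t => ?_⟩
    · simp only [htop, Set.ofPred_true, probReal_univ]
      linarith
    · rw [hzero]
      simp [← hL0]
  · have hq : ∑ j : Fin n₁ ⊕ Fin n₂, (Q * sampleScale j) ^ 2 ≤ 2 * Q ^ 2 := by
      simp only [mul_pow, ← Finset.mul_sum]
      nlinarith [mul_le_mul_of_nonneg_left (sum_sampleScale_sq (n₁ := n₁) (n₂ := n₂)) (sq_nonneg Q)]
    have hΩq : ∀ S, ∑ j : Fin n₁ ⊕ Fin n₂, batchWeight S j * (Q * sampleScale j) ^ 2 ≤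
        2 * Q ^ 2 := by
      intro S
      have h1 : ∑ j : Fin n₁ ⊕ Fin n₂, batchWeight S j * (Q * sampleScale j) ^ 2 =
          Q ^ 2 * ∑ j, batchWeight S j * sampleScale j ^ 2 := by
        rw [Finset.mul_sum]; exact Finset.sum_congr rfl fun j _ => by ring
      rw [h1]
      nlinarith [mul_le_mul_of_nonneg_left (sum_batchWeight_sampleScale_sq S) (sq_nonneg Q)]
    rw [hloss] at hL0 hL₀Q hL₀m
    have key := features_sgd (ν := (batchLaw hb₁).prod (batchLaw hb₂)) (Ω := batchWeight)
      (Θ := P.sgd η θ₀) (θ₀ := θ₀) (τ := P.target) hF hm hQ hq batchWeight_nonneg hΩq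
      (integral_batchWeight hb₁ hb₂ h1b₁ h1b₂) (fun _ => rfl)
      (fun S t r => sgd_succ_fst hσ.contDiff hγ η θ₀ S t r)
      (fun S t r => sgd_succ_snd hσ.contDiff hγ η θ₀ S t r) hRw hRa hRa1 hη hlam0
      (fun r w hw => weightRegion_add (h.1.1 r) hRw2 hw) h.2.1
      (fun v => by rw [hlam]; exact h.1.le_quad hσ hC hγ hx hy hd hm hW hA hΔ h.2.1 (hlam ▸ hΔl) v)
      hR hηQ hηl hL0 hL₀Q
    simp only [← hloss] at key hL₀m
    refine ⟨?_, fun t => ?_⟩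
    · simp only [stoppingTime_eq_top_iff]
      exact (by linarith : (1 - δ') ^ 2 ≤ _).trans key.2
    · have h2 : P.stoppedLoss η Rw Ra θ₀ t = {S | ∀ u ≤ t,
          (∀ r, ‖(P.sgd η θ₀ S u).1 r - θ₀.1 r‖ ≤ Rw ∧ |(P.sgd η θ₀ S u).2 r - θ₀.2 r| ≤ Ra) ∧
          P.loss (P.sgd η θ₀ S u) ≤ √(m : ℝ) * P.loss θ₀}.indicator
            fun S => P.loss (P.sgd η θ₀ S t) := by
        funext S
        unfold stoppedLoss
        simp only [lt_stoppingTime_iff]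
      rw [h2]
      exact key.1 t

end Problem
end PINN
end

/-! ### Choice of the constants and conclusion -/

theorem mainTheorem1 (γ F C ℓ : ℝ) (hγ : 0 < γ) (hF : 0 ≤ F) (hC : 0 < C) (hℓ : 0 < ℓ) :
    ∃ c₀ : ℝ, 0 < c₀ ∧ ∀ cw ca : ℝ, 0 < cw → cw ≤ c₀ → 0 < ca → ca ≤ c₀ →
    ∃ K c : ℝ, 0 < K ∧ 0 < c ∧
    ∀ (d n₁ n₂ b₁ b₂ m : ℕ), 1 ≤ d → 1 ≤ b₁ → 1 ≤ b₂ → ∀ (hb₁ : b₁ ≤ n₁) (hb₂ : b₂ ≤ n₂)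
      (D : Set (EuclideanSpace ℝ (Fin d))) (P : PINN.Problem d n₁ n₂) (CM : ℝ → ℝ)
      (δ δ' η B CB lw la lθ Rw Ra : ℝ),
    IsOpen D → Bornology.IsBounded D →
    (∀ p, P.x p ∈ D ∧ ‖P.x p‖ ≤ 1 ∧ |P.f (P.x p)| ≤ F) →
    (∀ q, P.y q ∈ frontier D ∧ ‖P.y q‖ ≤ 1 ∧ |P.g (P.y q)| ≤ F) →
    P.γ = γ → PINN.ActivationBound P.σ CM C ℓ →
    (P.gramWInf m).PosDef → (P.gramAInf m).PosDef →
    0 < δ → δ < 1 → 0 < δ' → δ' < 1 → 0 < η →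
    B = PINN.radius m d δ → CB = CM B →
    lw = PINN.lambdaMin (P.gramWInf m) → la = PINN.lambdaMin (P.gramAInf m) → lθ = lw + la →
    Rw = cw * (min lw la / (CB ^ 2 * B ^ 6)) → Ra = ca * (min lw la / (CB ^ 2 * B ^ 6)) →
    K * (CB ^ 4 * (d : ℝ) ^ 2 / min (lw ^ 2) (la ^ 2) *
        Real.log (((n₁ : ℝ) + n₂) / δ) ^ 2 *
        max (Real.log (((n₁ : ℝ) + n₂) / δ)) (CB ^ 4 * B ^ 18 / (δ' ^ 2 * lθ ^ 2))) ≤ (m : ℝ) →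
    η ≤ c * (lθ / (CB ^ 4 * B ^ 12)) →
    ∃ A : Set (PINN.Params m d), MeasurableSet A ∧ 1 - 2 * δ ≤ (PINN.initLaw m d).real A ∧
      ∀ θ₀ ∈ A,
        (1 - δ') ^ 2 ≤
          (PINN.batchesLaw hb₁ hb₂).real {S | P.stoppingTime η Rw Ra θ₀ S = ⊤} ∧
        ∀ t : ℕ,
          Integrable (P.stoppedLoss η Rw Ra θ₀ t) (PINN.batchesLaw hb₁ hb₂) ∧
          ∫ S, P.stoppedLoss η Rw Ra θ₀ t S ∂(PINN.batchesLaw hb₁ hb₂) ≤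
            (1 - η * lθ / 2) ^ t * P.loss θ₀ := by
  set κ : ℝ := 16 * (1 + γ) with hκ
  -- `κ` fixes the feature scale `Q = κ C_B B³`, `Λ` bounds both eigenvalues, `G d²` bounds the
  -- kernel integrals up to sample scales, and `K' d² X` bounds the initial loss.
  set Λ := PINN.Problem.eigenvalueBound γ C ℓ with hΛdef
  set G := PINN.growthConst γ C ℓ ^ 2 * PINN.momentConst with hG
  set K' : ℝ := 20 * (G + Λ / 8) + 4 * (1 + γ) * F ^ 2 with hK'
  have hκ1 : 1 ≤ κ := by linarith
  have hκ0 : 0 < κ := by linarith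
  have hgc : 0 < PINN.growthConst γ C ℓ := by
    unfold PINN.growthConst PINN.activationConst; positivity
  have hΛ : 0 < Λ := by rw [hΛdef]; unfold PINN.Problem.eigenvalueBound; positivity
  have hG0 : 0 ≤ G := by
    have := PINN.one_le_momentConst
    positivity
  have hK'0 : 0 < K' := by positivity
  refine ⟨1 / (28 * κ ^ 2 + 2 * Λ), by positivity, fun cw ca hcw hcw₀ hca hca₀ => ?_⟩
  have hc' : 0 < min cw ca := lt_min hcw hca
  set s := 256 * κ ^ 2 * Λ + 64 * G * Λ + 4 * Λ ^ 2 * K' + 8 * Λ ^ 2 + 64 * κ * √K' / min cw ca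
    with hs
  have hs0 : 0 < s := by positivity
  refine ⟨s ^ 2, 1 / (400 * κ ^ 4 + 8 * Λ ^ 2), by positivity, by positivity, ?_⟩
  intro d n₁ n₂ b₁ b₂ m hd h1b₁ h1b₂ hb₁ hb₂ D P CM δ δ' η B CB lw la lθ Rw Ra _ _ hP hP' hPγ hσ
    hWpos hApos hδ hδ1 hδ' hδ'1 hη hB hCB hlw hla hlθ hRw hRa hmK hηc
  subst hPγ
  have hx : ∀ p, ‖P.x p‖ ≤ 1 := fun p => (hP p).2.1
  have hy : ∀ q, ‖P.y q‖ ≤ 1 := fun q => (hP' q).2.1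
  let q₀ : Fin n₂ := ⟨0, by omega⟩
  have : Nonempty (Fin n₁ ⊕ Fin n₂) := ⟨Sum.inr q₀⟩
  have hlw0 : 0 < lw := hlw ▸ PINN.lambdaMin_pos hWpos
  have hla0 : 0 < la := hla ▸ PINN.lambdaMin_pos hApos
  set μ := min lw la with hμ
  have hμ0 : 0 < μ := lt_min hlw0 hla0
  have hlθ0 : 0 < lθ := by linarith
  have hB1 : 1 ≤ B := hB ▸ PINN.one_le_radius m d δ
  have hB0 : 0 < B := by linarith
  have hCB1 : 1 ≤ CB := hCB ▸ hσ.one_le B hB0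
  have hCB0 : 0 < CB := by linarith
  have hd1 : (1 : ℝ) ≤ d := by exact_mod_cast hd
  have hn : (2 : ℝ) ≤ (n₁ : ℝ) + n₂ := by
    have h1 : (1 : ℝ) ≤ n₁ := by exact_mod_cast h1b₁.trans hb₁
    have h2 : (1 : ℝ) ≤ n₂ := by exact_mod_cast h1b₂.trans hb₂
    linarith
  obtain ⟨hX, hfail⟩ := PINN.log_div_estimates hn hδ hδ1
  set X := Real.log (((n₁ : ℝ) + n₂) / δ) with hXdef
  have hX0 : 0 < X := by linarith
  obtain ⟨hm0, H⟩ := PINN.le_sqrt_width hs0 hCB0 hB0 (by linarith : (0 : ℝ) < d) hX0 hlw0 hla0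
    hlθ0 hδ' hmK
  rw [← hμ] at H
  have hm : 1 ≤ m := by exact_mod_cast Nat.cast_pos.1 hm0
  set r := √(m : ℝ) with hr
  have hr0 : 0 < r := Real.sqrt_pos.2 hm0
  have hlwΛ : lw ≤ Λ := hlw ▸ PINN.Problem.lambdaMin_gramWInf_le hσ hC hγ.le hx hy hd hm q₀ hWpos
  have hlaΛ : la ≤ Λ := hla ▸ PINN.Problem.lambdaMin_gramAInf_le hσ hC hγ.le hy hd hm q₀ hApos
  have hμΛ : μ ≤ Λ := (min_le_left _ _).trans hlwΛ
  have hμl : 2 * μ ≤ lθ := by linarith [min_le_left lw la, min_le_right lw la]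
  have hlθΛ : lθ ≤ 2 * Λ := by linarith
  obtain ⟨hdB, hlogB⟩ := PINN.le_radius_sq hm hd hδ hδ1
  rw [← hB] at hdB
  obtain ⟨e1, e2, e3, e4⟩ := PINN.width_estimates hκ1 hΛ hG0 hK'0 hc' hs hCB1 hB1 hd1 hdB hX hμ0
    hμΛ hlθ0 hlθΛ hδ' hδ'1.le hr0 H
  set Q := κ * CB * B ^ 3 with hQ
  have hQ0 : 0 < Q := by positivity
  have hF' : PINN.FeatureBounds (PINN.weightRegion d B) P.feature P.featureGrad
      fun j => Q * PINN.sampleScale j := by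
    have := PINN.Problem.featureBounds hσ hγ.le hB1 hx hy
    rw [← hCB] at this
    exact this
  set Δ := PINN.Problem.gramDeviation P.γ C ℓ Q d m (5 * X) with hΔ
  obtain ⟨hΔ0, hΔl⟩ := PINN.Problem.gramDeviation_bounds P.γ C ℓ Q d hm0 hX0
  have hΔl := (mul_le_mul_of_nonneg_left hΔl (by norm_num : (0 : ℝ) ≤ 16)).trans e1
  have hregion := PINN.measureReal_compl_weightRegion_radius_le hm hd hδ hδ1
  rw [← hB] at hregion
  -- With `t = 5X` the concentration failures add up to at most `δ`; the other `δ` is spent on the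
  -- region of the weights.
  have hprob := PINN.Problem.measureReal_not_regularInit_le hσ hC hγ.le hx hy hd hm
    (PINN.isClosed_weightRegion (B - 1)) hδ1.le hregion
    (hF'.mono (PINN.weightRegion_mono (by linarith))) (by positivity : 0 ≤ 5 * X)
  have hAmeas : MeasurableSet {θ : PINN.Params m d |
      P.RegularInit (PINN.weightRegion d (B - 1)) Δ (5 * X) θ} :=
    (PINN.Problem.isClosed_regularInit hσ.contDiff (PINN.isClosed_weightRegion (B - 1))
      Δ (5 * X)).measurableSet
  refine ⟨{θ | P.RegularInit (PINN.weightRegion d (B - 1)) Δ (5 * X) θ}, hAmeas, ?_,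
    fun θ₀ hθ₀ => ?_⟩
  · rw [probReal_compl_eq_one_sub hAmeas] at hprob
    linarith
  have hloss : P.loss θ₀ ≤ K' * (d : ℝ) ^ 2 * X := by
    refine (hθ₀.loss_le hσ hC hγ.le hx hy hd (fun p => (hP p).2.2) (fun q => (hP' q).2.2) hΔ0
      (by positivity)).trans ?_
    exact PINN.loss_estimate (by positivity) hX hd1 hΔ0 (by linarith)
  set ρ := μ / (CB ^ 2 * B ^ 6) with hρ
  have hρ0 : 0 < ρ := by positivity
  have hc₀ : ∀ c : ℝ, c ≤ 1 / (28 * κ ^ 2 + 2 * Λ) → c * ρ ≤ 1 / 2 ∧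
      28 * (Q ^ 2 * (c * ρ)) ≤ μ := fun c hc =>
    PINN.radius_estimates hΛ hCB1 hB1 hμ0 hμΛ hc
  have hRmin : min Rw Ra = min cw ca * ρ := by
    rw [hRw, hRa, min_mul_of_nonneg _ _ hρ0.le]
  have hηl : 400 * Q ^ 4 * η ≤ lθ ∧ η * lθ < 2 :=
    PINN.step_size_estimates hκ0 hΛ hCB1 hB1 hlθ0 hlθΛ hηc
  have hRwb := hc₀ cw hcw₀
  have hRab := hc₀ ca hca₀
  rw [← hRw] at hRwb
  rw [← hRa] at hRab
  refine hθ₀.sgd_convergence hb₁ hb₂ h1b₁ h1b₂ hσ hC hγ.le hx hy hd hm hWpos hApos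
    (by rw [hlθ, hlw, hla]) hlθ0 hΔ0 hΔl hQ0 hF' (by rw [hRw]; positivity) hRwb.1
    (by rw [hRa]; positivity) (by linarith [hRab.1]) hη ?_ hηl.1 hηl.2
    (le_trans (by linarith) e2) hδ' hδ'1 e3 (le_trans ?_ e4)
  · linarith only [hRwb.2, hRab.2, hμl]
  · rw [hRmin]
    exact div_le_div_of_nonneg_right (mul_le_mul_of_nonneg_left (Real.sqrt_le_sqrt hloss)
      (by positivity)) (by positivity)
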